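/- **Conventions (rational case).** $sl(2)$ has generators $e,f,h$ with $[h,e]=e$, $[h,f]=-f$, $[e,f]=2h$; $V(\lambda)$ is the Verma module with highest vector $v$, $hv=\lambda v$, and basis $f^lv$, $l\ge 0$; put $B_l(\lambda)=l!\prod_{a=0}^{l-1}(2\lambda-a)$, the value $B_\lambda(f^lv,f^lv)$ of the Shapovalov form. The Yangian $Y(gl(2))$ is generated by the coefficients of $T_{ij}(u)=\delta_{ij}+\sum_{a\ge1}T_{ij}^{(a)}u^{-a}$, $i,j\in\{1,2\}$, with relations $R(x-y)\,T_{(1)}(x)T_{(2)}(y)=T_{(2)}(y)T_{(1)}(x)\,R(x-y)$, where $R(x)=x\,\mathrm{Id}+P$, $P$ is the flip of $\mathbb C^2\otimes\mathbb C^2$, $T_{(1)}=1\otimes T$, $T_{(2)}=T\otimes1$; its comultiplication is $T_{ij}(u)\mapsto\sum_aT_{ia}(u)\otimes T_{aj}(u)$. The evaluation module $V(z,\lambda)$, $z\in\mathbb C$, is $V(\lambda)$ with $T_{11}=1+\frac{h}{u-z}$, $T_{12}=\frac{f}{u-z}$, $T_{21}=\frac{e}{u-z}$, $T_{22}=1-\frac{h}{u-z}$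 (expanded at $u=\infty$). For $z=(z_1,z_2)$, $\lambda=(\lambda_1,\lambda_2)\in\mathbb C^2$ let $V(z,\lambda)=V(z_1,\lambda_1)\otimes V(z_2,\lambda_2)$, on which the Yangian is made to act by the normalized series $\widetilde T_{ij}(u)=T_{ij}(u)\prod_{a=1}^2\frac{u-z_a}{u-z_a-\lambda_a}$ (that is, through the automorphism of $Y(gl(2))$ multiplying all $T_{ij}(u)$ by this scalar series). **Parameters.** For permutations $\sigma,\sigma'$ of $\{1,2\}$ define $z_\sigma^{\sigma'},\lambda_\sigma^{\sigma'}\in\mathbb C^2$ by $(z_\sigma^{\sigma'})_a+(\lambda_\sigma^{\sigma'})_a=z_{\sigma(a)}+\lambda_{\sigma(a)}$ and $(z_\sigma^{\sigma'})_a-(\lambda_\sigma^{\sigma'})_a=z_{\sigma'(a)}-\lambda_{\sigma'(a)}$. In particular $(\lambda_{id}^{(12)})_1=\tfrac12(z_1-z_2+\lambda_1+\lambda_2)$ and $(\lambda^{id}_{(12)})_1=\tfrac12(-z_1+z_2+\lambda_1+\lambda_2)$. Consider the three cases $\widehat R$: $\sigma'=\sigma=(12)$; $D$: $\sigma'=id$,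 $\sigma=(12)$; $N$: $\sigma'=(12)$, $\sigma=id$; and let $(u,\omega)=(z_\sigma^{\sigma'},\lambda_\sigma^{\sigma'})$ be the corresponding parameters of the target. **Theorem (rational case).** Let $z_a-z_b+\lambda_a+\lambda_b\notin\mathbb Z_{\ge0}$ for all $a,b\in\{1,2\}$. In each of the three cases: 1. There is a unique isomorphism of Yangian modules $A:V(z,\lambda)\to V(u,\omega)$ mapping the tensor product of the highest vectors to the tensor product of the highest vectors (it is called the rational $\widehat R$, $D$, $N$ matrix, respectively). 2. For every $l\ge0$ there is a unique singular vector $v_{(\lambda_1,\lambda_2;l)}\in V(\lambda_1)\otimes V(\lambda_2)$ of the form $B_l(\lambda_1)^{-1}f^lv_1\otimes v_2+\sum_{a=1}^lc_a\,f^{l-a}v_1\otimes f^av_2$ with $e\,v_{(\lambda_1,\lambda_2;l)}=0$; and likewise for $(\omega_1,\omega_2)$. 3. $A$ commutes with the action of $sl(2)$, and for all $l\ge 0$ $$A\,v_{(\lambda_1,\lambda_2;l)}=\frac{B_l\big((\lambda_{id}^{(12)})_1\big)}{B_l\big((\omega_{id}^{(12)})_1\big)}\,v_{(\omega_1,\omega_2;l)},\qquad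 (\omega_{id}^{(12)})_1=\tfrac12(u_1-u_2+\omega_1+\omega_2).$$ **Conventions (trigonometric case).** Let $p\in\mathbb C\setminus\mathbb Q$, $q^x=\exp(\pi ix/p)$, $q=q^1$ (so $q$ is not a root of unity), $[x]_q=\frac{q^x-q^{-x}}{q-q^{-1}}$. $U_qsl(2)$ has generators $e_q,f_q,q^{\pm h}$ with $q^hq^{-h}=q^{-h}q^h=1$, $q^he_q=q\,e_qq^h$, $q^hf_q=q^{-1}f_qq^h$, $[e_q,f_q]=\frac{q^{2h}-q^{-2h}}{q-q^{-1}}$ and comultiplication $e_q\mapsto e_q\otimes q^h+q^{-h}\otimes e_q$, $f_q\mapsto f_q\otimes q^h+q^{-h}\otimes f_q$, $q^{\pm h}\mapsto q^{\pm h}\otimes q^{\pm h}$. $V_q(\lambda)$ is the Verma module with highest vector $v^q$, $q^hv^q=q^\lambda v^q$, and $B^q_l(\lambda)=\prod_{a=1}^{l}[a]_q\prod_{a=0}^{l-1}[2\lambda-a]_q$ is the value of its Shapovalov form on $(f_q^lv^q,f_q^lv^q)$. $U_q\widehat{gl(2)}$ is generated by the coefficients of $L^\pm_{ij}(\xi)=\sum_{s\ge0}L_{ij}^{(\pm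 s)}\xi^{\pm s}$, with $L_{12}^{(+0)}=L_{21}^{(-0)}=0$, $L^{(\pm0)}_{11}L^{(\pm0)}_{22}=L^{(\pm0)}_{22}L^{(\pm0)}_{11}=1$, $L_{ii}^{(\pm0)}L_{ii}^{(\mp0)}=1$, $$R(\xi/\zeta)L^\pm_{(1)}(\xi)L^\pm_{(2)}(\zeta)=L^\pm_{(2)}(\zeta)L^\pm_{(1)}(\xi)R(\xi/\zeta),\quad R(\xi/\zeta)L^+_{(1)}(\xi)L^-_{(2)}(\zeta)=L^-_{(2)}(\zeta)L^+_{(1)}(\xi)R(\xi/\zeta),$$ where $L_{(1)}=L\otimes1$, $L_{(2)}=1\otimes L$ and $R(\xi)=(\xi q-q^{-1})(e_{11}\otimes e_{11}+e_{22}\otimes e_{22})+(\xi-1)(e_{11}\otimes e_{22}+e_{22}\otimes e_{11})+\xi(q-q^{-1})e_{12}\otimes e_{21}+(q-q^{-1})e_{21}\otimes e_{12}$. Its comultiplication is $L^\pm_{ij}(\xi)\mapsto\sum_aL^\pm_{aj}(\xi)\otimes L^\pm_{ia}(\xi)$. The evaluation module $V_q(z,\lambda)$, $z\in\mathbb C$,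 is $V_q(\lambda)$ on which $L^\pm_{ij}(\xi)$ acts by the following expressions with $\xi$ replaced by $\xi q^{-2z}$: $L^\pm_{11}=q^{\mp h}-q^{\pm h}\xi^{\pm1}$, $L^\pm_{22}=q^{\pm h}-q^{\mp h}\xi^{\pm1}$, $L^+_{12}=-(q-q^{-1})\xi f_q$, $L^-_{12}=(q-q^{-1})f_q$, $L^+_{21}=-(q-q^{-1})e_q$, $L^-_{21}=(q-q^{-1})\xi^{-1}e_q$. For $z,\lambda\in\mathbb C^2$ put $V_q(z,\lambda)=V_q(z_1,\lambda_1)\otimes V_q(z_2,\lambda_2)$. **Theorem (trigonometric case).** Let $z_a-z_b+\lambda_a+\lambda_b\notin\mathbb Z_{\ge0}+p\mathbb Z$ for all $a,b\in\{1,2\}$. In each of the three cases above: 1. There is a unique isomorphism of $U_q\widehat{gl(2)}$-modules $A^q:V_q(z,\lambda)\to V_q(u,\omega)$ mapping the tensor product of the highest vectors to the tensor product of the highest vectors (it is called the trigonometric $\widehat R^q$, $D^q$, $N^q$ matrix, respectively). 2. For every $l\ge0$ there is a unique singular vector $v^q_{(\lambda_1,\lambda_2;l)}\in V_q(\lambda_1)\otimes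 V_q(\lambda_2)$ of the form $B^q_l(\lambda_1)^{-1}f_q^lv^q_1\otimes v^q_2+\sum_{a=1}^ld_a\,f_q^{l-a}v^q_1\otimes f_q^av^q_2$ with $e_q\,v^q_{(\lambda_1,\lambda_2;l)}=0$; and likewise for $(\omega_1,\omega_2)$. 3. $A^q$ commutes with the action of $U_qsl(2)$, and for all $l\ge0$ $$A^q\,v^q_{(\lambda_1,\lambda_2;l)}=q^{\,l(\lambda_1-\omega_1)}\,\frac{B^q_l\big((\lambda^{id}_{(12)})_1\big)}{B^q_l\big((\omega^{id}_{(12)})_1\big)}\,v^q_{(\omega_1,\omega_2;l)},\qquad(\omega^{id}_{(12)})_1=\tfrac12(-u_1+u_2+\omega_1+\omega_2).$$ -/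

import Mathlib

open scoped TensorProduct Kronecker

noncomputable section

namespace SpectralDecomposition

/-! ### Formal series in two variables and `2 × 2` matrices of generating series -/

section Series

variable {E : Type*} [Ring E]

/-- A one-variable series, regarded as a series in the first of two commuting variables. -/
def inFirst : PowerSeries E →+* PowerSeries (PowerSeries E) :=
  PowerSeries.C

/-- A one-variable series, regarded as a series in the second of two commuting variables. -/
def inSecond : PowerSeries E →+* PowerSeries (PowerSeries E) :=
  PowerSeries.map PowerSeries.C

/-- The first formal variable. -/
def var₁ : PowerSeries (PowerSeries E) := inFirst PowerSeries.X

/-- The second formal variable. -/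
def var₂ : PowerSeries (PowerSeries E) := inSecond PowerSeries.X

/-- `T ⊗ 1`: the matrix `T` in the first factor of `End(ℂ²) ⊗ End(ℂ²)`. -/
def leg₁ {S : Type*} [Ring S] (T : Matrix (Fin 2) (Fin 2) S) :
    Matrix (Fin 2 × Fin 2) (Fin 2 × Fin 2) S := T ⊗ₖ (1 : Matrix (Fin 2) (Fin 2) S)

/-- `1 ⊗ T`: the matrix `T` in the second factor of `End(ℂ²) ⊗ End(ℂ²)`. -/
def leg₂ {S : Type*} [Ring S] (T : Matrix (Fin 2) (Fin 2) S) :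
    Matrix (Fin 2 × Fin 2) (Fin 2 × Fin 2) S := (1 : Matrix (Fin 2) (Fin 2) S) ⊗ₖ T

theorem leg₁_mul {S : Type*} [Ring S] (A B : Matrix (Fin 2) (Fin 2) S) :
    leg₁ (A * B) = leg₁ A * leg₁ B := by
  ext ⟨i, k⟩ ⟨j, l⟩
  fin_cases k <;> fin_cases l <;>
    simp [leg₁, Matrix.mul_apply, Fintype.sum_prod_type, Fin.sum_univ_two]

theorem leg₂_mul {S : Type*} [Ring S] (A B : Matrix (Fin 2) (Fin 2) S) :
    leg₂ (A * B) = leg₂ A * leg₂ B := by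
  ext ⟨i, k⟩ ⟨j, l⟩
  fin_cases i <;> fin_cases j <;>
    simp [leg₂, Matrix.mul_apply, Fintype.sum_prod_type, Fin.sum_univ_two]

theorem leg_comm {S : Type*} [Ring S] (A B : Matrix (Fin 2) (Fin 2) S)
    (h : ∀ i j k l, Commute (A i j) (B k l)) : leg₁ A * leg₂ B = leg₂ B * leg₁ A := by
  ext ⟨i, k⟩ ⟨j, l⟩
  fin_cases i <;> fin_cases j <;> fin_cases k <;> fin_cases l <;>
    simp [leg₁, leg₂, Matrix.mul_apply, Fintype.sum_prod_type, Fin.sum_univ_two, (h _ _ _ _).eq]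

/-- The relation `R T₍₁₎ T₍₂₎ = T₍₂₎ T₍₁₎ R` passes to the product of two mutually commuting
solutions. -/
theorem rtt_mul {S : Type*} [Ring S] (R : Matrix (Fin 2 × Fin 2) (Fin 2 × Fin 2) S)
    (A A' B B' : Matrix (Fin 2) (Fin 2) S)
    (hA : R * leg₁ A * leg₂ A' = leg₂ A' * leg₁ A * R)
    (hB : R * leg₁ B * leg₂ B' = leg₂ B' * leg₁ B * R)
    (h : ∀ i j k l, Commute (B i j) (A' k l)) (h' : ∀ i j k l, Commute (A i j) (B' k l)) :
    R * leg₁ (A * B) * leg₂ (A' * B') = leg₂ (A' * B') * leg₁ (A * B) * R := by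
  have e := leg_comm B A' h
  have e' := leg_comm A B' h'
  rw [leg₁_mul, leg₂_mul]
  calc R * (leg₁ A * leg₁ B) * (leg₂ A' * leg₂ B')
      = R * leg₁ A * (leg₁ B * leg₂ A') * leg₂ B' := by noncomm_ring
    _ = (R * leg₁ A * leg₂ A') * leg₁ B * leg₂ B' := by rw [e]; noncomm_ring
    _ = leg₂ A' * leg₁ A * (R * leg₁ B * leg₂ B') := by rw [hA]; noncomm_ring
    _ = leg₂ A' * (leg₁ A * leg₂ B') * leg₁ B * R := by rw [hB]; noncomm_ring
    _ = leg₂ A' * leg₂ B' * (leg₁ A * leg₁ B) * R := by rw [e']; noncomm_ring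

/-- The same for the other order of the two legs. -/
theorem rtt_mul' {S : Type*} [Ring S] (R : Matrix (Fin 2 × Fin 2) (Fin 2 × Fin 2) S)
    (A A' B B' : Matrix (Fin 2) (Fin 2) S)
    (hA : R * leg₂ A * leg₁ A' = leg₁ A' * leg₂ A * R)
    (hB : R * leg₂ B * leg₁ B' = leg₁ B' * leg₂ B * R)
    (h : ∀ i j k l, Commute (A' i j) (B k l)) (h' : ∀ i j k l, Commute (B' i j) (A k l)) :
    R * leg₂ (A * B) * leg₁ (A' * B') = leg₁ (A' * B') * leg₂ (A * B) * R := by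
  have e := leg_comm A' B h
  have e' := leg_comm B' A h'
  rw [leg₁_mul, leg₂_mul]
  calc R * (leg₂ A * leg₂ B) * (leg₁ A' * leg₁ B')
      = R * leg₂ A * (leg₂ B * leg₁ A') * leg₁ B' := by noncomm_ring
    _ = (R * leg₂ A * leg₁ A') * leg₂ B * leg₁ B' := by rw [← e]; noncomm_ring
    _ = leg₁ A' * leg₂ A * (R * leg₂ B * leg₁ B') := by rw [hA]; noncomm_ring
    _ = leg₁ A' * (leg₂ A * leg₁ B') * leg₂ B * R := by rw [hB]; noncomm_ring
    _ = leg₁ A' * leg₁ B' * (leg₂ A * leg₂ B) * R := by rw [← e']; noncomm_ring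

theorem commute_series {x y : PowerSeries E}
    (h : ∀ m n, Commute (PowerSeries.coeff m x) (PowerSeries.coeff n y)) : Commute x y := by
  ext n
  rw [PowerSeries.coeff_mul, PowerSeries.coeff_mul,
    ← Finset.Nat.sum_antidiagonal_swap]
  exact Finset.sum_congr rfl fun a _ => (h _ _).eq

theorem commute_two {x y : PowerSeries E}
    (h : ∀ m n, Commute (PowerSeries.coeff m x) (PowerSeries.coeff n y)) :
    Commute (inFirst x) (inSecond y) := by
  refine commute_series fun m n => ?_
  simp only [inFirst, inSecond, PowerSeries.coeff_C, PowerSeries.coeff_map]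
  split_ifs with hm
  · refine commute_series fun m n => ?_
    simp only [PowerSeries.coeff_C]
    split_ifs with hn
    · exact h _ _
    · exact Commute.zero_right _
  · exact Commute.zero_left _

end Series

/-! ### Central scalars in two-variable series -/

section Central

variable {M : Type*} [AddCommGroup M] [Module ℂ M]

/-- Two-variable series with complex coefficients inside those with operator coefficients. -/
def scalarHom (M : Type*) [AddCommGroup M] [Module ℂ M] :
    PowerSeries (PowerSeries ℂ) →+* PowerSeries (PowerSeries (Module.End ℂ M)) :=
  PowerSeries.map (PowerSeries.map (algebraMap ℂ (Module.End ℂ M)))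

theorem scalarHom_comm (c : PowerSeries (PowerSeries ℂ))
    (s : PowerSeries (PowerSeries (Module.End ℂ M))) :
    scalarHom M c * s = s * scalarHom M c := by
  refine commute_series fun m n => commute_series fun m' n' => ?_
  simp only [scalarHom, PowerSeries.coeff_map]
  exact Algebra.commutes _ _

theorem scalarHom_first (g : PowerSeries ℂ) :
    scalarHom M (inFirst g) =
      inFirst (PowerSeries.map (algebraMap ℂ (Module.End ℂ M)) g) := by
  simp [scalarHom, inFirst]

theorem scalarHom_second (g : PowerSeries ℂ) :
    scalarHom M (inSecond g) =
      inSecond (PowerSeries.map (algebraMap ℂ (Module.End ℂ M)) g) := by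
  ext m n
  simp only [scalarHom, inSecond, PowerSeries.coeff_map, PowerSeries.coeff_C]
  split_ifs <;> simp

theorem scalarHom_var₁ : scalarHom M var₁ = var₁ := by
  simp [var₁, scalarHom_first]

theorem scalarHom_var₂ : scalarHom M var₂ = var₂ := by
  simp [var₂, scalarHom_second]

end Central

/-! ### `sl(2)` and the Yangian -/

/-- A representation of `sl(2)` with `[h,e] = e`, `[h,f] = -f`, `[e,f] = 2h`. -/
structure Sl2Module (M : Type*) [AddCommGroup M] [Module ℂ M] where
  e : Module.End ℂ M
  f : Module.End ℂ M
  h : Module.End ℂ M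
  h_e : h * e - e * h = e
  h_f : h * f - f * h = -f
  e_f : e * f - f * e = (2 : ℂ) • h

/-- The tensor product of `sl(2)`-modules. -/
def Sl2Module.tensor {M N : Type*} [AddCommGroup M] [Module ℂ M] [AddCommGroup N] [Module ℂ N]
    (A : Sl2Module M) (B : Sl2Module N) : Sl2Module (M ⊗[ℂ] N) where
  e := A.e.rTensor N + B.e.lTensor M
  f := A.f.rTensor N + B.f.lTensor M
  h := A.h.rTensor N + B.h.lTensor M
  h_e := by
    have h1 := congrArg (LinearMap.rTensor N) A.h_e
    have h2 := congrArg (LinearMap.lTensor M) B.h_e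
    ext x y
    have h1 := LinearMap.congr_fun h1 (x ⊗ₜ y)
    have h2 := LinearMap.congr_fun h2 (x ⊗ₜ y)
    simp [TensorProduct.sub_tmul, TensorProduct.tmul_sub] at h1 h2 ⊢
    rw [← h1, ← h2]
    abel
  h_f := by
    have h1 := congrArg (LinearMap.rTensor N) A.h_f
    have h2 := congrArg (LinearMap.lTensor M) B.h_f
    ext x y
    have h1 := LinearMap.congr_fun h1 (x ⊗ₜ y)
    have h2 := LinearMap.congr_fun h2 (x ⊗ₜ y)
    simp [TensorProduct.sub_tmul, TensorProduct.tmul_sub, TensorProduct.neg_tmul,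
      TensorProduct.tmul_neg] at h1 h2 ⊢
    rw [add_comm, ← h1, ← h2]
    abel
  e_f := by
    have h1 := congrArg (LinearMap.rTensor N) A.e_f
    have h2 := congrArg (LinearMap.lTensor M) B.e_f
    ext x y
    have h1 := LinearMap.congr_fun h1 (x ⊗ₜ y)
    have h2 := LinearMap.congr_fun h2 (x ⊗ₜ y)
    simp [TensorProduct.smul_tmul'] at h1 h2 ⊢
    rw [← h1, ← h2]
    abel

/-- The permutation of the two factors of `ℂ² ⊗ ℂ²`. -/
def flipMatrix (S : Type*) [Ring S] : Matrix (Fin 2 × Fin 2) (Fin 2 × Fin 2) S :=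
  fun a b => if a.1 = b.2 ∧ a.2 = b.1 then 1 else 0

/-- The matrix `(xy)⁻¹ R(x - y)`, where `R(x) = x + P`, in the variables
`s = x⁻¹` and `t = y⁻¹`. -/
def rationalR {S : Type*} [Ring S] (s t : S) : Matrix (Fin 2 × Fin 2) (Fin 2 × Fin 2) S :=
  (t - s) • (1 : Matrix (Fin 2 × Fin 2) (Fin 2 × Fin 2) S) + (s * t) • flipMatrix S

/-- A module over the Yangian `Y(gl(2))`: operators `T_{ij}^{(a)}`, with generating series
`T_{ij}(u) = ∑_a T_{ij}^{(a)} u^{-a}` and `T_{ij}^{(0)} = δ_{ij}`, subject to the defining relations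
`R(x - y) T₍₁₎(x) T₍₂₎(y) = T₍₂₎(y) T₍₁₎(x) R(x - y)`, where `T₍₁₎ = 1 ⊗ T` and `T₍₂₎ = T ⊗ 1`.
The formal variable of `T i j` stands for `u⁻¹`. -/
structure YangianModule (M : Type*) [AddCommGroup M] [Module ℂ M] where
  T : Matrix (Fin 2) (Fin 2) (PowerSeries (Module.End ℂ M))
  T_zero : T.map PowerSeries.constantCoeff = 1
  rtt : rationalR var₁ var₂ * leg₂ (T.map inFirst) * leg₁ (T.map inSecond) =
    leg₁ (T.map inSecond) * leg₂ (T.map inFirst) * rationalR var₁ var₂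

/-- Operators on `M`, applied to the first factor of `M ⊗ N`. -/
def onLeft (M N : Type*) [AddCommGroup M] [Module ℂ M] [AddCommGroup N] [Module ℂ N] :
    PowerSeries (Module.End ℂ M) →+* PowerSeries (Module.End ℂ (M ⊗[ℂ] N)) :=
  PowerSeries.map (Module.End.rTensorAlgHom ℂ M N : _ →+* _)

/-- Operators on `N`, applied to the second factor of `M ⊗ N`. -/
def onRight (M N : Type*) [AddCommGroup M] [Module ℂ M] [AddCommGroup N] [Module ℂ N] :
    PowerSeries (Module.End ℂ N) →+* PowerSeries (Module.End ℂ (M ⊗[ℂ] N)) :=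
  PowerSeries.map (Module.End.lTensorAlgHom ℂ N M : _ →+* _)

theorem rTensor_lTensor_commute {M N : Type*} [AddCommGroup M] [Module ℂ M] [AddCommGroup N]
    [Module ℂ N] (a : Module.End ℂ M) (b : Module.End ℂ N) :
    Commute (Module.End.rTensorAlgHom ℂ M N a) (Module.End.lTensorAlgHom ℂ N M b) :=
  TensorProduct.ext' fun x y => rfl

theorem onLeft_onRight_comm {M N : Type*} [AddCommGroup M] [Module ℂ M] [AddCommGroup N]
    [Module ℂ N] (x : PowerSeries (Module.End ℂ M)) (y : PowerSeries (Module.End ℂ N)) (m n : ℕ) :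
    Commute (PowerSeries.coeff m (onLeft M N x)) (PowerSeries.coeff n (onRight M N y)) := by
  simp only [onLeft, onRight, PowerSeries.coeff_map]
  exact rTensor_lTensor_commute _ _

theorem mapTwo_first {E F : Type*} [Ring E] [Ring F] (φ : E →+* F)
    (x : PowerSeries E) : PowerSeries.map (PowerSeries.map φ) (inFirst x) =
      inFirst (PowerSeries.map φ x) := by
  simp [inFirst]

theorem mapTwo_second {E F : Type*} [Ring E] [Ring F] (φ : E →+* F)
    (x : PowerSeries E) : PowerSeries.map (PowerSeries.map φ) (inSecond x) =
      inSecond (PowerSeries.map φ x) := by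
  ext m n
  simp only [inSecond, PowerSeries.coeff_map, PowerSeries.coeff_C]
  split_ifs <;> simp

theorem map_leg₁ {S S' : Type*} [Ring S] [Ring S'] (φ : S →+* S') (T : Matrix (Fin 2) (Fin 2) S) :
    (leg₁ T).map φ = leg₁ (T.map φ) := by
  ext ⟨i, k⟩ ⟨j, l⟩
  fin_cases k <;> fin_cases l <;> simp [leg₁]

theorem map_leg₂ {S S' : Type*} [Ring S] [Ring S'] (φ : S →+* S') (T : Matrix (Fin 2) (Fin 2) S) :
    (leg₂ T).map φ = leg₂ (T.map φ) := by
  ext ⟨i, k⟩ ⟨j, l⟩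
  fin_cases i <;> fin_cases j <;> simp [leg₂]

theorem map_rationalR {S S' : Type*} [Ring S] [Ring S'] (φ : S →+* S') (s t : S) :
    (rationalR s t).map φ = rationalR (φ s) (φ t) := by
  ext ⟨i, k⟩ ⟨j, l⟩
  simp only [rationalR, flipMatrix, Matrix.map_apply, Matrix.add_apply, Matrix.smul_apply,
    Matrix.one_apply, smul_eq_mul]
  split_ifs <;> simp

theorem map_var₁ {E F : Type*} [Ring E] [Ring F] (φ : E →+* F) :
    PowerSeries.map (PowerSeries.map φ) (var₁ : PowerSeries (PowerSeries E)) = var₁ := by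
  simp [var₁, mapTwo_first]

theorem map_var₂ {E F : Type*} [Ring E] [Ring F] (φ : E →+* F) :
    PowerSeries.map (PowerSeries.map φ) (var₂ : PowerSeries (PowerSeries E)) = var₂ := by
  simp [var₂, mapTwo_second]

theorem map_first {E F : Type*} [Ring E] [Ring F] (φ : E →+* F)
    (T : Matrix (Fin 2) (Fin 2) (PowerSeries E)) :
    (T.map inFirst).map (PowerSeries.map (PowerSeries.map φ)) =
      (T.map (PowerSeries.map φ)).map inFirst := by
  ext1 i j
  simp [mapTwo_first]

theorem map_second {E F : Type*} [Ring E] [Ring F] (φ : E →+* F)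
    (T : Matrix (Fin 2) (Fin 2) (PowerSeries E)) :
    (T.map inSecond).map (PowerSeries.map (PowerSeries.map φ)) =
      (T.map (PowerSeries.map φ)).map inSecond := by
  ext1 i j
  simp [mapTwo_second]

theorem rtt_map {E F : Type*} [Ring E] [Ring F] (φ : E →+* F)
    (T : Matrix (Fin 2) (Fin 2) (PowerSeries E))
    (h : rationalR var₁ var₂ * leg₂ (T.map inFirst) * leg₁ (T.map inSecond) =
      leg₁ (T.map inSecond) * leg₂ (T.map inFirst) * rationalR var₁ var₂) :
    rationalR var₁ var₂ * leg₂ ((T.map (PowerSeries.map φ)).map inFirst) *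
        leg₁ ((T.map (PowerSeries.map φ)).map inSecond) =
      leg₁ ((T.map (PowerSeries.map φ)).map inSecond) *
        leg₂ ((T.map (PowerSeries.map φ)).map inFirst) * rationalR var₁ var₂ := by
  have := congrArg (fun A => A.map (PowerSeries.map (PowerSeries.map φ))) h
  simpa only [Matrix.map_mul, map_leg₁, map_leg₂, map_rationalR, map_var₁, map_var₂,
    map_first, map_second] using this

theorem tensor_key {M N : Type*} [AddCommGroup M] [Module ℂ M] [AddCommGroup N] [Module ℂ N]
    (A : Matrix (Fin 2) (Fin 2) (PowerSeries (Module.End ℂ M)))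
    (B : Matrix (Fin 2) (Fin 2) (PowerSeries (Module.End ℂ N))) :
    (Matrix.of fun i j => ∑ a, onLeft M N (A i a) * onRight M N (B a j)) =
      A.map (onLeft M N) * B.map (onRight M N) := by
  ext1 i j
  simp [Matrix.mul_apply]

theorem tensor_zero_left {M N : Type*} [AddCommGroup M] [Module ℂ M] [AddCommGroup N] [Module ℂ N]
    (A : Matrix (Fin 2) (Fin 2) (PowerSeries (Module.End ℂ M)))
    (h : A.map PowerSeries.constantCoeff = 1) :
    (A.map (onLeft M N)).map PowerSeries.constantCoeff = 1 := by
  have h' := congrArg (fun X => X.map (Module.End.rTensorAlgHom ℂ M N)) h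
  rw [← Matrix.map_one (Module.End.rTensorAlgHom ℂ M N) (map_zero _) (map_one _), ← h']
  ext1 i j
  simp only [Matrix.map_apply, onLeft, ← PowerSeries.coeff_zero_eq_constantCoeff_apply,
    PowerSeries.coeff_map]
  rfl

theorem tensor_zero_right {M N : Type*} [AddCommGroup M] [Module ℂ M] [AddCommGroup N] [Module ℂ N]
    (B : Matrix (Fin 2) (Fin 2) (PowerSeries (Module.End ℂ N)))
    (h : B.map PowerSeries.constantCoeff = 1) :
    (B.map (onRight M N)).map PowerSeries.constantCoeff = 1 := by
  have h' := congrArg (fun X => X.map (Module.End.lTensorAlgHom ℂ N M)) h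
  rw [← Matrix.map_one (Module.End.lTensorAlgHom ℂ N M) (map_zero _) (map_one _), ← h']
  ext1 i j
  simp only [Matrix.map_apply, onRight, ← PowerSeries.coeff_zero_eq_constantCoeff_apply,
    PowerSeries.coeff_map]
  rfl

/-- The tensor product of Yangian modules, for the comultiplication
`T_{ij}(u) ↦ ∑_a T_{ia}(u) ⊗ T_{aj}(u)`. -/
def YangianModule.tensor {M N : Type*} [AddCommGroup M] [Module ℂ M] [AddCommGroup N] [Module ℂ N]
    (A : YangianModule M) (B : YangianModule N) : YangianModule (M ⊗[ℂ] N) where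
  T := Matrix.of fun i j => ∑ a, onLeft M N (A.T i a) * onRight M N (B.T a j)
  T_zero := by
    rw [tensor_key, Matrix.map_mul, tensor_zero_left _ A.T_zero, tensor_zero_right _ B.T_zero,
      one_mul]
  rtt := by
    have hm : ∀ (g : PowerSeries (Module.End ℂ (M ⊗[ℂ] N)) →+*
        PowerSeries (PowerSeries (Module.End ℂ (M ⊗[ℂ] N)))),
        (A.T.map (onLeft M N) * B.T.map (onRight M N)).map g =
          (A.T.map (onLeft M N)).map g * (B.T.map (onRight M N)).map g :=
      fun g => Matrix.map_mul
    rw [tensor_key, hm, hm]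
    refine rtt_mul' _ _ _ _ _ (rtt_map _ _ A.rtt) (rtt_map _ _ B.rtt) ?_ ?_
    · intro i j k l
      exact (commute_two fun m n => (onLeft_onRight_comm _ _ n m).symm).symm
    · intro i j k l
      exact (commute_two fun m n => onLeft_onRight_comm _ _ m n).symm

/-- The ring-theoretic core of the evaluation morphism of the Yangian. -/
theorem eval_rtt {Z S : Type*} [CommRing Z] [Ring S] [Algebra Z S] (s t g k : Z)
    (hg : s * t * (g - k) = g * k * (s - t)) (e f h : S) (h_e : h * e = e * h + e)
    (h_f : h * f = f * h - f) (e_f : e * f = f * e + (2 : Z) • h) :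
    let E : Matrix (Fin 2) (Fin 2) S := !![h, f; e, -h]
    rationalR (algebraMap Z S s) (algebraMap Z S t) * leg₂ (1 + g • E) * leg₁ (1 + k • E) =
      leg₁ (1 + k • E) * leg₂ (1 + g • E) * rationalR (algebraMap Z S s) (algebraMap Z S t) := by
  intro E
  have hs : rationalR (algebraMap Z S s) (algebraMap Z S t) =
      (t - s) • (1 : Matrix (Fin 2 × Fin 2) (Fin 2 × Fin 2) S) + (s * t) • flipMatrix S := by
    ext a b
    simp only [rationalR, Matrix.add_apply, Matrix.smul_apply, smul_eq_mul, ← map_sub, ← map_mul,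
      ← Algebra.smul_def]
  rw [hs]
  ext ⟨i, k⟩ ⟨j, l⟩
  fin_cases i <;> fin_cases j <;> fin_cases k <;> fin_cases l <;>
    simp [E, leg₁, leg₂, flipMatrix, Matrix.mul_apply, Fintype.sum_prod_type, Fin.sum_univ_two,
      Matrix.one_apply, add_mul, mul_add, smul_add, smul_smul, h_e, h_f, e_f] <;>
    match_scalars <;>
    first
    | ring1
    | linear_combination hg
    | linear_combination -hg
    | linear_combination 2 * hg
    | linear_combination -2 * hg

/-- The expansion of `1 / (u - z)` in powers of `u⁻¹`. -/
def geomSeries (z : ℂ) : PowerSeries ℂ := PowerSeries.mk fun a => if a = 0 then 0 else z ^ (a - 1)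

theorem geomSeries_eq (z : ℂ) :
    geomSeries z = PowerSeries.X + PowerSeries.C z * PowerSeries.X * geomSeries z := by
  ext n
  rcases n with _ | n
  · simp [geomSeries]
  · rw [mul_assoc, map_add, PowerSeries.coeff_C_mul, PowerSeries.coeff_succ_X_mul]
    rcases n with _ | n
    · simp [geomSeries]
    · simp [geomSeries, PowerSeries.coeff_X, pow_succ, mul_comm]

/-- An operator, as a constant two-variable series. -/
def constHom (E : Type*) [Ring E] : E →+* PowerSeries (PowerSeries E) :=
  PowerSeries.C.comp PowerSeries.C

theorem inFirst_C {E : Type*} [Ring E] (a : E) : inFirst (PowerSeries.C a) = constHom E a := rfl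

theorem inSecond_C {E : Type*} [Ring E] (a : E) : inSecond (PowerSeries.C a) = constHom E a := by
  simp [inSecond, constHom]

/-- The `sl(2)`-module `M` made into a module over the Yangian by the evaluation morphism at `z`:
`T₁₁(u) = 1 + h/(u-z)`, `T₁₂(u) = f/(u-z)`, `T₂₁(u) = e/(u-z)`, `T₂₂(u) = 1 - h/(u-z)`. -/
def Sl2Module.eval {M : Type*} [AddCommGroup M] [Module ℂ M] (A : Sl2Module M) (z : ℂ) :
    YangianModule M where
  T :=
    let g : PowerSeries (Module.End ℂ M) := PowerSeries.map (algebraMap ℂ _) (geomSeries z)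
    !![1 + g * PowerSeries.C A.h, g * PowerSeries.C A.f;
      g * PowerSeries.C A.e, 1 - g * PowerSeries.C A.h]
  T_zero := by
    have hg : PowerSeries.constantCoeff (PowerSeries.map (algebraMap ℂ (Module.End ℂ M))
        (geomSeries z)) = 0 := by
      rw [← PowerSeries.coeff_zero_eq_constantCoeff_apply, PowerSeries.coeff_map]
      simp [geomSeries]
    ext1 i j
    fin_cases i <;> fin_cases j <;> simp [hg]
  rtt := by
    let _ := (scalarHom M).toAlgebra' scalarHom_comm
    have hsm : ∀ (c : PowerSeries (PowerSeries ℂ))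
      (s : PowerSeries (PowerSeries (Module.End ℂ M))), c • s = scalarHom M c * s := fun _ _ => rfl
    have ham : ∀ (c : PowerSeries (PowerSeries ℂ)), algebraMap _
      (PowerSeries (PowerSeries (Module.End ℂ M))) c = scalarHom M c := fun _ => rfl
    have h1 : inFirst (geomSeries z) = var₁ + inFirst (PowerSeries.C z) * var₁ *
        inFirst (geomSeries z) := by
      conv_lhs => rw [geomSeries_eq]
      simp [var₁]
    have h2 : inSecond (geomSeries z) = var₂ + inFirst (PowerSeries.C z) * var₂ *
        inSecond (geomSeries z) := by
      conv_lhs => rw [geomSeries_eq]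
      simp [var₂, inFirst_C, inSecond_C]
    have key := eval_rtt (var₁ : PowerSeries (PowerSeries ℂ)) var₂ (inFirst (geomSeries z))
      (inSecond (geomSeries z))
      (by linear_combination (var₂ * inSecond (geomSeries z)) * h1 -
            (var₁ * inFirst (geomSeries z)) * h2)
      (constHom _ A.e) (constHom _ A.f) (constHom _ A.h)
      (by rw [← map_mul, ← map_mul, ← map_add, ← sub_eq_iff_eq_add'.1 A.h_e])
      (by rw [← map_mul, ← map_mul, ← map_sub, sub_eq_add_neg, ← sub_eq_iff_eq_add'.1 A.h_f])
      (by
        rw [hsm, map_ofNat, ← map_mul, ← map_mul, sub_eq_iff_eq_add'.1 A.e_f, map_add, two_smul,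
          map_add, two_mul])
    simp only [ham, scalarHom_var₁, scalarHom_var₂] at key
    have hT₁ : (1 + (inFirst (geomSeries z) : PowerSeries (PowerSeries ℂ)) •
        !![constHom _ A.h, constHom _ A.f; constHom _ A.e, -constHom _ A.h] :
        Matrix (Fin 2) (Fin 2) (PowerSeries (PowerSeries (Module.End ℂ M)))) = Matrix.map
        !![1 + PowerSeries.map (algebraMap ℂ _) (geomSeries z) * PowerSeries.C A.h,
          PowerSeries.map (algebraMap ℂ _) (geomSeries z) * PowerSeries.C A.f;
          PowerSeries.map (algebraMap ℂ _) (geomSeries z) * PowerSeries.C A.e,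
          1 - PowerSeries.map (algebraMap ℂ _) (geomSeries z) * PowerSeries.C A.h] inFirst := by
      ext1 i j
      fin_cases i <;> fin_cases j <;>
        simp [hsm, scalarHom_first, inFirst_C, sub_eq_add_neg]
    have hT₂ : (1 + (inSecond (geomSeries z) : PowerSeries (PowerSeries ℂ)) •
        !![constHom _ A.h, constHom _ A.f; constHom _ A.e, -constHom _ A.h] :
        Matrix (Fin 2) (Fin 2) (PowerSeries (PowerSeries (Module.End ℂ M)))) = Matrix.map
        !![1 + PowerSeries.map (algebraMap ℂ _) (geomSeries z) * PowerSeries.C A.h,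
          PowerSeries.map (algebraMap ℂ _) (geomSeries z) * PowerSeries.C A.f;
          PowerSeries.map (algebraMap ℂ _) (geomSeries z) * PowerSeries.C A.e,
          1 - PowerSeries.map (algebraMap ℂ _) (geomSeries z) * PowerSeries.C A.h] inSecond := by
      ext1 i j
      fin_cases i <;> fin_cases j <;>
        simp [hsm, scalarHom_second, inSecond_C, sub_eq_add_neg]
    rw [hT₁, hT₂] at key
    exact key

/-- Pull-back of a Yangian module by the automorphism `T_{ij}(u) ↦ g(u) T_{ij}(u)`, for a series
`g` in `u⁻¹` with constant coefficient `1`. -/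
def YangianModule.twist {M : Type*} [AddCommGroup M] [Module ℂ M] (A : YangianModule M)
    (g : PowerSeries ℂ) (hg : PowerSeries.constantCoeff g = 1) : YangianModule M where
  T := A.T.map fun x => PowerSeries.map (algebraMap ℂ (Module.End ℂ M)) g * x
  T_zero := by
    have h : PowerSeries.constantCoeff (PowerSeries.map (algebraMap ℂ (Module.End ℂ M)) g) = 1 := by
      rw [← PowerSeries.coeff_zero_eq_constantCoeff_apply, PowerSeries.coeff_map,
        PowerSeries.coeff_zero_eq_constantCoeff_apply, hg, map_one]
    rw [← A.T_zero]
    ext1 i j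
    simp only [Matrix.map_apply, map_mul, h, one_mul]
  rtt := by
    let _ := (scalarHom M).toAlgebra' scalarHom_comm
    have hsm : ∀ (c : PowerSeries (PowerSeries ℂ))
      (s : PowerSeries (PowerSeries (Module.End ℂ M))), c • s = scalarHom M c * s := fun _ _ => rfl
    have h1 : leg₂ ((A.T.map fun x =>
        PowerSeries.map (algebraMap ℂ (Module.End ℂ M)) g * x).map inFirst) =
        (inFirst g : PowerSeries (PowerSeries ℂ)) • leg₂ (A.T.map inFirst) := by
      ext ⟨i, k⟩ ⟨j, l⟩
      by_cases hij : i = j <;>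
        simp [leg₂, hsm, scalarHom_first, Matrix.one_apply, hij]
    have h2 : leg₁ ((A.T.map fun x =>
        PowerSeries.map (algebraMap ℂ (Module.End ℂ M)) g * x).map inSecond) =
        (inSecond g : PowerSeries (PowerSeries ℂ)) • leg₁ (A.T.map inSecond) := by
      ext ⟨i, k⟩ ⟨j, l⟩
      by_cases hkl : k = l <;>
        simp [leg₁, hsm, scalarHom_second, Matrix.one_apply, hkl]
    rw [h1, h2]
    simp only [Matrix.mul_smul, Matrix.smul_mul, A.rtt]
    rw [smul_comm]

/-! ### `U_q sl(2)` and the quantum affine algebra -/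

/-- `q^x = exp(π i x / p)`; in particular `q = q^1 = exp(π i / p)`. -/
def qpow (p x : ℂ) : ℂ := Complex.exp (Real.pi * Complex.I * x / p)

theorem qpow_add (p x y : ℂ) : qpow p (x + y) = qpow p x * qpow p y := by
  rw [qpow, qpow, qpow, ← Complex.exp_add]
  ring_nf

theorem qpow_zero (p : ℂ) : qpow p 0 = 1 := by simp [qpow]

theorem qpow_mul_neg (p x : ℂ) : qpow p x * qpow p (-x) = 1 := by
  rw [← qpow_add, add_neg_cancel, qpow_zero]

/-- The `q`-number `[x]_q = (q^x - q^{-x}) / (q - q⁻¹)`. -/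
def qnum (p x : ℂ) : ℂ := (qpow p x - qpow p (-x)) / (qpow p 1 - qpow p (-1))

/-- A representation of `U_q sl(2)`, where `q = exp(π i / p)`; the operators `K`, `Kinv` are the
actions of `q^h`, `q^{-h}`. -/
structure UqModule (p : ℂ) (M : Type*) [AddCommGroup M] [Module ℂ M] where
  e : Module.End ℂ M
  f : Module.End ℂ M
  K : Module.End ℂ M
  Kinv : Module.End ℂ M
  K_Kinv : K * Kinv = 1
  Kinv_K : Kinv * K = 1
  e_f : e * f - f * e = (qpow p 1 - qpow p (-1))⁻¹ • (K * K - Kinv * Kinv)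
  K_e : K * e = qpow p 1 • (e * K)
  K_f : K * f = qpow p (-1) • (f * K)

theorem map_sub_left {M N : Type*} [AddCommGroup M] [Module ℂ M] [AddCommGroup N] [Module ℂ N]
    (a a' : Module.End ℂ M) (b : Module.End ℂ N) :
    TensorProduct.map (a - a') b = TensorProduct.map a b - TensorProduct.map a' b := by
  ext x y
  simp [TensorProduct.sub_tmul]

theorem map_sub_right {M N : Type*} [AddCommGroup M] [Module ℂ M] [AddCommGroup N] [Module ℂ N]
    (a : Module.End ℂ M) (b b' : Module.End ℂ N) :
    TensorProduct.map a (b - b') = TensorProduct.map a b - TensorProduct.map a b' := by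
  ext x y
  simp [TensorProduct.tmul_sub]

namespace UqModule

variable {p : ℂ} {M N : Type*} [AddCommGroup M] [Module ℂ M] [AddCommGroup N] [Module ℂ N]

theorem Kinv_e (A : UqModule p M) : A.Kinv * A.e = qpow p (-1) • (A.e * A.Kinv) := by
  have h : A.Kinv * (A.K * A.e) * A.Kinv = A.Kinv * (qpow p 1 • (A.e * A.K)) * A.Kinv := by
    rw [A.K_e]
  rw [← mul_assoc, A.Kinv_K, one_mul, mul_smul_comm, smul_mul_assoc, mul_assoc, mul_assoc,
    A.K_Kinv, mul_one] at h
  rw [h, smul_smul, mul_comm, qpow_mul_neg, one_smul]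

theorem Kinv_f (A : UqModule p M) : A.Kinv * A.f = qpow p 1 • (A.f * A.Kinv) := by
  have h : A.Kinv * (A.K * A.f) * A.Kinv = A.Kinv * (qpow p (-1) • (A.f * A.K)) * A.Kinv := by
    rw [A.K_f]
  rw [← mul_assoc, A.Kinv_K, one_mul, mul_smul_comm, smul_mul_assoc, mul_assoc, mul_assoc,
    A.K_Kinv, mul_one] at h
  rw [h, smul_smul, qpow_mul_neg, one_smul]

theorem e_f' (A : UqModule p M) : A.e * A.f = A.f * A.e +
    ((qpow p 1 - qpow p (-1))⁻¹ • (A.K * A.K) - (qpow p 1 - qpow p (-1))⁻¹ • (A.Kinv * A.Kinv)) := by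
  rw [← smul_sub, ← A.e_f]
  abel

/-- The tensor product of `U_q sl(2)`-modules, for the comultiplication
`e ↦ e ⊗ q^h + q^{-h} ⊗ e`, `f ↦ f ⊗ q^h + q^{-h} ⊗ f`, `q^{±h} ↦ q^{±h} ⊗ q^{±h}`. -/
def tensor (A : UqModule p M) (B : UqModule p N) : UqModule p (M ⊗[ℂ] N) where
  e := TensorProduct.map A.e B.K + TensorProduct.map A.Kinv B.e
  f := TensorProduct.map A.f B.K + TensorProduct.map A.Kinv B.f
  K := TensorProduct.map A.K B.K
  Kinv := TensorProduct.map A.Kinv B.Kinv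
  K_Kinv := by
    rw [← TensorProduct.map_mul, A.K_Kinv, B.K_Kinv, TensorProduct.map_one]
  Kinv_K := by
    rw [← TensorProduct.map_mul, A.Kinv_K, B.Kinv_K, TensorProduct.map_one]
  e_f := by
    simp only [add_mul, mul_add, ← TensorProduct.map_mul, A.e_f', B.e_f', A.Kinv_e, A.Kinv_f,
      B.K_e, B.K_f, TensorProduct.map_add_left, TensorProduct.map_add_right,
      TensorProduct.map_smul_left, TensorProduct.map_smul_right, map_sub_left, map_sub_right]
    module
  K_e := by
    simp only [add_mul, mul_add, ← TensorProduct.map_mul, A.K_e, B.K_e, A.K_Kinv, A.Kinv_K,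
      TensorProduct.map_smul_left, TensorProduct.map_smul_right]
    module
  K_f := by
    simp only [add_mul, mul_add, ← TensorProduct.map_mul, A.K_f, B.K_f, A.K_Kinv, A.Kinv_K,
      TensorProduct.map_smul_left, TensorProduct.map_smul_right]
    module

end UqModule
/-- The matrix `R(ξ/ζ)`, multiplied by a power series so as to be polynomial: if `ξ/ζ = α/β`, then
`trigR q q⁻¹ α β = β R(α/β)`, where
`R(ξ) = (ξq - q⁻¹)(e₁₁⊗e₁₁ + e₂₂⊗e₂₂) + (ξ - 1)(e₁₁⊗e₂₂ + e₂₂⊗e₁₁)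
  + ξ(q - q⁻¹) e₁₂⊗e₂₁ + (q - q⁻¹) e₂₁⊗e₁₂`. -/
def trigR {S : Type*} [Ring S] (q qi α β : S) : Matrix (Fin 2 × Fin 2) (Fin 2 × Fin 2) S :=
  let e : Fin 2 → Fin 2 → Matrix (Fin 2) (Fin 2) S := fun i j => Matrix.single i j 1
  (α * q - β * qi) • (e 0 0 ⊗ₖ e 0 0 + e 1 1 ⊗ₖ e 1 1) +
    (α - β) • (e 0 0 ⊗ₖ e 1 1 + e 1 1 ⊗ₖ e 0 0) +
    (α * (q - qi)) • (e 0 1 ⊗ₖ e 1 0) + (β * (q - qi)) • (e 1 0 ⊗ₖ e 0 1)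

/-- The entries of `trigR`. -/
theorem trigR_eq {S : Type*} [Ring S] (q qi α β : S) : trigR q qi α β = Matrix.of fun a b =>
    if a = b then (if a.1 = a.2 then α * q - β * qi else α - β)
    else if a = (0, 1) ∧ b = (1, 0) then α * (q - qi)
    else if a = (1, 0) ∧ b = (0, 1) then β * (q - qi) else 0 := by
  ext ⟨i, k⟩ ⟨j, l⟩
  fin_cases i <;> fin_cases j <;> fin_cases k <;> fin_cases l <;>
    simp [trigR, Matrix.single_apply]

section
variable {Z S : Type*} [CommRing Z] [Ring S] [Algebra Z S]

/-- The matrix `L⁺` of the evaluation morphism. -/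
def evalLp (q qi x : Z) (e f K Ki : S) : Matrix (Fin 2) (Fin 2) S :=
  !![Ki - x • K, -((q - qi) * x) • f; -(q - qi) • e, K - x • Ki]

/-- The matrix `L⁻` of the evaluation morphism. -/
def evalLm (q qi y : Z) (e f K Ki : S) : Matrix (Fin 2) (Fin 2) S :=
  !![K - y • Ki, (q - qi) • f; ((q - qi) * y) • e, Ki - y • K]

theorem trigR_scalar (q qi α β : Z) :
    trigR (algebraMap Z S q) (algebraMap Z S qi) (algebraMap Z S α) (algebraMap Z S β) =
      Matrix.of fun a b => (if a = b then (if a.1 = a.2 then α * q - β * qi else α - β)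
    else if a = (0, 1) ∧ b = (1, 0) then α * (q - qi)
    else if a = (1, 0) ∧ b = (0, 1) then β * (q - qi) else 0) • (1 : S) := by
  rw [trigR_eq]
  ext a b
  simp only [Matrix.of_apply]
  split_ifs <;> simp [Algebra.algebraMap_eq_smul_one, smul_smul, sub_smul, mul_sub, mul_comm]

/-- A homogeneous form of the matrices `L^±` of the evaluation morphism. -/
def evalHom (q qi x₀ x₁ : Z) (e f K Ki : S) : Matrix (Fin 2) (Fin 2) S :=
  !![x₀ • Ki - x₁ • K, -((q - qi) * x₁) • f; -((q - qi) * x₀) • e, x₀ • K - x₁ • Ki]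

set_option maxHeartbeats 4000000 in
theorem eval_hom (q qi d x₀ x₁ y₀ y₁ : Z) (hq : q * qi = 1)
    (hd : (q - qi) * (q - qi) * d = q - qi)
    (e f K Ki : S) (h1 : K * Ki = 1) (h2 : Ki * K = 1) (h3 : K * e = q • (e * K))
    (h4 : K * f = qi • (f * K)) (h5 : Ki * e = qi • (e * Ki)) (h6 : Ki * f = q • (f * Ki))
    (h7 : e * f = f * e + (d • (K * K) - d • (Ki * Ki))) :
    let R : Matrix (Fin 2 × Fin 2) (Fin 2 × Fin 2) S := trigR (algebraMap Z S q)
      (algebraMap Z S qi) (algebraMap Z S (x₁ * y₀)) (algebraMap Z S (x₀ * y₁))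
    R * leg₁ (evalHom q qi x₀ x₁ e f K Ki) * leg₂ (evalHom q qi y₀ y₁ e f K Ki) =
      leg₂ (evalHom q qi y₀ y₁ e f K Ki) * leg₁ (evalHom q qi x₀ x₁ e f K Ki) * R := by
  intro R
  simp only [R]
  rw [trigR_scalar]
  ext ⟨i, k⟩ ⟨j, l⟩
  fin_cases i <;> fin_cases j <;> fin_cases k <;> fin_cases l <;>
    simp [evalHom, leg₁, leg₂, Matrix.mul_apply, Fintype.sum_prod_type, Fin.sum_univ_two,
      Matrix.one_apply, add_mul, mul_add, sub_mul, mul_sub, smul_add, smul_sub, smul_smul,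
      h1, h2, h3, h4, h5, h6, h7] <;>
    match_scalars <;> grind

theorem evalLp_eq (q qi x : Z) (e f K Ki : S) :
    evalLp q qi x e f K Ki = evalHom q qi 1 x e f K Ki := by
  simp [evalLp, evalHom]

theorem evalLm_eq (q qi y : Z) (e f K Ki : S) :
    evalLm q qi y e f K Ki = -evalHom q qi y 1 e f K Ki := by
  ext i j
  fin_cases i <;> fin_cases j <;> simp [evalLm, evalHom]
  module

theorem leg₁_neg (A : Matrix (Fin 2) (Fin 2) S) : leg₁ (-A) = -leg₁ A := by
  ext ⟨i, k⟩ ⟨j, l⟩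
  simp [leg₁]

theorem leg₂_neg (A : Matrix (Fin 2) (Fin 2) S) : leg₂ (-A) = -leg₂ A := by
  ext ⟨i, k⟩ ⟨j, l⟩
  simp [leg₂]

theorem eval_pp (q qi d x y : Z) (hq : q * qi = 1) (hd : (q - qi) * (q - qi) * d = q - qi)
    (e f K Ki : S) (h1 : K * Ki = 1) (h2 : Ki * K = 1) (h3 : K * e = q • (e * K))
    (h4 : K * f = qi • (f * K)) (h5 : Ki * e = qi • (e * Ki)) (h6 : Ki * f = q • (f * Ki))
    (h7 : e * f = f * e + (d • (K * K) - d • (Ki * Ki))) :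
    let R : Matrix (Fin 2 × Fin 2) (Fin 2 × Fin 2) S := trigR (algebraMap Z S q)
      (algebraMap Z S qi) (algebraMap Z S x) (algebraMap Z S y)
    R * leg₁ (evalLp q qi x e f K Ki) * leg₂ (evalLp q qi y e f K Ki) =
      leg₂ (evalLp q qi y e f K Ki) * leg₁ (evalLp q qi x e f K Ki) * R := by
  have key := eval_hom q qi d 1 x 1 y hq hd e f K Ki h1 h2 h3 h4 h5 h6 h7
  simpa only [evalLp_eq, mul_one, one_mul] using key

theorem eval_mm (q qi d x y : Z) (hq : q * qi = 1) (hd : (q - qi) * (q - qi) * d = q - qi)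
    (e f K Ki : S) (h1 : K * Ki = 1) (h2 : Ki * K = 1) (h3 : K * e = q • (e * K))
    (h4 : K * f = qi • (f * K)) (h5 : Ki * e = qi • (e * Ki)) (h6 : Ki * f = q • (f * Ki))
    (h7 : e * f = f * e + (d • (K * K) - d • (Ki * Ki))) :
    let R : Matrix (Fin 2 × Fin 2) (Fin 2 × Fin 2) S := trigR (algebraMap Z S q)
      (algebraMap Z S qi) (algebraMap Z S y) (algebraMap Z S x)
    R * leg₁ (evalLm q qi x e f K Ki) * leg₂ (evalLm q qi y e f K Ki) =
      leg₂ (evalLm q qi y e f K Ki) * leg₁ (evalLm q qi x e f K Ki) * R := by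
  have key := eval_hom q qi d x 1 y 1 hq hd e f K Ki h1 h2 h3 h4 h5 h6 h7
  simpa only [evalLm_eq, leg₁_neg, leg₂_neg, mul_neg, neg_mul, neg_neg, mul_one, one_mul] using key

theorem eval_pm (q qi d x y : Z) (hq : q * qi = 1) (hd : (q - qi) * (q - qi) * d = q - qi)
    (e f K Ki : S) (h1 : K * Ki = 1) (h2 : Ki * K = 1) (h3 : K * e = q • (e * K))
    (h4 : K * f = qi • (f * K)) (h5 : Ki * e = qi • (e * Ki)) (h6 : Ki * f = q • (f * Ki))
    (h7 : e * f = f * e + (d • (K * K) - d • (Ki * Ki))) :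
    let R : Matrix (Fin 2 × Fin 2) (Fin 2 × Fin 2) S := trigR (algebraMap Z S q)
      (algebraMap Z S qi) (algebraMap Z S (x * y)) (algebraMap Z S 1)
    R * leg₁ (evalLp q qi x e f K Ki) * leg₂ (evalLm q qi y e f K Ki) =
      leg₂ (evalLm q qi y e f K Ki) * leg₁ (evalLp q qi x e f K Ki) * R := by
  have key := eval_hom q qi d 1 x y 1 hq hd e f K Ki h1 h2 h3 h4 h5 h6 h7
  simpa only [evalLp_eq, evalLm_eq, leg₂_neg, mul_neg, neg_mul, neg_inj, mul_one, one_mul] using key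

end

/-- A complex number, as a constant two-variable series. -/
def scal (E : Type*) [Ring E] [Algebra ℂ E] (c : ℂ) : PowerSeries (PowerSeries E) :=
  constHom E (algebraMap ℂ E c)

/-- A module over the quantum affine algebra, `q = exp(π i / p)`: operators `L_{ij}^{(±s)}` with
generating series `L^±_{ij}(ξ) = ∑_s L_{ij}^{(±s)} ξ^{±s}`, subject to the defining relations. The
formal variable stands for `ξ` in `Lp = L⁺` and for `ξ⁻¹` in `Lm = L⁻`. -/
structure AffineModule (p : ℂ) (M : Type*) [AddCommGroup M] [Module ℂ M] where
  Lp : Matrix (Fin 2) (Fin 2) (PowerSeries (Module.End ℂ M))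
  Lm : Matrix (Fin 2) (Fin 2) (PowerSeries (Module.End ℂ M))
  Lp_tri : PowerSeries.constantCoeff (Lp 0 1) = 0
  Lm_tri : PowerSeries.constantCoeff (Lm 1 0) = 0
  Lp_diag : PowerSeries.constantCoeff (Lp 0 0) * PowerSeries.constantCoeff (Lp 1 1) = 1
  Lp_diag' : PowerSeries.constantCoeff (Lp 1 1) * PowerSeries.constantCoeff (Lp 0 0) = 1
  Lm_diag : PowerSeries.constantCoeff (Lm 0 0) * PowerSeries.constantCoeff (Lm 1 1) = 1
  Lm_diag' : PowerSeries.constantCoeff (Lm 1 1) * PowerSeries.constantCoeff (Lm 0 0) = 1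
  Lp_Lm : ∀ i, PowerSeries.constantCoeff (Lp i i) * PowerSeries.constantCoeff (Lm i i) = 1
  Lm_Lp : ∀ i, PowerSeries.constantCoeff (Lm i i) * PowerSeries.constantCoeff (Lp i i) = 1
  /-- `R(ξ/ζ) L⁺₍₁₎(ξ) L⁺₍₂₎(ζ) = L⁺₍₂₎(ζ) L⁺₍₁₎(ξ) R(ξ/ζ)`, with variables `ξ`, `ζ` -/
  rtt_pp : trigR (scal _ (qpow p 1)) (scal _ (qpow p (-1))) var₁ var₂ *
      leg₁ (Lp.map inFirst) * leg₂ (Lp.map inSecond) =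
    leg₂ (Lp.map inSecond) * leg₁ (Lp.map inFirst) *
      trigR (scal _ (qpow p 1)) (scal _ (qpow p (-1))) var₁ var₂
  /-- `R(ξ/ζ) L⁻₍₁₎(ξ) L⁻₍₂₎(ζ) = L⁻₍₂₎(ζ) L⁻₍₁₎(ξ) R(ξ/ζ)`, with variables `ξ⁻¹`, `ζ⁻¹` -/
  rtt_mm : trigR (scal _ (qpow p 1)) (scal _ (qpow p (-1))) var₂ var₁ *
      leg₁ (Lm.map inFirst) * leg₂ (Lm.map inSecond) =
    leg₂ (Lm.map inSecond) * leg₁ (Lm.map inFirst) *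
      trigR (scal _ (qpow p 1)) (scal _ (qpow p (-1))) var₂ var₁
  /-- `R(ξ/ζ) L⁺₍₁₎(ξ) L⁻₍₂₎(ζ) = L⁻₍₂₎(ζ) L⁺₍₁₎(ξ) R(ξ/ζ)`, with variables `ξ`, `ζ⁻¹` -/
  rtt_pm : trigR (scal _ (qpow p 1)) (scal _ (qpow p (-1))) (var₁ * var₂) 1 *
      leg₁ (Lp.map inFirst) * leg₂ (Lm.map inSecond) =
    leg₂ (Lm.map inSecond) * leg₁ (Lp.map inFirst) *
      trigR (scal _ (qpow p 1)) (scal _ (qpow p (-1))) (var₁ * var₂) 1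

theorem map_trigR {S S' : Type*} [Ring S] [Ring S'] (φ : S →+* S') (q qi α β : S) :
    (trigR q qi α β).map φ = trigR (φ q) (φ qi) (φ α) (φ β) := by
  rw [trigR_eq, trigR_eq]
  ext a b
  simp only [Matrix.map_apply, Matrix.of_apply]
  split_ifs <;> simp

theorem map_scal {E F : Type*} [Ring E] [Ring F] [Algebra ℂ E] [Algebra ℂ F] (φ : E →ₐ[ℂ] F)
    (c : ℂ) : PowerSeries.map (PowerSeries.map (φ : E →+* F)) (scal E c) = scal F c := by
  simp [scal, constHom]

theorem trig_rtt_map {E F : Type*} [Ring E] [Ring F] [Algebra ℂ E] [Algebra ℂ F] (φ : E →ₐ[ℂ] F)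
    (q qi : ℂ) (α β : PowerSeries (PowerSeries E)) (α' β' : PowerSeries (PowerSeries F))
    (hα : PowerSeries.map (PowerSeries.map (φ : E →+* F)) α = α')
    (hβ : PowerSeries.map (PowerSeries.map (φ : E →+* F)) β = β')
    (T U : Matrix (Fin 2) (Fin 2) (PowerSeries E))
    (h : trigR (scal _ q) (scal _ qi) α β * leg₁ (T.map inFirst) * leg₂ (U.map inSecond) =
      leg₂ (U.map inSecond) * leg₁ (T.map inFirst) * trigR (scal _ q) (scal _ qi) α β) :
    trigR (scal _ q) (scal _ qi) α' β' *
        leg₁ ((T.map (PowerSeries.map (φ : E →+* F))).map inFirst) *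
        leg₂ ((U.map (PowerSeries.map (φ : E →+* F))).map inSecond) =
      leg₂ ((U.map (PowerSeries.map (φ : E →+* F))).map inSecond) *
        leg₁ ((T.map (PowerSeries.map (φ : E →+* F))).map inFirst) *
        trigR (scal _ q) (scal _ qi) α' β' := by
  have := congrArg (fun A => A.map (PowerSeries.map (PowerSeries.map (φ : E →+* F)))) h
  simpa only [Matrix.map_mul, map_leg₁, map_leg₂, map_trigR, map_scal, hα, hβ,
    map_first, map_second] using this

section Tensor

variable {M N : Type*} [AddCommGroup M] [Module ℂ M] [AddCommGroup N] [Module ℂ N]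

theorem tensor_key' (A : Matrix (Fin 2) (Fin 2) (PowerSeries (Module.End ℂ M)))
    (B : Matrix (Fin 2) (Fin 2) (PowerSeries (Module.End ℂ N))) :
    (Matrix.of fun i j => ∑ a, onLeft M N (A a j) * onRight M N (B i a)) =
      B.map (onRight M N) * A.map (onLeft M N) := by
  ext1 i j
  simp only [Matrix.of_apply, Matrix.mul_apply, Matrix.map_apply]
  exact Finset.sum_congr rfl fun a _ => (commute_series fun m n => onLeft_onRight_comm _ _ m n).eq

/-- The coefficients of `ξ^0` in a product series. -/
theorem const_left (x : PowerSeries (Module.End ℂ M)) :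
    PowerSeries.constantCoeff (onLeft M N x) =
      Module.End.rTensorAlgHom ℂ M N (PowerSeries.constantCoeff x) := by
  rw [onLeft, ← PowerSeries.coeff_zero_eq_constantCoeff_apply, PowerSeries.coeff_map,
    PowerSeries.coeff_zero_eq_constantCoeff_apply]
  rfl

theorem const_right (x : PowerSeries (Module.End ℂ N)) :
    PowerSeries.constantCoeff (onRight M N x) =
      Module.End.lTensorAlgHom ℂ N M (PowerSeries.constantCoeff x) := by
  rw [onRight, ← PowerSeries.coeff_zero_eq_constantCoeff_apply, PowerSeries.coeff_map,
    PowerSeries.coeff_zero_eq_constantCoeff_apply]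
  rfl

theorem const_pair (a a' : Module.End ℂ M) (b b' : Module.End ℂ N) (ha : a * a' = 1)
    (hb : b * b' = 1) :
    (Module.End.rTensorAlgHom ℂ M N a * Module.End.lTensorAlgHom ℂ N M b) *
      (Module.End.rTensorAlgHom ℂ M N a' * Module.End.lTensorAlgHom ℂ N M b') = 1 := by
  rw [mul_assoc, ← mul_assoc (Module.End.lTensorAlgHom ℂ N M b),
    ← (rTensor_lTensor_commute a' b).eq, mul_assoc, ← mul_assoc, ← map_mul, ← map_mul, ha, hb,
    map_one, map_one, one_mul]

theorem tensor_rtt (q qi : ℂ)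
    (α β : PowerSeries (PowerSeries (Module.End ℂ (M ⊗[ℂ] N))))
    (A A' : Matrix (Fin 2) (Fin 2) (PowerSeries (Module.End ℂ M)))
    (B B' : Matrix (Fin 2) (Fin 2) (PowerSeries (Module.End ℂ N)))
    (hA : trigR (scal _ q) (scal _ qi) α β * leg₁ ((A.map (onLeft M N)).map inFirst) *
        leg₂ ((A'.map (onLeft M N)).map inSecond) =
      leg₂ ((A'.map (onLeft M N)).map inSecond) * leg₁ ((A.map (onLeft M N)).map inFirst) *
        trigR (scal _ q) (scal _ qi) α β)
    (hB : trigR (scal _ q) (scal _ qi) α β * leg₁ ((B.map (onRight M N)).map inFirst) *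
        leg₂ ((B'.map (onRight M N)).map inSecond) =
      leg₂ ((B'.map (onRight M N)).map inSecond) * leg₁ ((B.map (onRight M N)).map inFirst) *
        trigR (scal _ q) (scal _ qi) α β) :
    trigR (scal _ q) (scal _ qi) α β *
        leg₁ ((B.map (onRight M N) * A.map (onLeft M N)).map inFirst) *
        leg₂ ((B'.map (onRight M N) * A'.map (onLeft M N)).map inSecond) =
      leg₂ ((B'.map (onRight M N) * A'.map (onLeft M N)).map inSecond) *
        leg₁ ((B.map (onRight M N) * A.map (onLeft M N)).map inFirst) *
        trigR (scal _ q) (scal _ qi) α β := by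
  rw [Matrix.map_mul, Matrix.map_mul]
  refine rtt_mul _ _ _ _ _ hB hA ?_ ?_
  · intro i j k l
    exact commute_two fun m n => onLeft_onRight_comm _ _ m n
  · intro i j k l
    exact commute_two fun m n => (onLeft_onRight_comm _ _ n m).symm

/-- The tensor product of modules over the quantum affine algebra, for the comultiplication
`L^±_{ij}(ξ) ↦ ∑_a L^±_{aj}(ξ) ⊗ L^±_{ia}(ξ)`. -/
def AffineModule.tensor {p : ℂ} (A : AffineModule p M) (B : AffineModule p N) :
    AffineModule p (M ⊗[ℂ] N) where
  Lp := Matrix.of fun i j => ∑ a, onLeft M N (A.Lp a j) * onRight M N (B.Lp i a)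
  Lm := Matrix.of fun i j => ∑ a, onLeft M N (A.Lm a j) * onRight M N (B.Lm i a)
  Lp_tri := by
    simp [Fin.sum_univ_two, const_left, const_right, A.Lp_tri, B.Lp_tri]
  Lm_tri := by
    simp [Fin.sum_univ_two, const_left, const_right, A.Lm_tri, B.Lm_tri]
  Lp_diag := by
    simp only [Matrix.of_apply, Fin.sum_univ_two, map_add, map_mul, const_left, const_right,
      A.Lp_tri, B.Lp_tri, map_zero, mul_zero, zero_mul, add_zero, zero_add]
    exact const_pair _ _ _ _ A.Lp_diag B.Lp_diag
  Lp_diag' := by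
    simp only [Matrix.of_apply, Fin.sum_univ_two, map_add, map_mul, const_left, const_right,
      A.Lp_tri, B.Lp_tri, map_zero, mul_zero, zero_mul, add_zero, zero_add]
    exact const_pair _ _ _ _ A.Lp_diag' B.Lp_diag'
  Lm_diag := by
    simp only [Matrix.of_apply, Fin.sum_univ_two, map_add, map_mul, const_left, const_right,
      A.Lm_tri, B.Lm_tri, map_zero, mul_zero, zero_mul, add_zero, zero_add]
    exact const_pair _ _ _ _ A.Lm_diag B.Lm_diag
  Lm_diag' := by
    simp only [Matrix.of_apply, Fin.sum_univ_two, map_add, map_mul, const_left, const_right,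
      A.Lm_tri, B.Lm_tri, map_zero, mul_zero, zero_mul, add_zero, zero_add]
    exact const_pair _ _ _ _ A.Lm_diag' B.Lm_diag'
  Lp_Lm := by
    rw [Fin.forall_fin_two]
    simp only [Matrix.of_apply, Fin.sum_univ_two, map_add, map_mul, const_left, const_right,
      A.Lm_tri, B.Lm_tri, A.Lp_tri, B.Lp_tri, map_zero, mul_zero, zero_mul, add_zero, zero_add]
    exact ⟨const_pair _ _ _ _ (A.Lp_Lm 0) (B.Lp_Lm 0), const_pair _ _ _ _ (A.Lp_Lm 1) (B.Lp_Lm 1)⟩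
  Lm_Lp := by
    rw [Fin.forall_fin_two]
    simp only [Matrix.of_apply, Fin.sum_univ_two, map_add, map_mul, const_left, const_right,
      A.Lm_tri, B.Lm_tri, A.Lp_tri, B.Lp_tri, map_zero, mul_zero, zero_mul, add_zero, zero_add]
    exact ⟨const_pair _ _ _ _ (A.Lm_Lp 0) (B.Lm_Lp 0), const_pair _ _ _ _ (A.Lm_Lp 1) (B.Lm_Lp 1)⟩
  rtt_pp := by
    rw [tensor_key']
    exact tensor_rtt _ _ _ _ _ _ _ _
      (trig_rtt_map _ _ _ _ _ _ _ (map_var₁ _) (map_var₂ _) _ _ A.rtt_pp)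
      (trig_rtt_map _ _ _ _ _ _ _ (map_var₁ _) (map_var₂ _) _ _ B.rtt_pp)
  rtt_mm := by
    rw [tensor_key']
    exact tensor_rtt _ _ _ _ _ _ _ _
      (trig_rtt_map _ _ _ _ _ _ _ (map_var₂ _) (map_var₁ _) _ _ A.rtt_mm)
      (trig_rtt_map _ _ _ _ _ _ _ (map_var₂ _) (map_var₁ _) _ _ B.rtt_mm)
  rtt_pm := by
    rw [tensor_key', tensor_key']
    exact tensor_rtt _ _ _ _ _ _ _ _
      (trig_rtt_map _ _ _ _ _ _ _ (by rw [map_mul, map_var₁, map_var₂]) (map_one _) _ _ A.rtt_pm)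
      (trig_rtt_map _ _ _ _ _ _ _ (by rw [map_mul, map_var₁, map_var₂]) (map_one _) _ _ B.rtt_pm)

end Tensor

theorem trigR_mul {Z S : Type*} [CommRing Z] [Ring S] [Algebra Z S] (q qi c α β : Z) :
    trigR (algebraMap Z S q) (algebraMap Z S qi) (algebraMap Z S (c * α))
        (algebraMap Z S (c * β)) =
      c • trigR (algebraMap Z S q) (algebraMap Z S qi) (algebraMap Z S α) (algebraMap Z S β) := by
  rw [trigR_scalar, trigR_scalar]
  ext a b
  simp only [Matrix.of_apply, Matrix.smul_apply, smul_smul]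
  split_ifs <;> ring_nf

theorem cancel_scalar {Z S : Type*} [CommRing Z] [Ring S] [Algebra Z S] (c ci : Z)
    (hc : ci * c = 1) (R X Y : Matrix (Fin 2 × Fin 2) (Fin 2 × Fin 2) S)
    (h : c • R * X * Y = Y * X * c • R) : R * X * Y = Y * X * R := by
  have := congrArg (fun A => ci • A) h
  simpa [smul_smul, hc] using this

section Eval

variable {p : ℂ} {M : Type*} [AddCommGroup M] [Module ℂ M]

theorem scalarHom_scal (c : ℂ) : scalarHom M (scal ℂ c) = scal (Module.End ℂ M) c := by
  simp [scalarHom, scal, constHom]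

theorem scal_mul_const (c : ℂ) (a : Module.End ℂ M) :
    scal (Module.End ℂ M) c * constHom _ a = constHom _ (c • a) := by
  rw [scal, ← map_mul, Algebra.smul_def]

theorem scal_mul (c d : ℂ) : scal ℂ c * scal ℂ d = scal ℂ (c * d) := by
  simp [scal]

theorem scal_sub (c d : ℂ) : scal ℂ c - scal ℂ d = scal ℂ (c - d) := by
  simp [scal]

/-- The `U_q sl(2)`-module `M` made into a module over the quantum affine algebra by the evaluation
morphism at `q^{2z}`, i.e. with `ξ` replaced by `ξ q^{-2z}` in
`L^±₁₁ = q^{∓h} - q^{±h} ξ^{±1}`, `L^±₂₂ = q^{±h} - q^{∓h} ξ^{±1}`, `L⁺₁₂ = -(q - q⁻¹) ξ f`,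
`L⁺₂₁ = -(q - q⁻¹) e`, `L⁻₁₂ = (q - q⁻¹) f`, `L⁻₂₁ = (q - q⁻¹) ξ⁻¹ e`. -/
def evalMatLp (A : UqModule p M) (z : ℂ) : Matrix (Fin 2) (Fin 2) (PowerSeries (Module.End ℂ M)) :=
  let C := PowerSeries.C (R := Module.End ℂ M)
  let X := PowerSeries.X (R := Module.End ℂ M)
  let δ := qpow p 1 - qpow p (-1)
  let c := qpow p (-(2 * z))
  !![C A.Kinv - X * C (c • A.K), -(X * C ((δ * c) • A.f));
    -C (δ • A.e), C A.K - X * C (c • A.Kinv)]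

/-- See `evalMatLp`. -/
def evalMatLm (A : UqModule p M) (z : ℂ) : Matrix (Fin 2) (Fin 2) (PowerSeries (Module.End ℂ M)) :=
  let C := PowerSeries.C (R := Module.End ℂ M)
  let X := PowerSeries.X (R := Module.End ℂ M)
  let δ := qpow p 1 - qpow p (-1)
  let c := qpow p (2 * z)
  !![C A.K - X * C (c • A.Kinv), C (δ • A.f);
    X * C ((δ * c) • A.e), C A.Kinv - X * C (c • A.K)]

theorem var₁_mul (x : PowerSeries (PowerSeries (Module.End ℂ M))) : var₁ * x = x * var₁ := by
  rw [← scalarHom_var₁, scalarHom_comm]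

theorem var₂_mul (x : PowerSeries (PowerSeries (Module.End ℂ M))) : var₂ * x = x * var₂ := by
  rw [← scalarHom_var₂, scalarHom_comm]

theorem delta_sq (p : ℂ) : (qpow p 1 - qpow p (-1)) * (qpow p 1 - qpow p (-1)) *
    (qpow p 1 - qpow p (-1))⁻¹ = qpow p 1 - qpow p (-1) := by
  by_cases h : qpow p 1 - qpow p (-1) = 0
  · simp [h]
  · field_simp

theorem eval_all (A : UqModule p M) (z : ℂ) :
    (trigR (scal _ (qpow p 1)) (scal _ (qpow p (-1))) var₁ var₂ *
      leg₁ ((evalMatLp A z).map inFirst) * leg₂ ((evalMatLp A z).map inSecond) =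
    leg₂ ((evalMatLp A z).map inSecond) * leg₁ ((evalMatLp A z).map inFirst) *
      trigR (scal _ (qpow p 1)) (scal _ (qpow p (-1))) var₁ var₂) ∧
    (trigR (scal _ (qpow p 1)) (scal _ (qpow p (-1))) var₂ var₁ *
      leg₁ ((evalMatLm A z).map inFirst) * leg₂ ((evalMatLm A z).map inSecond) =
    leg₂ ((evalMatLm A z).map inSecond) * leg₁ ((evalMatLm A z).map inFirst) *
      trigR (scal _ (qpow p 1)) (scal _ (qpow p (-1))) var₂ var₁) ∧
    (trigR (scal _ (qpow p 1)) (scal _ (qpow p (-1))) (var₁ * var₂) 1 *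
      leg₁ ((evalMatLp A z).map inFirst) * leg₂ ((evalMatLm A z).map inSecond) =
    leg₂ ((evalMatLm A z).map inSecond) * leg₁ ((evalMatLp A z).map inFirst) *
      trigR (scal _ (qpow p 1)) (scal _ (qpow p (-1))) (var₁ * var₂) 1) := by
  let _ := (scalarHom M).toAlgebra' scalarHom_comm
  have hsm : ∀ (c : PowerSeries (PowerSeries ℂ))
    (s : PowerSeries (PowerSeries (Module.End ℂ M))), c • s = scalarHom M c * s := fun _ _ => rfl
  have ham : ∀ (c : PowerSeries (PowerSeries ℂ)), algebraMap _
    (PowerSeries (PowerSeries (Module.End ℂ M))) c = scalarHom M c := fun _ => rfl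
  have hcs : ∀ (c : ℂ) (a : Module.End ℂ M), scal ℂ c • constHom _ a = constHom _ (c • a) := by
    intro c a
    rw [hsm, scalarHom_scal, scal_mul_const]
  have hv₁ : ∀ (a : PowerSeries (PowerSeries (Module.End ℂ M))),
      (var₁ : PowerSeries (PowerSeries ℂ)) • a = var₁ * a := by
    intro a
    rw [hsm, scalarHom_var₁]
  have hv₂ : ∀ (a : PowerSeries (PowerSeries (Module.End ℂ M))),
      (var₂ : PowerSeries (PowerSeries ℂ)) • a = var₂ * a := by
    intro a
    rw [hsm, scalarHom_var₂]
  set q := scal ℂ (qpow p 1) with hq_def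
  set qi := scal ℂ (qpow p (-1)) with hqi_def
  set d := scal ℂ (qpow p 1 - qpow p (-1))⁻¹ with hd_def
  have hq : q * qi = 1 := by
    rw [hq_def, hqi_def, scal_mul, qpow_mul_neg]; simp [scal]
  have hd : (q - qi) * (q - qi) * d = q - qi := by
    rw [hq_def, hqi_def, hd_def, scal_sub, scal_mul, scal_mul, delta_sq]
  set c := scal ℂ (qpow p (-(2 * z))) with hc_def
  set ci := scal ℂ (qpow p (2 * z)) with hci_def
  have hc : ci * c = 1 := by
    rw [hc_def, hci_def, scal_mul, qpow_mul_neg]; simp [scal]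
  have h1 : constHom _ A.K * constHom _ A.Kinv = 1 := by rw [← map_mul, A.K_Kinv, map_one]
  have h2 : constHom _ A.Kinv * constHom _ A.K = 1 := by rw [← map_mul, A.Kinv_K, map_one]
  have h3 : constHom _ A.K * constHom _ A.e = q • (constHom _ A.e * constHom _ A.K) := by
    rw [← map_mul, ← map_mul, hcs, A.K_e]
  have h4 : constHom _ A.K * constHom _ A.f = qi • (constHom _ A.f * constHom _ A.K) := by
    rw [← map_mul, ← map_mul, hcs, A.K_f]
  have h5 : constHom _ A.Kinv * constHom _ A.e = qi • (constHom _ A.e * constHom _ A.Kinv) := by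
    rw [← map_mul, ← map_mul, hcs, A.Kinv_e]
  have h6 : constHom _ A.Kinv * constHom _ A.f = q • (constHom _ A.f * constHom _ A.Kinv) := by
    rw [← map_mul, ← map_mul, hcs, A.Kinv_f]
  have h7 : constHom _ A.e * constHom _ A.f = constHom _ A.f * constHom _ A.e +
      (d • (constHom _ A.K * constHom _ A.K) - d • (constHom _ A.Kinv * constHom _ A.Kinv)) := by
    rw [← map_mul, ← map_mul, ← map_mul, ← map_mul, A.e_f', map_add, map_sub, ← hcs, ← hcs]
  have hδ : q - qi = scal ℂ (qpow p 1 - qpow p (-1)) := scal_sub _ _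
  have hf : ∀ (k : ℂ) (a : Module.End ℂ M), (var₁ * scal ℂ k) • constHom _ a =
      inFirst (PowerSeries.X * PowerSeries.C (k • a)) := by
    intro k a
    rw [mul_smul, hcs, hv₁, map_mul, inFirst_C, var₁]
  have hf' : ∀ (k l : ℂ) (a : Module.End ℂ M), (scal ℂ k * (var₁ * scal ℂ l)) • constHom _ a =
      inFirst (PowerSeries.X * PowerSeries.C ((k * l) • a)) := by
    intro k l a
    rw [mul_left_comm, scal_mul, hf]
  have hf₀ : ∀ (k : ℂ) (a : Module.End ℂ M), scal ℂ k • constHom _ a =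
      inFirst (PowerSeries.C (k • a)) := by
    intro k a
    rw [hcs, inFirst_C]
  have hs : ∀ (k : ℂ) (a : Module.End ℂ M), (var₂ * scal ℂ k) • constHom _ a =
      inSecond (PowerSeries.X * PowerSeries.C (k • a)) := by
    intro k a
    rw [mul_smul, hcs, hv₂, map_mul, inSecond_C, var₂]
  have hs' : ∀ (k l : ℂ) (a : Module.End ℂ M), (scal ℂ k * (var₂ * scal ℂ l)) • constHom _ a =
      inSecond (PowerSeries.X * PowerSeries.C ((k * l) • a)) := by
    intro k l a
    rw [mul_left_comm, scal_mul, hs]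
  have hs₀ : ∀ (k : ℂ) (a : Module.End ℂ M), scal ℂ k • constHom _ a =
      inSecond (PowerSeries.C (k • a)) := by
    intro k a
    rw [hcs, inSecond_C]
  have hP₁ : evalLp q qi (var₁ * c) (constHom _ A.e) (constHom _ A.f) (constHom _ A.K)
      (constHom _ A.Kinv) = (evalMatLp A z).map inFirst := by
    ext1 i j
    fin_cases i <;> fin_cases j <;>
      simp only [evalLp, evalMatLp, hδ, hc_def, neg_smul, hf, hf', hf₀, Matrix.of_apply, Matrix.map_apply,
        Matrix.cons_val_zero, Matrix.cons_val_one, Matrix.cons_val', Matrix.cons_val_fin_one,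
        Fin.zero_eta, Fin.mk_one, map_sub, map_neg, inFirst_C]
  have hP₂ : evalLp q qi (var₂ * c) (constHom _ A.e) (constHom _ A.f) (constHom _ A.K)
      (constHom _ A.Kinv) = (evalMatLp A z).map inSecond := by
    ext1 i j
    fin_cases i <;> fin_cases j <;>
      simp only [evalLp, evalMatLp, hδ, hc_def, neg_smul, hs, hs', hs₀, Matrix.of_apply, Matrix.map_apply,
        Matrix.cons_val_zero, Matrix.cons_val_one, Matrix.cons_val', Matrix.cons_val_fin_one,
        Fin.zero_eta, Fin.mk_one, map_sub, map_neg, inSecond_C]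
  have hM₁ : evalLm q qi (var₁ * ci) (constHom _ A.e) (constHom _ A.f) (constHom _ A.K)
      (constHom _ A.Kinv) = (evalMatLm A z).map inFirst := by
    ext1 i j
    fin_cases i <;> fin_cases j <;>
      simp only [evalLm, evalMatLm, hδ, hci_def, neg_smul, hf, hf', hf₀, Matrix.of_apply, Matrix.map_apply,
        Matrix.cons_val_zero, Matrix.cons_val_one, Matrix.cons_val', Matrix.cons_val_fin_one,
        Fin.zero_eta, Fin.mk_one, map_sub, map_neg, inFirst_C]
  have hM₂ : evalLm q qi (var₂ * ci) (constHom _ A.e) (constHom _ A.f) (constHom _ A.K)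
      (constHom _ A.Kinv) = (evalMatLm A z).map inSecond := by
    ext1 i j
    fin_cases i <;> fin_cases j <;>
      simp only [evalLm, evalMatLm, hδ, hci_def, neg_smul, hs, hs', hs₀, Matrix.of_apply, Matrix.map_apply,
        Matrix.cons_val_zero, Matrix.cons_val_one, Matrix.cons_val', Matrix.cons_val_fin_one,
        Fin.zero_eta, Fin.mk_one, map_sub, map_neg, inSecond_C]
  have hR₁ : ∀ (k : PowerSeries (PowerSeries ℂ)) (a b : PowerSeries (PowerSeries ℂ)),
      trigR (algebraMap _ (PowerSeries (PowerSeries (Module.End ℂ M))) q) (algebraMap _ _ qi)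
        (algebraMap _ _ (a * k)) (algebraMap _ _ (b * k)) =
      k • trigR (scal _ (qpow p 1)) (scal _ (qpow p (-1))) (scalarHom M a) (scalarHom M b) := by
    intro k a b
    rw [mul_comm a, mul_comm b, trigR_mul, ham, ham, ham, ham, scalarHom_scal, scalarHom_scal]
  refine ⟨?_, ?_, ?_⟩
  · have key := eval_pp q qi d (var₁ * c) (var₂ * c) hq hd _ _ _ _ h1 h2 h3 h4 h5 h6 h7
    simp only [hR₁, hP₁, hP₂, scalarHom_var₁, scalarHom_var₂] at key
    exact cancel_scalar c ci hc _ _ _ key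
  · have key := eval_mm q qi d (var₁ * ci) (var₂ * ci) hq hd _ _ _ _ h1 h2 h3 h4 h5 h6 h7
    simp only [hR₁, hM₁, hM₂, scalarHom_var₁, scalarHom_var₂] at key
    exact cancel_scalar ci c (by rw [mul_comm, hc]) _ _ _ key
  · have key := eval_pm q qi d (var₁ * c) (var₂ * ci) hq hd _ _ _ _ h1 h2 h3 h4 h5 h6 h7
    have e : var₁ * c * (var₂ * ci) = var₁ * var₂ := by linear_combination var₁ * var₂ * hc
    simp only [e, hP₁, hM₂] at key
    simp only [ham, hq_def, hqi_def, scalarHom_scal, map_mul, map_one,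
      scalarHom_var₁, scalarHom_var₂] at key
    exact key

/-- The evaluation module over the quantum affine algebra; see `evalMatLp`. -/
def UqModule.eval (A : UqModule p M) (z : ℂ) : AffineModule p M where
  Lp := evalMatLp A z
  Lm := evalMatLm A z
  Lp_tri := by simp [evalMatLp]
  Lm_tri := by simp [evalMatLm]
  Lp_diag := by simp [evalMatLp, A.Kinv_K]
  Lp_diag' := by simp [evalMatLp, A.K_Kinv]
  Lm_diag := by simp [evalMatLm, A.K_Kinv]
  Lm_diag' := by simp [evalMatLm, A.Kinv_K]
  Lp_Lm := by
    rw [Fin.forall_fin_two]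
    simp [evalMatLp, evalMatLm, A.Kinv_K, A.K_Kinv]
  Lm_Lp := by
    rw [Fin.forall_fin_two]
    simp [evalMatLp, evalMatLm, A.Kinv_K, A.K_Kinv]
  rtt_pp := (eval_all A z).1
  rtt_mm := (eval_all A z).2.1
  rtt_pm := (eval_all A z).2.2

end Eval

/-! ### Verma modules -/

/-- The underlying space of a Verma module, with basis `f^l v`, `l = 0, 1, …`. -/
abbrev VermaSpace : Type := ℕ →₀ ℂ

/-- The basis vector `f^l v`. -/
def fv (l : ℕ) : VermaSpace := Finsupp.single l 1

theorem verma_ext {φ ψ : Module.End ℂ VermaSpace} (h : ∀ l, φ (fv l) = ψ (fv l)) : φ = ψ :=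
  Finsupp.lhom_ext' fun l => LinearMap.ext_ring (h l)

/-- The operator on a Verma space with the given values on the basis vectors `f^l v`. -/
def byBasis (g : ℕ → VermaSpace) : Module.End ℂ VermaSpace := Finsupp.linearCombination ℂ g

theorem byBasis_fv (g : ℕ → VermaSpace) (l : ℕ) : byBasis g (fv l) = g l := by
  simp [byBasis, fv]

/-- The `sl(2)` Verma module `V(lam)` of highest weight `lam`. -/
def verma (lam : ℂ) : Sl2Module VermaSpace where
  e := byBasis fun l => ((l : ℂ) * (2 * lam - l + 1)) • fv (l - 1)
  f := byBasis fun l => fv (l + 1)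
  h := byBasis fun l => (lam - l) • fv l
  h_e := by
    refine verma_ext fun l => ?_
    rcases l with _ | l <;>
      simp only [LinearMap.sub_apply, Module.End.mul_apply, byBasis_fv, map_smul,
        Nat.add_sub_cancel, Nat.zero_sub]
    all_goals
      match_scalars
      push_cast
      ring
  h_f := by
    refine verma_ext fun l => ?_
    simp only [LinearMap.sub_apply, LinearMap.neg_apply, Module.End.mul_apply, byBasis_fv, map_smul]
    match_scalars
    push_cast
    ring
  e_f := by
    refine verma_ext fun l => ?_
    rcases l with _ | l <;>
      simp only [LinearMap.sub_apply, LinearMap.smul_apply, Module.End.mul_apply, byBasis_fv,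
        map_smul, Nat.add_sub_cancel, Nat.zero_sub]
    · simp only [Nat.cast_zero, zero_mul, zero_smul, sub_zero]
      match_scalars
      push_cast
      ring
    · match_scalars
      push_cast
      ring

theorem qnum_identity (p lam l : ℂ) :
    qnum p (l + 1) * qnum p (2 * lam - l) - qnum p l * qnum p (2 * lam - l + 1) =
      (qpow p 1 - qpow p (-1))⁻¹ *
        (qpow p (lam - l) * qpow p (lam - l) - qpow p (l - lam) * qpow p (l - lam)) := by
  by_cases hD : qpow p 1 - qpow p (-1) = 0
  · simp [qnum, hD]
  have e1 : qpow p (l + 1) = qpow p l * qpow p 1 := qpow_add _ _ _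
  have e2 : qpow p (-(l + 1)) = qpow p (-l) * qpow p (-1) := by rw [← qpow_add]; ring_nf
  have e3 : qpow p (2 * lam - l) = qpow p lam * qpow p lam * qpow p (-l) := by
    rw [← qpow_add, ← qpow_add]; ring_nf
  have e4 : qpow p (-(2 * lam - l)) = qpow p (-lam) * qpow p (-lam) * qpow p l := by
    rw [← qpow_add, ← qpow_add]; ring_nf
  have e5 : qpow p (2 * lam - l + 1) = qpow p lam * qpow p lam * qpow p (-l) * qpow p 1 := by
    rw [← qpow_add, ← qpow_add, ← qpow_add]; ring_nf
  have e6 : qpow p (-(2 * lam - l + 1)) =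
      qpow p (-lam) * qpow p (-lam) * qpow p l * qpow p (-1) := by
    rw [← qpow_add, ← qpow_add, ← qpow_add]; ring_nf
  have e7 : qpow p (lam - l) = qpow p lam * qpow p (-l) := by rw [← qpow_add]; ring_nf
  have e8 : qpow p (l - lam) = qpow p l * qpow p (-lam) := by rw [← qpow_add]; ring_nf
  have hl := qpow_mul_neg p l
  rw [qnum, qnum, qnum, qnum, e1, e2, e3, e4, e5, e6, e7, e8]
  field_simp
  ring

/-- The `U_q sl(2)` Verma module `V_q(lam)` of highest weight `q^lam`, `q = exp(π i / p)`. -/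
def qVerma (p lam : ℂ) : UqModule p VermaSpace where
  e := byBasis fun l => (qnum p l * qnum p (2 * lam - l + 1)) • fv (l - 1)
  f := byBasis fun l => fv (l + 1)
  K := byBasis fun l => qpow p (lam - l) • fv l
  Kinv := byBasis fun l => qpow p (l - lam) • fv l
  K_Kinv := by
    refine verma_ext fun l => ?_
    simp only [Module.End.mul_apply, Module.End.one_apply, byBasis_fv, map_smul, smul_smul,
      ← qpow_add]
    simp [qpow_zero]
  Kinv_K := by
    refine verma_ext fun l => ?_
    simp only [Module.End.mul_apply, Module.End.one_apply, byBasis_fv, map_smul, smul_smul,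
      ← qpow_add]
    simp [qpow_zero]
  e_f := by
    refine verma_ext fun l => ?_
    have h := qnum_identity p lam l
    have h0 : qnum p 0 = 0 := by simp [qnum]
    have h1 : 2 * lam - ((l + 1 : ℕ) : ℂ) + 1 = 2 * lam - l := by push_cast; ring
    rcases l with _ | l <;>
      simp only [LinearMap.sub_apply, LinearMap.smul_apply, Module.End.mul_apply, byBasis_fv,
        map_smul, Nat.add_sub_cancel, Nat.zero_sub, h1, smul_smul, ← sub_smul]
    · simp only [Nat.cast_zero, h0, zero_mul, zero_smul, sub_zero] at h ⊢
      rw [← h]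
      simp
    · rw [← h]
      push_cast
      rfl
  K_e := by
    refine verma_ext fun l => ?_
    have h0 : qnum p 0 = 0 := by simp [qnum]
    rcases l with _ | l <;>
      simp only [LinearMap.smul_apply, Module.End.mul_apply, byBasis_fv,
        map_smul, Nat.add_sub_cancel, Nat.zero_sub, smul_smul]
    · simp [h0]
    · have : qpow p (lam - l) = qpow p 1 * qpow p (lam - (l + 1 : ℕ)) := by
        rw [← qpow_add]
        push_cast
        ring_nf
      rw [this]
      congr 1
      ring
  K_f := by
    refine verma_ext fun l => ?_
    simp only [LinearMap.smul_apply, Module.End.mul_apply, byBasis_fv, map_smul, smul_smul]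
    rw [← qpow_add]
    push_cast
    ring_nf

/-- `B_l(lam) = B_lam(f^l v, f^l v)`, the value of the Shapovalov form of `V(lam)`. -/
def shapovalov (l : ℕ) (lam : ℂ) : ℂ :=
  (l.factorial : ℂ) * ∏ a ∈ Finset.range l, (2 * lam - a)

/-- `B^q_l(lam) = [l]_q! ∏_{a<l} [2 lam - a]_q`, the value of the quantum Shapovalov form of
`V_q(lam)` on `(f^l v, f^l v)`. -/
def qShapovalov (p : ℂ) (l : ℕ) (lam : ℂ) : ℂ :=
  (∏ a ∈ Finset.range l, qnum p (a + 1)) * ∏ a ∈ Finset.range l, qnum p (2 * lam - a)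

/-! ### Parameters -/

/-- The numbers `z_σ^{τ}`, determined together with `twistLam` by
`(z_σ^{τ})_a + (lam_σ^{τ})_a = z_{σ(a)} + lam_{σ(a)}` and
`(z_σ^{τ})_a - (lam_σ^{τ})_a = z_{τ(a)} - lam_{τ(a)}`. -/
def twistZ (τ σ : Equiv.Perm (Fin 2)) (z lam : Fin 2 → ℂ) (a : Fin 2) : ℂ :=
  ((z (σ a) + lam (σ a)) + (z (τ a) - lam (τ a))) / 2

/-- The numbers `lam_σ^{τ}`; see `twistZ`. -/
def twistLam (τ σ : Equiv.Perm (Fin 2)) (z lam : Fin 2 → ℂ) (a : Fin 2) : ℂ :=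
  ((z (σ a) + lam (σ a)) - (z (τ a) - lam (τ a))) / 2

/-- The three kinds of matrices: `R̂`, `D` and `N`. -/
inductive MatrixKind
  | R
  | D
  | N

/-- The upper permutation `τ`. -/
def MatrixKind.sup : MatrixKind → Equiv.Perm (Fin 2)
  | .R => Equiv.swap 0 1
  | .D => 1
  | .N => Equiv.swap 0 1

/-- The lower permutation `σ`. -/
def MatrixKind.sub : MatrixKind → Equiv.Perm (Fin 2)
  | .R => Equiv.swap 0 1
  | .D => Equiv.swap 0 1
  | .N => 1

/-- The parameters `u` of the target of the matrix of the given kind. -/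
def MatrixKind.targetZ (κ : MatrixKind) (z lam : Fin 2 → ℂ) : Fin 2 → ℂ :=
  twistZ κ.sup κ.sub z lam

/-- The parameters `ω` of the target of the matrix of the given kind. -/
def MatrixKind.targetLam (κ : MatrixKind) (z lam : Fin 2 → ℂ) : Fin 2 → ℂ :=
  twistLam κ.sup κ.sub z lam

/-- `(lam^{(1,2)}_{id})_1 = (z₁ - z₂ + lam₁ + lam₂) / 2`. -/
def lamN (z lam : Fin 2 → ℂ) : ℂ := twistLam (Equiv.swap 0 1) 1 z lam 0

/-- `(lam_{(1,2)}^{id})_1 = (-z₁ + z₂ + lam₁ + lam₂) / 2`. -/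
def lamD (z lam : Fin 2 → ℂ) : ℂ := twistLam 1 (Equiv.swap 0 1) z lam 0

/-! ### The rational matrices -/

/-- The space of a two-fold tensor product of Verma modules. -/
abbrev VermaSpace₂ : Type := VermaSpace ⊗[ℂ] VermaSpace

/-- The `sl(2)`-module `V(lam₁) ⊗ V(lam₂)`. -/
def verma₂ (lam : Fin 2 → ℂ) : Sl2Module VermaSpace₂ :=
  (verma (lam 0)).tensor (verma (lam 1))

/-- The expansion of `∏_a (u - z_a) / (u - z_a - lam_a)` in powers of `u⁻¹`. -/
def normSeries (z lam : Fin 2 → ℂ) : PowerSeries ℂ :=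
  ∏ a, (1 - PowerSeries.C (z a) * PowerSeries.X) * PowerSeries.mk fun n => (z a + lam a) ^ n

theorem normSeries_zero (z lam : Fin 2 → ℂ) :
    PowerSeries.constantCoeff (normSeries z lam) = 1 := by
  have h : ∀ c : ℂ, PowerSeries.constantCoeff (PowerSeries.mk fun n => c ^ n) = 1 := fun c => by
    rw [← PowerSeries.coeff_zero_eq_constantCoeff_apply, PowerSeries.coeff_mk, pow_zero]
  simp [normSeries, Fin.prod_univ_two, h]

/-- The Yangian module `V(z,lam) = V(z₁,lam₁) ⊗ V(z₂,lam₂)`. The action is normalized: the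
generators act by the series `∏_a (u - z_a) / (u - z_a - lam_a) · T_{ij}(u)`, so that the highest
vector `v₁ ⊗ v₂` has eigenvalue `1` for the `22` series and, for the `11` series, eigenvalue
`∏_a (u - z_a + lam_a) / (u - z_a - lam_a)`. -/
def evalVerma₂ (z lam : Fin 2 → ℂ) : YangianModule VermaSpace₂ :=
  (((verma (lam 0)).eval (z 0)).tensor ((verma (lam 1)).eval (z 1))).twist (normSeries z lam)
    (normSeries_zero z lam)

/-- Homomorphisms of `sl(2)`-modules. -/
def IsSl2Hom {M N : Type*} [AddCommGroup M] [Module ℂ M] [AddCommGroup N] [Module ℂ N]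
    (A : Sl2Module M) (B : Sl2Module N) (φ : M →ₗ[ℂ] N) : Prop :=
  φ ∘ₗ A.e = B.e ∘ₗ φ ∧ φ ∘ₗ A.f = B.f ∘ₗ φ ∧ φ ∘ₗ A.h = B.h ∘ₗ φ

/-- Homomorphisms of Yangian modules: the linear maps commuting with all `T_{ij}^{(a)}`. -/
def IsYangianHom {M N : Type*} [AddCommGroup M] [Module ℂ M] [AddCommGroup N] [Module ℂ N]
    (A : YangianModule M) (B : YangianModule N) (φ : M →ₗ[ℂ] N) : Prop :=
  ∀ (i j : Fin 2) (a : ℕ),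
    φ ∘ₗ (PowerSeries.coeff a (A.T i j) : M →ₗ[ℂ] M) =
      (PowerSeries.coeff a (B.T i j) : N →ₗ[ℂ] N) ∘ₗ φ

/-- `A` is the rational matrix of the given kind: the isomorphism of Yangian modules
`V(z,lam) → V(u,ω)` with `v₁ ⊗ v₂ ↦ w₁ ⊗ w₂` (highest vectors). -/
def IsRationalMatrix (κ : MatrixKind) (z lam : Fin 2 → ℂ) (A : VermaSpace₂ ≃ₗ[ℂ] VermaSpace₂) :
    Prop :=
  IsYangianHom (evalVerma₂ z lam) (evalVerma₂ (κ.targetZ z lam) (κ.targetLam z lam)) A ∧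
    A (fv 0 ⊗ₜ fv 0) = fv 0 ⊗ₜ fv 0

/-- `w` is the singular vector `v_{(lam₁,lam₂;l)}`: it is killed by `e` and has the form
`B_l(lam₁)⁻¹ f^l v₁ ⊗ v₂ + ∑_{a=1}^l c_a f^{l-a} v₁ ⊗ f^a v₂`. -/
def IsSingularVector (lam : Fin 2 → ℂ) (l : ℕ) (w : VermaSpace₂) : Prop :=
  (verma₂ lam).e w = 0 ∧ ∃ c : ℕ → ℂ,
    w = (shapovalov l (lam 0))⁻¹ • (fv l ⊗ₜ[ℂ] fv 0) +
      ∑ a ∈ Finset.Icc 1 l, c a • (fv (l - a) ⊗ₜ[ℂ] fv a)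

/-! ### The trigonometric matrices -/

/-- The `U_q sl(2)`-module `V_q(lam₁) ⊗ V_q(lam₂)`. -/
def qVerma₂ (p : ℂ) (lam : Fin 2 → ℂ) : UqModule p VermaSpace₂ :=
  (qVerma p (lam 0)).tensor (qVerma p (lam 1))

/-- The module `V_q(z₁,lam₁) ⊗ V_q(z₂,lam₂)` over the quantum affine algebra. -/
def qEvalVerma₂ (p : ℂ) (z lam : Fin 2 → ℂ) : AffineModule p VermaSpace₂ :=
  ((qVerma p (lam 0)).eval (z 0)).tensor ((qVerma p (lam 1)).eval (z 1))

/-- Homomorphisms of `U_q sl(2)`-modules. -/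
def IsUqHom {p : ℂ} {M N : Type*} [AddCommGroup M] [Module ℂ M] [AddCommGroup N] [Module ℂ N]
    (A : UqModule p M) (B : UqModule p N) (φ : M →ₗ[ℂ] N) : Prop :=
  φ ∘ₗ A.e = B.e ∘ₗ φ ∧ φ ∘ₗ A.f = B.f ∘ₗ φ ∧ φ ∘ₗ A.K = B.K ∘ₗ φ ∧ φ ∘ₗ A.Kinv = B.Kinv ∘ₗ φ

/-- Homomorphisms of modules over the quantum affine algebra: the linear maps commuting with all
`L_{ij}^{(±s)}`. -/
def IsAffineHom {p : ℂ} {M N : Type*} [AddCommGroup M] [Module ℂ M] [AddCommGroup N] [Module ℂ N]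
    (A : AffineModule p M) (B : AffineModule p N) (φ : M →ₗ[ℂ] N) : Prop :=
  ∀ (i j : Fin 2) (s : ℕ),
    φ ∘ₗ (PowerSeries.coeff s (A.Lp i j) : M →ₗ[ℂ] M) =
        (PowerSeries.coeff s (B.Lp i j) : N →ₗ[ℂ] N) ∘ₗ φ ∧
      φ ∘ₗ (PowerSeries.coeff s (A.Lm i j) : M →ₗ[ℂ] M) =
        (PowerSeries.coeff s (B.Lm i j) : N →ₗ[ℂ] N) ∘ₗ φ

/-- `A` is the trigonometric matrix of the given kind: the isomorphism
`V_q(z,lam) → V_q(u,ω)` of modules over the quantum affine algebra with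
`v₁ ⊗ v₂ ↦ w₁ ⊗ w₂` (highest vectors). -/
def IsTrigMatrix (p : ℂ) (κ : MatrixKind) (z lam : Fin 2 → ℂ)
    (A : VermaSpace₂ ≃ₗ[ℂ] VermaSpace₂) : Prop :=
  IsAffineHom (qEvalVerma₂ p z lam) (qEvalVerma₂ p (κ.targetZ z lam) (κ.targetLam z lam)) A ∧
    A (fv 0 ⊗ₜ fv 0) = fv 0 ⊗ₜ fv 0

/-- `w` is the singular vector `v^q_{(lam₁,lam₂;l)}`: it is killed by `e_q` and has the form
`B^q_l(lam₁)⁻¹ f^l v₁ ⊗ v₂ + ∑_{a=1}^l d_a f^{l-a} v₁ ⊗ f^a v₂`. -/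
def IsQSingularVector (p : ℂ) (lam : Fin 2 → ℂ) (l : ℕ) (w : VermaSpace₂) : Prop :=
  (qVerma₂ p lam).e w = 0 ∧ ∃ c : ℕ → ℂ,
    w = (qShapovalov p l (lam 0))⁻¹ • (fv l ⊗ₜ[ℂ] fv 0) +
      ∑ a ∈ Finset.Icc 1 l, c a • (fv (l - a) ⊗ₜ[ℂ] fv a)

end SpectralDecomposition

end

/-! One entry of the monodromy matrix controls everything. On the basis `b (m, n) = f^m v₁ ⊗ f^n v₂`
the entry `12`, cleared of its denominators (and, in the trigonometric case, of the factor `-(q -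
q⁻¹) ξ`), is a pencil `F u`, affine in `u`, with `F u (b (m, n)) = r n (u - ρ n) b (m + 1, n) + s m
(u - σ m) b (m, n + 1)`. Its values commute; at `u = σ m` only the first index grows, at `u = ρ n`
only the second. Absence of resonances gives `σ m ≠ ρ n`, so the highest vector generates the space;
in effect the space is free of rank one over the polynomial ring in two commuting operators that
span the pencil. Hence between any two such pencils there is exactly one intertwiner fixing the
highest vector, and it is invertible (`IsRaising.hom_ext`, `IsRaising.intertwiner_raise`,
`IsRaising.equiv`).

The other entries follow. The exchange relations move them past `F` with coefficients independent of
the parameters, so they are determined by their action on the highest vector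
(`IsRaising.equiv_diagonal`, `IsRaising.equiv_lower`). The eigenvalues of the diagonal entries there
are symmetric in the numbers `z_a - λ_a` and in the numbers `z_a + λ_a`, and the target parameters
only permute these numbers. The remaining data are symmetric too: the rational normalization leaves
a pole factor in the `z_a + λ_a`, and `L⁻` is recovered from `L⁺` by a scalar depending on `z₁ +
z₂`.

In each weight, being killed by `e` is a two-term recursion, so singular vectors are unique up to a
scalar and are mapped to multiples of each other. To find the multiple, note that the functional
supported on the `b (0, n)` with values `c ^ n`, and its mirror image on the `b (m, 0)`, are
eigenvectors of the transposes of all `F u`, with eigenvalues vanishing at `σ 0`, respectively at `ρ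
0`. If such a root is common to source and target, the intertwiner carries one functional to the
other, and comparing the extreme coefficients of the singular vectors gives the scalar
(`IsRaising.equiv_isSingular_right`, `IsRaising.equiv_isSingular_left`).

The `D` matrix keeps every `z_a - λ_a` and the `N` matrix every `z_a + λ_a`. In the rational case `σ
0 = z₁ - λ₁` serves `D` and `ρ 0 = z₂ + λ₂` serves `N`; in the trigonometric case `σ 0 = q^{2(z₁ +
λ₁)}` serves `N` and `ρ 0 = q^{2(z₂ - λ₂)}` serves `D`, and the ratio of the leading coefficients `s
0` or `r 0` produces the power of `q`. By uniqueness the `R̂` matrix is `N` after `D`, and an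
intermediate Shapovalov value cancels. -/

open scoped TensorProduct Kronecker

noncomputable section

namespace SpectralDecomposition

/-! ### Raising pencils -/

section Abstract

variable {V : Type*} [AddCommGroup V] [Module ℂ V] {b : Module.Basis (ℕ × ℕ) ℂ V}

/-- A pencil of operators `F(u)`, affine in `u`, raising either of the two indices of `b (m, n)`. -/
structure IsRaising (b : Module.Basis (ℕ × ℕ) ℂ V) (F : ℂ → Module.End ℂ V)
    (r ρ s σ : ℕ → ℂ) : Prop where
  act : ∀ u m n, F u (b (m, n)) =
    (r n * (u - ρ n)) • b (m + 1, n) + (s m * (u - σ m)) • b (m, n + 1)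
  r_ne : ∀ n, r n ≠ 0
  s_ne : ∀ m, s m ≠ 0
  ne : ∀ m n, σ m - ρ n ≠ 0
  -- This is the coefficient of `b (m + 1, n + 1)` in the condition that the values of the pencil
  -- commute; the coefficients of `b (m + 2, n)` and `b (m, n + 2)` are symmetric in the two
  -- parameters by themselves.
  compat : ∀ m n, r n * s (m + 1) * (σ (m + 1) - ρ n) = r (n + 1) * s m * (σ m - ρ (n + 1))

namespace IsRaising

variable {F F' : ℂ → Module.End ℂ V} {r ρ s σ r' ρ' s' σ' : ℕ → ℂ}

/-- Any three values of an affine pencil are linearly dependent. This reduces claims about `F u` to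
two convenient parameters, and no division keeps the identity valid when parameters coincide. -/
theorem interpolate (hF : IsRaising b F r ρ s σ) (u v w : ℂ) (y : V) :
    (v - w) • F u y = (u - w) • F v y - (u - v) • F w y := by
  have : (v - w) • F u = (u - w) • F v - (u - v) • F w := by
    refine b.ext fun ⟨m, n⟩ => ?_
    simp only [LinearMap.smul_apply, LinearMap.sub_apply, hF.act]
    module
  exact LinearMap.congr_fun this y

theorem comm (hF : IsRaising b F r ρ s σ) (u v : ℂ) (y : V) :
    F u (F v y) = F v (F u y) := by
  have : F u * F v = F v * F u := by
    refine b.ext fun ⟨m, n⟩ => ?_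
    have h := hF.compat m n
    simp only [Module.End.mul_apply, hF.act, map_add, map_smul]
    match_scalars
    · ring
    · linear_combination (u - v) * h
    · ring
  exact LinearMap.congr_fun this y

theorem basis_succ_left (hF : IsRaising b F r ρ s σ) (m n : ℕ) :
    F (σ m) (b (m, n)) = (r n * (σ m - ρ n)) • b (m + 1, n) := by
  simp [hF.act]

theorem basis_succ_right (hF : IsRaising b F r ρ s σ) (m n : ℕ) :
    F (ρ n) (b (m, n)) = (s m * (ρ n - σ m)) • b (m, n + 1) := by
  simp [hF.act]

theorem ne' (hF : IsRaising b F r ρ s σ) (m n : ℕ) : ρ n - σ m ≠ 0 := by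
  rw [← neg_sub]
  exact neg_ne_zero.2 (hF.ne m n)

/-- The highest vector generates the whole space. -/
theorem generate (hF : IsRaising b F r ρ s σ) (P : Submodule ℂ V) (h0 : b (0, 0) ∈ P)
    (h : ∀ u, ∀ y ∈ P, F u y ∈ P) (y : V) : y ∈ P := by
  have h1 : ∀ m, b (m, 0) ∈ P := by
    intro m
    induction m with
    | zero => exact h0
    | succ m ih =>
      have := h (σ m) _ ih
      rw [hF.basis_succ_left] at this
      exact (P.smul_mem_iff (mul_ne_zero (hF.r_ne _) (hF.ne _ _))).1 this
  have h2 : ∀ n m, b (m, n) ∈ P := by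
    intro n
    induction n with
    | zero => exact h1
    | succ n ih =>
      intro m
      have := h (ρ n) _ (ih m)
      rw [hF.basis_succ_right] at this
      exact (P.smul_mem_iff (mul_ne_zero (hF.s_ne _) (hF.ne' _ _))).1 this
  have h3 : P.mkQ = 0 := b.ext fun ⟨m, n⟩ => by
    rw [LinearMap.zero_apply, Submodule.mkQ_apply, Submodule.Quotient.mk_eq_zero]
    exact h2 n m
  rw [← Submodule.Quotient.mk_eq_zero, ← Submodule.mkQ_apply, h3, LinearMap.zero_apply]

/-- Two linear maps that agree on the highest vector and transform `F` in the same way are equal. -/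
theorem hom_ext {N : Type*} [AddCommGroup N] [Module ℂ N] (hF : IsRaising b F r ρ s σ)
    (G : ℂ → Module.End ℂ N) {φ ψ : V →ₗ[ℂ] N} (h0 : φ (b (0, 0)) = ψ (b (0, 0)))
    (hφ : ∀ u y, φ (F u y) = G u (φ y)) (hψ : ∀ u y, ψ (F u y) = G u (ψ y)) : φ = ψ := by
  refine LinearMap.ext fun y => ?_
  refine hF.generate (LinearMap.eqLocus φ ψ) h0 (fun u y hy => ?_) y
  rw [LinearMap.mem_eqLocus] at hy ⊢
  rw [hφ, hψ, hy]

/-- The images of the vectors `b (m, 0)` under the intertwiner of two pencils. -/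
def imageLeft (b : Module.Basis (ℕ × ℕ) ℂ V) (F' : ℂ → Module.End ℂ V) (r ρ σ : ℕ → ℂ) : ℕ → V
  | 0 => b (0, 0)
  | m + 1 => (r 0 * (σ m - ρ 0))⁻¹ • F' (σ m) (imageLeft b F' r ρ σ m)

/-- The images of the basis vectors under the intertwiner of two pencils. -/
def image (b : Module.Basis (ℕ × ℕ) ℂ V) (F' : ℂ → Module.End ℂ V) (r ρ s σ : ℕ → ℂ) (m : ℕ) : ℕ → V
  | 0 => imageLeft b F' r ρ σ m
  | n + 1 => (s m * (ρ n - σ m))⁻¹ • F' (ρ n) (image b F' r ρ s σ m n)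

theorem image_right (hF : IsRaising b F r ρ s σ) (m n : ℕ) :
    F' (ρ n) (image b F' r ρ s σ m n) = (s m * (ρ n - σ m)) • image b F' r ρ s σ m (n + 1) := by
  rw [image, smul_smul, mul_inv_cancel₀ (mul_ne_zero (hF.s_ne _) (hF.ne' _ _)), one_smul]

/-- The vectors `image` are built by raising the first index completely and then the second. Raising
in the other order gives the same result because `F' (σ m)` commutes past each `F' (ρ n)`; the
scalars match by `compat` for the source pencil. -/
theorem image_left (hF : IsRaising b F r ρ s σ) (hF' : IsRaising b F' r' ρ' s' σ') (m n : ℕ) :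
    F' (σ m) (image b F' r ρ s σ m n) = (r n * (σ m - ρ n)) • image b F' r ρ s σ (m + 1) n := by
  induction n with
  | zero =>
    rw [image, image, imageLeft, smul_smul,
      mul_inv_cancel₀ (mul_ne_zero (hF.r_ne _) (hF.ne _ _)), one_smul]
  | succ n ih =>
    have h1 := hF.s_ne m
    have h2 := hF.ne' m n
    have h := hF.compat m n
    rw [image, map_smul, hF'.comm, ih, map_smul, hF.image_right, smul_smul, smul_smul]
    congr 1
    field_simp
    linear_combination -(σ m - ρ n) * h

/-- The intertwiner of two pencils that fixes the highest vector. -/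
def intertwiner (b : Module.Basis (ℕ × ℕ) ℂ V) (F' : ℂ → Module.End ℂ V) (r ρ s σ : ℕ → ℂ) :
    Module.End ℂ V :=
  b.constr ℂ fun x => image b F' r ρ s σ x.1 x.2

theorem intertwiner_vac : intertwiner b F' r ρ s σ (b (0, 0)) = b (0, 0) := by
  rw [intertwiner, Module.Basis.constr_basis, image, imageLeft]

/-- For `u = σ m` and `u = ρ n` the identity on `b (m, n)` is `image_left` and `image_right`. These
two parameters are distinct, so affine interpolation gives every `u`. -/
theorem intertwiner_raise (hF : IsRaising b F r ρ s σ) (hF' : IsRaising b F' r' ρ' s' σ') (u : ℂ)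
    (y : V) : intertwiner b F' r ρ s σ (F u y) = F' u (intertwiner b F' r ρ s σ y) := by
  have : intertwiner b F' r ρ s σ ∘ₗ F u = F' u ∘ₗ intertwiner b F' r ρ s σ := by
    refine b.ext fun ⟨m, n⟩ => ?_
    simp only [LinearMap.comp_apply, hF.act, map_add, map_smul, intertwiner,
      Module.Basis.constr_basis]
    have h := hF'.interpolate u (σ m) (ρ n) (image b F' r ρ s σ m n)
    rw [hF.image_left hF', hF.image_right] at h
    refine smul_right_injective _ (hF.ne m n) ?_
    simp only [h]
    module
  exact LinearMap.congr_fun this y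

/-- The intertwiner is bijective. -/
def equiv (hF : IsRaising b F r ρ s σ) (hF' : IsRaising b F' r' ρ' s' σ') :
    V ≃ₗ[ℂ] V :=
  LinearEquiv.ofLinearMap (intertwiner b F' r ρ s σ) (intertwiner b F r' ρ' s' σ')
    -- Each composite of the two intertwiners commutes with one of the pencils and fixes the highest
    -- vector, so it is the identity.
    (hF'.hom_ext F' (by simp [intertwiner_vac])
      (fun u y => by simp [hF.intertwiner_raise hF', hF'.intertwiner_raise hF]) fun u y => rfl)
    (hF.hom_ext F (by simp [intertwiner_vac])
      (fun u y => by simp [hF.intertwiner_raise hF', hF'.intertwiner_raise hF]) fun u y => rfl)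

theorem equiv_vac (hF : IsRaising b F r ρ s σ) (hF' : IsRaising b F' r' ρ' s' σ') :
    hF.equiv hF' (b (0, 0)) = b (0, 0) := intertwiner_vac

theorem equiv_raise (hF : IsRaising b F r ρ s σ) (hF' : IsRaising b F' r' ρ' s' σ') (u : ℂ)
    (y : V) : hF.equiv hF' (F u y) = F' u (hF.equiv hF' y) :=
  hF.intertwiner_raise hF' u y

end IsRaising

/-! ### Weight spaces -/

/-- The span of the vectors `b (m, n)` with `m + n = l`. -/
def weightSpace (b : Module.Basis (ℕ × ℕ) ℂ V) (l : ℕ) : Submodule ℂ V :=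
  Submodule.span ℂ {y | ∃ m n, m + n = l ∧ b (m, n) = y}

theorem basis_mem_weightSpace (m n : ℕ) : b (m, n) ∈ weightSpace b (m + n) :=
  Submodule.subset_span ⟨m, n, rfl, rfl⟩

theorem exists_sum_of_mem_weightSpace {l : ℕ} {y : V} (hy : y ∈ weightSpace b l) :
    ∃ c : ℕ → ℂ, y = ∑ a ∈ Finset.range (l + 1), c a • b (l - a, a) := by
  induction hy using Submodule.span_induction with
  | mem y hy =>
    obtain ⟨m, n, rfl, rfl⟩ := hy
    refine ⟨Pi.single n 1, ?_⟩
    rw [Finset.sum_eq_single n]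
    · simp
    · intro b _ hb
      simp [hb]
    · intro h
      simp at h
  | zero => exact ⟨0, by simp⟩
  | add y y' _ _ h h' =>
    obtain ⟨c, rfl⟩ := h
    obtain ⟨c', rfl⟩ := h'
    exact ⟨c + c', by simp [add_smul, Finset.sum_add_distrib]⟩
  | smul k y _ h =>
    obtain ⟨c, rfl⟩ := h
    exact ⟨k • c, by simp [Finset.smul_sum, smul_smul]⟩

namespace IsRaising

variable {F F' : ℂ → Module.End ℂ V} {r ρ s σ r' ρ' s' σ' : ℕ → ℂ}

theorem raise_mem (hF : IsRaising b F r ρ s σ) (u : ℂ) {l : ℕ} {y : V}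
    (hy : y ∈ weightSpace b l) : F u y ∈ weightSpace b (l + 1) := by
  induction hy using Submodule.span_induction with
  | mem y hy =>
    obtain ⟨m, n, rfl, rfl⟩ := hy
    rw [hF.act]
    refine add_mem (Submodule.smul_mem _ _ ?_) (Submodule.smul_mem _ _ ?_)
    · rw [add_right_comm]
      exact basis_mem_weightSpace _ _
    · exact basis_mem_weightSpace m (n + 1)
  | zero => simp
  | add y y' _ _ h h' => rw [map_add]; exact add_mem h h'
  | smul k y _ h => rw [map_smul]; exact Submodule.smul_mem _ _ h

theorem image_mem (hF' : IsRaising b F' r' ρ' s' σ') (m n : ℕ) :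
    image b F' r ρ s σ m n ∈ weightSpace b (m + n) := by
  induction n with
  | zero =>
    rw [image, add_zero]
    induction m with
    | zero => exact basis_mem_weightSpace 0 0
    | succ m ih => exact Submodule.smul_mem _ _ (hF'.raise_mem _ ih)
  | succ n ih => exact Submodule.smul_mem _ _ (hF'.raise_mem _ ih)

/-- Each factor `F' u` in `image` raises the weight by one. The image of a singular vector therefore
stays homogeneous and can be compared with the target's singular vector of the same weight. -/
theorem equiv_mem (hF : IsRaising b F r ρ s σ) (hF' : IsRaising b F' r' ρ' s' σ') {l : ℕ}
    {y : V} (hy : y ∈ weightSpace b l) : hF.equiv hF' y ∈ weightSpace b l := by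
  induction hy using Submodule.span_induction with
  | mem y hy =>
    obtain ⟨m, n, rfl, rfl⟩ := hy
    have : hF.equiv hF' (b (m, n)) = image b F' r ρ s σ m n := b.constr_basis ℂ _ _
    rw [this]
    exact hF'.image_mem m n
  | zero => simp
  | add y y' _ _ h h' => rw [map_add]; exact add_mem h h'
  | smul k y _ h => rw [map_smul]; exact Submodule.smul_mem _ _ h

end IsRaising

/-! ### Functionals -/

/-- The functional `b (0, n) ↦ c ^ n`, vanishing on the other basis vectors. -/
def rightFunctional (b : Module.Basis (ℕ × ℕ) ℂ V) (c : ℂ) : V →ₗ[ℂ] ℂ :=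
  b.constr ℂ fun x => if x.1 = 0 then c ^ x.2 else 0

/-- The functional `b (m, 0) ↦ c ^ m`, vanishing on the other basis vectors. -/
def leftFunctional (b : Module.Basis (ℕ × ℕ) ℂ V) (c : ℂ) : V →ₗ[ℂ] ℂ :=
  b.constr ℂ fun x => if x.2 = 0 then c ^ x.1 else 0

namespace IsRaising

variable {F F' : ℂ → Module.End ℂ V} {r ρ s σ r' ρ' s' σ' : ℕ → ℂ}

/-- The vectors `b (m, n)` with `m > 0` span a subspace stable under `F u`, and on the quotient `F
u` only shifts `n`, always with the same coefficient `s 0 * (u - σ 0)`. A geometric sequence is an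
eigenvector of the transposed shift. -/
theorem rightFunctional_raise (hF : IsRaising b F r ρ s σ) (c u : ℂ) (y : V) :
    rightFunctional b c (F u y) = (c * (s 0 * (u - σ 0))) • rightFunctional b c y := by
  have : rightFunctional b c ∘ₗ F u = (c * (s 0 * (u - σ 0))) • rightFunctional b c := by
    refine b.ext fun ⟨m, n⟩ => ?_
    simp only [LinearMap.comp_apply, hF.act, map_add, map_smul, rightFunctional,
      Module.Basis.constr_basis,
      LinearMap.smul_apply]
    rcases m with _ | m
    · simp; ring
    · simp
  exact LinearMap.congr_fun this y

theorem leftFunctional_raise (hF : IsRaising b F r ρ s σ) (c u : ℂ) (y : V) :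
    leftFunctional b c (F u y) = (c * (r 0 * (u - ρ 0))) • leftFunctional b c y := by
  have : leftFunctional b c ∘ₗ F u = (c * (r 0 * (u - ρ 0))) • leftFunctional b c := by
    refine b.ext fun ⟨m, n⟩ => ?_
    simp only [LinearMap.comp_apply, hF.act, map_add, map_smul, leftFunctional,
      Module.Basis.constr_basis,
      LinearMap.smul_apply]
    rcases n with _ | n
    · simp; ring
    · simp
  exact LinearMap.congr_fun this y

/-- Both sides are eigenfunctionals of the source pencil with the same eigenvalue: `t` absorbs the
change of the leading coefficient, and the root `σ 0` is shared. They agree on the highest vector,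
which generates. -/
theorem rightFunctional_equiv (hF : IsRaising b F r ρ s σ) (hF' : IsRaising b F' r' ρ' s' σ')
    (t : ℂ) (hs : s' 0 = t * s 0) (hσ : σ' 0 = σ 0) (y : V) :
    rightFunctional b 1 (hF.equiv hF' y) = rightFunctional b t y := by
  have : rightFunctional b 1 ∘ₗ (hF.equiv hF' : V →ₗ[ℂ] V) =
      rightFunctional b t := by
    refine hF.hom_ext (fun u => (t * (s 0 * (u - σ 0))) • LinearMap.id) ?_ (fun u y => ?_)
      fun u y => hF.rightFunctional_raise t u y
    · simp [equiv_vac, rightFunctional, Module.Basis.constr_basis]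
    · simp [equiv_raise, hF'.rightFunctional_raise, hs, hσ, mul_assoc]
  exact LinearMap.congr_fun this y

theorem leftFunctional_equiv (hF : IsRaising b F r ρ s σ) (hF' : IsRaising b F' r' ρ' s' σ') (t : ℂ)
    (hr : r' 0 = t * r 0) (hρ : ρ' 0 = ρ 0) (y : V) :
    leftFunctional b 1 (hF.equiv hF' y) = leftFunctional b t y := by
  have : leftFunctional b 1 ∘ₗ (hF.equiv hF' : V →ₗ[ℂ] V) =
      leftFunctional b t := by
    refine hF.hom_ext (fun u => (t * (r 0 * (u - ρ 0))) • LinearMap.id) ?_ (fun u y => ?_)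
      fun u y => hF.leftFunctional_raise t u y
    · simp [equiv_vac, leftFunctional, Module.Basis.constr_basis]
    · simp [equiv_raise, hF'.leftFunctional_raise, hr, hρ, mul_assoc]
  exact LinearMap.congr_fun this y

end IsRaising

/-! ### Bethe relations -/

/-- The exchange relations between the entries of a `2 × 2` monodromy matrix, whose upper right
entry is `F`, and the action of its other entries on the highest vector. -/
structure IsBethe (b : Module.Basis (ℕ × ℕ) ℂ V) (βa γa βd γd : ℂ → ℂ → ℂ) (ε : ℂ) (ea ed : ℂ → ℂ)
    (a d e F : ℂ → Module.End ℂ V) : Prop where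
  a_F : ∀ u v, (u - v) • (a u * F v) = βa u v • (F v * a u) + γa u v • (F u * a v)
  d_F : ∀ u v, (u - v) • (d u * F v) = βd u v • (F v * d u) + γd u v • (F u * d v)
  e_F : ∀ u v, (u - v) • (e u * F v) = (u - v) • (F v * e u) + ε • (a u * d v - a v * d u)
  a_vac : ∀ u, a u (b (0, 0)) = ea u • b (0, 0)
  d_vac : ∀ u, d u (b (0, 0)) = ed u • b (0, 0)
  e_vac : ∀ u, e u (b (0, 0)) = 0

namespace IsRaising

variable {F F' : ℂ → Module.End ℂ V} {r ρ s σ r' ρ' s' σ' : ℕ → ℂ}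

/-- The vectors on which all `x u` are intertwined form a submodule, so it suffices to propagate the
property from the highest vector through the pencil. Exchange relations yield this only for distinct
parameters, since they carry a factor `u - v`. -/
theorem equiv_of_generic (hF : IsRaising b F r ρ s σ) (hF' : IsRaising b F' r' ρ' s' σ')
    {x x' : ℂ → Module.End ℂ V}
    (h0 : ∀ u, hF.equiv hF' (x u (b (0, 0))) = x' u (b (0, 0)))
    (h : ∀ y, (∀ u, hF.equiv hF' (x u y) = x' u (hF.equiv hF' y)) → ∀ u v, u - v ≠ 0 →
      hF.equiv hF' (x u (F v y)) = x' u (hF.equiv hF' (F v y))) (u : ℂ) (y : V) :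
    hF.equiv hF' (x u y) = x' u (hF.equiv hF' y) := by
  let P : Submodule ℂ V :=
    ⨅ u, LinearMap.eqLocus ((hF.equiv hF' : V →ₗ[ℂ] V) ∘ₗ x u)
      (x' u ∘ₗ (hF.equiv hF' : V →ₗ[ℂ] V))
  have hP : ∀ y, y ∈ P ↔ ∀ u, hF.equiv hF' (x u y) = x' u (hF.equiv hF' y) := by
    intro y
    simp [P, Submodule.mem_iInf, LinearMap.mem_eqLocus]
  refine (hP y).1 (hF.generate P ((hP _).2 fun u => ?_) (fun v y hy => (hP _).2 fun u => ?_) y) u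
  · rw [h0, equiv_vac]
  · have hy := h y ((hP y).1 hy)
    by_cases huv : u - v = 0
    -- At coinciding parameters the exchange relation cannot be divided by `u - v`; instead `F u = 2
    -- F (u + 1) - F (u + 2)` reduces to two admissible parameters.
    · obtain rfl := sub_eq_zero.1 huv
      have h1 := hy u (u + 1) (by simp)
      have h2 := hy u (u + 2) (by simp)
      have h3 : F u y = (2 : ℂ) • F (u + 1) y - F (u + 2) y := by
        have := hF.interpolate u (u + 1) (u + 2) y
        rw [show u + 1 - (u + 2) = -1 by ring, show u - (u + 2) = -2 by ring,
          show u - (u + 1) = -1 by ring] at this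
        rw [← neg_inj, ← neg_one_smul ℂ, this]
        module
      simp only [h3, map_sub, map_smul, h1, h2]
    · exact hy u v huv

variable {βa γa βd γd : ℂ → ℂ → ℂ} {ε : ℂ} {ea ed : ℂ → ℂ}
  {a d e a' d' e' : ℂ → Module.End ℂ V}

/-- Source and target satisfy one and the same exchange relation, so moving the diagonal entry past
`F` expresses it through its action on shorter products, and finally through the common eigenvalue
on the highest vector. -/
theorem equiv_diagonal (hF : IsRaising b F r ρ s σ) (hF' : IsRaising b F' r' ρ' s' σ')
    {β γ : ℂ → ℂ → ℂ} {ev : ℂ → ℂ}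
    (h : ∀ u v, (u - v) • (a u * F v) = β u v • (F v * a u) + γ u v • (F u * a v))
    (h' : ∀ u v, (u - v) • (a' u * F' v) = β u v • (F' v * a' u) + γ u v • (F' u * a' v))
    (h0 : ∀ u, a u (b (0, 0)) = ev u • b (0, 0)) (h0' : ∀ u, a' u (b (0, 0)) = ev u • b (0, 0))
    (u : ℂ) (y : V) : hF.equiv hF' (a u y) = a' u (hF.equiv hF' y) := by
  refine hF.equiv_of_generic hF' (fun u => ?_) (fun y hy u v huv => ?_) u y
  · rw [h0, h0', map_smul, equiv_vac]
  · have k := congrArg (hF.equiv hF') (LinearMap.congr_fun (h u v) y)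
    have k' := LinearMap.congr_fun (h' u v) (hF.equiv hF' y)
    simp only [LinearMap.smul_apply, LinearMap.add_apply, Module.End.mul_apply, map_add, map_smul,
      equiv_raise, hy] at k k'
    rw [← k'] at k
    rw [equiv_raise]
    exact smul_right_injective _ huv k

/-- The commutator of the lowering entry with `F` involves only diagonal entries, which are already
intertwined, and the lowering entry kills both highest vectors. -/
theorem equiv_lower (hF : IsRaising b F r ρ s σ) (hF' : IsRaising b F' r' ρ' s' σ')
    (h : IsBethe b βa γa βd γd ε ea ed a d e F) (h' : IsBethe b βa γa βd γd ε ea ed a' d' e' F')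
    (u : ℂ) (y : V) : hF.equiv hF' (e u y) = e' u (hF.equiv hF' y) := by
  have ha := hF.equiv_diagonal hF' h.a_F h'.a_F h.a_vac h'.a_vac
  have hd := hF.equiv_diagonal hF' h.d_F h'.d_F h.d_vac h'.d_vac
  refine hF.equiv_of_generic hF' (fun u => ?_) (fun y hy u v huv => ?_) u y
  · rw [h.e_vac, h'.e_vac, map_zero]
  · have k := congrArg (hF.equiv hF') (LinearMap.congr_fun (h.e_F u v) y)
    have k' := LinearMap.congr_fun (h'.e_F u v) (hF.equiv hF' y)
    simp only [LinearMap.smul_apply, LinearMap.add_apply, LinearMap.sub_apply,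
      Module.End.mul_apply, map_add, map_sub, map_smul, equiv_raise, hy, ha, hd] at k k'
    rw [← k'] at k
    rw [equiv_raise]
    exact smul_right_injective _ huv k

end IsRaising

end Abstract

/-! ### Singular vectors -/

section Singular

variable {V : Type*} [AddCommGroup V] [Module ℂ V] {b : Module.Basis (ℕ × ℕ) ℂ V}

/-- An operator lowering either of the two indices of `b (m, n)`. -/
structure IsLowering (b : Module.Basis (ℕ × ℕ) ℂ V) (e : Module.End ℂ V) (β₁ β₂ g k : ℕ → ℂ) :
    Prop where
  act : ∀ m n, e (b (m, n)) = (β₁ m * g n) • b (m - 1, n) + (β₂ n * k m) • b (m, n - 1)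
  -- These two vanishing conditions make the truncated differences `m - 1` and `n - 1` harmless at
  -- `0`.
  left_zero : β₁ 0 = 0
  right_zero : β₂ 0 = 0
  left_ne : ∀ m, β₁ (m + 1) ≠ 0
  right_ne : ∀ n, β₂ (n + 1) ≠ 0
  k_ne : ∀ m, k m ≠ 0

/-- A vector of weight `l` killed by `e`, with the coefficient `B` at `b (l, 0)`. -/
def IsSingular (b : Module.Basis (ℕ × ℕ) ℂ V) (e : Module.End ℂ V) (B : ℂ) (l : ℕ) (w : V) : Prop :=
  e w = 0 ∧ ∃ c : ℕ → ℂ, w = B • b (l, 0) + ∑ a ∈ Finset.Icc 1 l, c a • b (l - a, a)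

/-- The coefficients of the singular vector of weight `l`. -/
def singularCoeff (β₁ β₂ g k : ℕ → ℂ) (l : ℕ) : ℕ → ℂ
  | 0 => 1
  -- The value for which the coefficient of `b (l - a - 1, a)` in the image under `e` vanishes.
  | a + 1 => -(β₁ (l - a) * g a / (β₂ (a + 1) * k (l - a - 1))) * singularCoeff β₁ β₂ g k l a

/-- The singular vector of weight `l`, with the coefficient `1` at `b (l, 0)`. -/
def singularVector (b : Module.Basis (ℕ × ℕ) ℂ V) (β₁ β₂ g k : ℕ → ℂ) (l : ℕ) : V :=
  ∑ a ∈ Finset.range (l + 1), singularCoeff β₁ β₂ g k l a • b (l - a, a)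

theorem sum_mem_weightSpace (c : ℕ → ℂ) (l : ℕ) :
    ∑ a ∈ Finset.range (l + 1), c a • b (l - a, a) ∈ weightSpace b l := by
  refine Submodule.sum_mem _ fun a ha => Submodule.smul_mem _ _ ?_
  have h := basis_mem_weightSpace (b := b) (l - a) a
  rwa [Nat.sub_add_cancel (Finset.mem_range_succ_iff.1 ha)] at h

theorem sum_split (c : ℕ → ℂ) (l : ℕ) :
    ∑ a ∈ Finset.range (l + 1), c a • b (l - a, a) =
      c 0 • b (l, 0) + ∑ a ∈ Finset.Icc 1 l, c a • b (l - a, a) := by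
  rw [Finset.range_eq_Ico, Finset.sum_eq_sum_Ico_succ_bot (by omega)]
  rfl

theorem leftFunctional_sum (c : ℕ → ℂ) (t : ℂ) (l : ℕ) :
    leftFunctional b t (∑ a ∈ Finset.range (l + 1), c a • b (l - a, a)) = c 0 * t ^ l := by
  rw [map_sum, Finset.sum_eq_single 0]
  · simp [leftFunctional, Module.Basis.constr_basis]
  · intro a _ ha
    simp [leftFunctional, Module.Basis.constr_basis, ha]
  · simp

theorem rightFunctional_sum (c : ℕ → ℂ) (t : ℂ) (l : ℕ) :
    rightFunctional b t (∑ a ∈ Finset.range (l + 1), c a • b (l - a, a)) = c l * t ^ l := by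
  rw [map_sum, Finset.sum_eq_single l]
  · simp [rightFunctional, Module.Basis.constr_basis]
  · intro a h ha
    have : l - a ≠ 0 := by
      have := Finset.mem_range.1 h
      omega
    simp [rightFunctional, Module.Basis.constr_basis, this]
  · simp

theorem eq_zero_of_sum_eq_zero {c : ℕ → ℂ} {l : ℕ}
    (h : ∑ a ∈ Finset.range (l + 1), c a • b (l - a, a) = 0) {a : ℕ} (ha : a ≤ l) : c a = 0 := by
  have inj : Function.Injective fun a : Finset.range (l + 1) => (l - (a : ℕ), (a : ℕ)) :=
    fun x y hxy => Subtype.ext (Prod.ext_iff.1 hxy).2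
  have hl := (b.linearIndependent.comp _ inj)
  rw [Fintype.linearIndependent_iff] at hl
  refine hl (fun x => c x) ?_ ⟨a, by simpa [Nat.lt_succ_iff] using ha⟩
  rw [← h, ← Finset.sum_coe_sort (Finset.range (l + 1))]
  rfl

namespace IsLowering

variable {e : Module.End ℂ V} {β₁ β₂ g k : ℕ → ℂ}

theorem lower_sum (he : IsLowering b e β₁ β₂ g k) (c : ℕ → ℂ) (l : ℕ) :
    e (∑ a ∈ Finset.range (l + 1 + 1), c a • b (l + 1 - a, a)) =
      ∑ a ∈ Finset.range (l + 1), (c a * (β₁ (l + 1 - a) * g a) +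
        c (a + 1) * (β₂ (a + 1) * k (l - a))) • b (l - a, a) := by
  simp only [map_sum, map_smul, he.act, smul_add, Finset.sum_add_distrib, smul_smul, add_smul]
  congr 1
  · rw [Finset.sum_range_succ, Nat.sub_self, he.left_zero]
    simp only [zero_mul, mul_zero, zero_smul, add_zero]
    refine Finset.sum_congr rfl fun a ha => ?_
    rw [show l + 1 - a - 1 = l - a by omega]
  · rw [Finset.sum_range_succ', he.right_zero]
    simp

theorem lower_zero (he : IsLowering b e β₁ β₂ g k) : e (b (0, 0)) = 0 := by
  simp [he.act, he.left_zero, he.right_zero]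

theorem lower_singularVector (he : IsLowering b e β₁ β₂ g k) (l : ℕ) :
    e (singularVector b β₁ β₂ g k l) = 0 := by
  rcases l with _ | l
  · simp [singularVector, he.lower_zero]
  · rw [singularVector, he.lower_sum]
    refine Finset.sum_eq_zero fun a ha => ?_
    have h1 := he.right_ne a
    have h2 := he.k_ne (l - a)
    rw [singularCoeff, show l + 1 - a - 1 = l - a by omega]
    convert zero_smul ℂ _
    field_simp
    ring

/-- Vanishing of the image, read coefficient by coefficient, is a first-order recursion in `a`.
Since `β₂ (a + 1)` and `k` do not vanish, it is solvable and leaves only the coefficient at `b (l,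
0)` free. -/
theorem eq_smul_singularVector (he : IsLowering b e β₁ β₂ g k) {l : ℕ} (c : ℕ → ℂ)
    (h : e (∑ a ∈ Finset.range (l + 1), c a • b (l - a, a)) = 0) :
    ∑ a ∈ Finset.range (l + 1), c a • b (l - a, a) = c 0 • singularVector b β₁ β₂ g k l := by
  rcases l with _ | l
  · simp [singularVector, singularCoeff]
  · rw [he.lower_sum] at h
    have key : ∀ a, a ≤ l + 1 → c a = c 0 * singularCoeff β₁ β₂ g k (l + 1) a := by
      intro a
      induction a with
      | zero => simp [singularCoeff]
      | succ a ih =>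
        intro ha
        have h0 := eq_zero_of_sum_eq_zero h (a := a) (by omega)
        have h1 := he.right_ne a
        have h2 := he.k_ne (l - a)
        rw [ih (by omega)] at h0
        rw [singularCoeff, show l + 1 - a - 1 = l - a by omega]
        field_simp
        linear_combination h0
    rw [singularVector, Finset.smul_sum]
    refine Finset.sum_congr rfl fun a ha => ?_
    rw [smul_smul, ← key a (by simpa [Nat.lt_succ_iff] using ha)]

theorem isSingular_iff (he : IsLowering b e β₁ β₂ g k) (B : ℂ) (l : ℕ) (w : V) :
    IsSingular b e B l w ↔ w = B • singularVector b β₁ β₂ g k l := by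
  constructor
  · rintro ⟨h, c, rfl⟩
    -- The coefficient `c 0` is arbitrary in the definition of a singular vector; it is replaced by
    -- `B` so that the leading term joins the sum.
    have hs : ∑ a ∈ Finset.range (l + 1), Function.update c 0 B a • b (l - a, a) =
        B • b (l, 0) + ∑ a ∈ Finset.Icc 1 l, c a • b (l - a, a) := by
      rw [sum_split, Function.update_self]
      congr 1
      refine Finset.sum_congr rfl fun a ha => ?_
      have : a ≠ 0 := by
        have := (Finset.mem_Icc.1 ha).1
        omega
      rw [Function.update_of_ne this]
    rw [← hs] at h ⊢
    rw [he.eq_smul_singularVector _ h, Function.update_self]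
  · rintro rfl
    refine ⟨by rw [map_smul, he.lower_singularVector, smul_zero],
      fun a => B * singularCoeff β₁ β₂ g k l a, ?_⟩
    rw [singularVector, sum_split, smul_add, Finset.smul_sum, singularCoeff, one_smul]
    simp only [smul_smul]

theorem existsUnique_isSingular (he : IsLowering b e β₁ β₂ g k) (B : ℂ) (l : ℕ) :
    ∃! w, IsSingular b e B l w := by
  simp only [he.isSingular_iff]
  exact existsUnique_eq

/-- In weight `l` the recursion only meets the quotients `g a / k (l - a - 1)`, which all equal `θ`.
It therefore telescopes: the `β₁` factors run down from `β₁ l` and the `β₂` factors run up from `β₂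
1`. -/
theorem singularCoeff_mul (he : IsLowering b e β₁ β₂ g k) {l : ℕ} {θ : ℂ}
    (hθ : ∀ m n, m + n + 1 = l → g n = θ * k m) {a : ℕ} (ha : a ≤ l) :
    singularCoeff β₁ β₂ g k l a * ∏ i ∈ Finset.range a, β₂ (i + 1) =
      (-θ) ^ a * ∏ i ∈ Finset.range a, β₁ (l - 1 - i + 1) := by
  induction a with
  | zero => simp [singularCoeff]
  | succ a ih =>
    have h1 := he.right_ne a
    have h2 := he.k_ne (l - a - 1)
    rw [Finset.prod_range_succ, Finset.prod_range_succ, singularCoeff,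
      hθ (l - a - 1) a (by omega), show l - 1 - a + 1 = l - a by omega]
    have := ih (by omega)
    field_simp
    linear_combination -β₁ (l - a) * θ * this

theorem singularCoeff_last (he : IsLowering b e β₁ β₂ g k) {l : ℕ} {θ : ℂ}
    (hθ : ∀ m n, m + n + 1 = l → g n = θ * k m) :
    singularCoeff β₁ β₂ g k l l * ∏ i ∈ Finset.range l, β₂ (i + 1) =
      (-θ) ^ l * ∏ i ∈ Finset.range l, β₁ (i + 1) := by
  rw [he.singularCoeff_mul hθ le_rfl, Finset.prod_range_reflect (fun i => β₁ (i + 1))]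

end IsLowering

namespace IsRaising

variable {F F' : ℂ → Module.End ℂ V} {r ρ s σ r' ρ' s' σ' : ℕ → ℂ} {e e' : Module.End ℂ V}
  {β₁ β₂ g k β₁' β₂' g' k' : ℕ → ℂ}

/-- The image has weight `l` and is killed by `e'`, and such vectors form a line. -/
theorem equiv_singularVector (hF : IsRaising b F r ρ s σ) (hF' : IsRaising b F' r' ρ' s' σ')
    (he : IsLowering b e β₁ β₂ g k) (he' : IsLowering b e' β₁' β₂' g' k')
    (h : ∀ y, hF.equiv hF' (e y) = e' (hF.equiv hF' y)) (l : ℕ) :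
    ∃ x : ℂ, hF.equiv hF' (singularVector b β₁ β₂ g k l) =
      x • singularVector b β₁' β₂' g' k' l := by
  obtain ⟨c, hc⟩ := exists_sum_of_mem_weightSpace
    (hF.equiv_mem hF' (sum_mem_weightSpace (b := b) (singularCoeff β₁ β₂ g k l) l))
  refine ⟨c 0, ?_⟩
  rw [← he'.eq_smul_singularVector, ← hc, singularVector]
  rw [← hc, ← h, ← singularVector, he.lower_singularVector, map_zero]

/-- Both vectors `singularVector` have coefficient `1` at `b (l, 0)`, and the left functional reads
off this coefficient with weight `t ^ l` in the source. Their ratio is thus `t ^ l`; the products of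
`β₁` enter only through the normalization of `w` and `w'`. -/
theorem equiv_isSingular_left (hF : IsRaising b F r ρ s σ) (hF' : IsRaising b F' r' ρ' s' σ')
    (he : IsLowering b e β₁ β₂ g k) (he' : IsLowering b e' β₁' β₂' g' k')
    (h : ∀ y, hF.equiv hF' (e y) = e' (hF.equiv hF' y)) (t : ℂ)
    (hr : r' 0 = t * r 0) (hρ : ρ' 0 = ρ 0) {l : ℕ} {w w' : V}
    (hw : IsSingular b e (∏ i ∈ Finset.range l, β₁ (i + 1))⁻¹ l w)
    (hw' : IsSingular b e' (∏ i ∈ Finset.range l, β₁' (i + 1))⁻¹ l w') :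
    hF.equiv hF' w = (t ^ l * ((∏ i ∈ Finset.range l, β₁' (i + 1)) /
      ∏ i ∈ Finset.range l, β₁ (i + 1))) • w' := by
  obtain ⟨x, hx⟩ := hF.equiv_singularVector hF' he he' h l
  have h1 := congrArg (leftFunctional b 1) hx
  rw [hF.leftFunctional_equiv hF' t hr hρ, map_smul, singularVector, singularVector,
    leftFunctional_sum, leftFunctional_sum, singularCoeff, singularCoeff, one_pow, smul_eq_mul,
    one_mul, one_mul, mul_one] at h1
  have hne : ∏ i ∈ Finset.range l, β₁' (i + 1) ≠ 0 :=
    Finset.prod_ne_zero_iff.2 fun i _ => he'.left_ne i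
  rw [(he.isSingular_iff _ _ _).1 hw, (he'.isSingular_iff _ _ _).1 hw', map_smul, hx, ← h1,
    smul_smul, smul_smul]
  congr 1
  field_simp

/-- Here the coefficients at `b (0, l)` are compared; by `singularCoeff_last` they are `(-θ) ^ l ∏
β₁ / ∏ β₂`. The powers of `-θ` cancel between source and target, and the products of `β₁` cancel
against the normalization, leaving those of `β₂`. -/
theorem equiv_isSingular_right (hF : IsRaising b F r ρ s σ) (hF' : IsRaising b F' r' ρ' s' σ')
    (he : IsLowering b e β₁ β₂ g k) (he' : IsLowering b e' β₁' β₂' g' k')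
    (h : ∀ y, hF.equiv hF' (e y) = e' (hF.equiv hF' y)) (t : ℂ)
    (hs : s' 0 = t * s 0) (hσ : σ' 0 = σ 0) {l : ℕ} {θ : ℂ} (hθ0 : θ ≠ 0)
    (hθ : ∀ m n, m + n + 1 = l → g n = θ * k m) (hθ' : ∀ m n, m + n + 1 = l → g' n = θ * k' m)
    {w w' : V} (hw : IsSingular b e (∏ i ∈ Finset.range l, β₁ (i + 1))⁻¹ l w)
    (hw' : IsSingular b e' (∏ i ∈ Finset.range l, β₁' (i + 1))⁻¹ l w') :
    hF.equiv hF' w = (t ^ l * ((∏ i ∈ Finset.range l, β₂' (i + 1)) /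
      ∏ i ∈ Finset.range l, β₂ (i + 1))) • w' := by
  obtain ⟨x, hx⟩ := hF.equiv_singularVector hF' he he' h l
  have h1 := congrArg (rightFunctional b 1) hx
  rw [hF.rightFunctional_equiv hF' t hs hσ, map_smul, singularVector, singularVector,
    rightFunctional_sum, rightFunctional_sum, one_pow, smul_eq_mul, mul_one] at h1
  have c1 := he.singularCoeff_last hθ
  have c2 := he'.singularCoeff_last hθ'
  have n1 : ∏ i ∈ Finset.range l, β₁ (i + 1) ≠ 0 :=
    Finset.prod_ne_zero_iff.2 fun i _ => he.left_ne i
  have n2 : ∏ i ∈ Finset.range l, β₂ (i + 1) ≠ 0 :=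
    Finset.prod_ne_zero_iff.2 fun i _ => he.right_ne i
  have n3 : ∏ i ∈ Finset.range l, β₁' (i + 1) ≠ 0 :=
    Finset.prod_ne_zero_iff.2 fun i _ => he'.left_ne i
  have n4 : ∏ i ∈ Finset.range l, β₂' (i + 1) ≠ 0 :=
    Finset.prod_ne_zero_iff.2 fun i _ => he'.right_ne i
  have n5 : (-θ) ^ l ≠ 0 := pow_ne_zero _ (neg_ne_zero.2 hθ0)
  rw [← eq_div_iff n2] at c1
  rw [← eq_div_iff n4] at c2
  rw [c1, c2] at h1
  rw [(he.isSingular_iff _ _ _).1 hw, (he'.isSingular_iff _ _ _).1 hw', map_smul, hx,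
    smul_smul, smul_smul]
  congr 1
  field_simp at h1 ⊢
  linear_combination -h1

end IsRaising

end Singular

/-! ### Maps intertwining series of operators -/

section Intertwining

variable {M N : Type*} [AddCommGroup M] [Module ℂ M] [AddCommGroup N] [Module ℂ N]

/-- The map `φ` intertwines all coefficients of two series of operators. -/
def IntertwinesSeries (φ : M →ₗ[ℂ] N) (P : PowerSeries (Module.End ℂ M))
    (Q : PowerSeries (Module.End ℂ N)) : Prop :=
  ∀ (n : ℕ) (y : M), φ (PowerSeries.coeff n P y) = PowerSeries.coeff n Q (φ y)

theorem IntertwinesSeries.mul {φ : M →ₗ[ℂ] N} {P P' : PowerSeries (Module.End ℂ M)}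
    {Q Q' : PowerSeries (Module.End ℂ N)} (h : IntertwinesSeries φ P Q)
    (h' : IntertwinesSeries φ P' Q') : IntertwinesSeries φ (P * P') (Q * Q') := by
  intro n y
  simp only [PowerSeries.coeff_mul, LinearMap.sum_apply, map_sum, Module.End.mul_apply]
  exact Finset.sum_congr rfl fun x _ => by rw [h, h']

/-- A scalar series, acting on `M`. -/
def scalarSeries (M : Type*) [AddCommGroup M] [Module ℂ M] :
    PowerSeries ℂ →+* PowerSeries (Module.End ℂ M) :=
  PowerSeries.map (algebraMap ℂ (Module.End ℂ M))

theorem intertwinesSeries_scalar (φ : M →ₗ[ℂ] N) (s : PowerSeries ℂ) :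
    IntertwinesSeries φ (scalarSeries M s) (scalarSeries N s) := by
  intro n y
  simp [scalarSeries, PowerSeries.coeff_map, Module.algebraMap_end_apply]

/-- A scalar series commutes with every linear map coefficientwise, and one with nonzero constant
term is invertible, so a common factor can be cancelled. -/
theorem intertwinesSeries_scalar_mul {φ : M →ₗ[ℂ] N} {P : PowerSeries (Module.End ℂ M)}
    {Q : PowerSeries (Module.End ℂ N)} {s : PowerSeries ℂ}
    (hs : PowerSeries.constantCoeff s ≠ 0) :
    IntertwinesSeries φ (scalarSeries M s * P) (scalarSeries N s * Q) ↔
      IntertwinesSeries φ P Q := by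
  refine ⟨fun h => ?_, fun h => (intertwinesSeries_scalar φ s).mul h⟩
  have := (intertwinesSeries_scalar φ s⁻¹).mul h
  rwa [← mul_assoc, ← mul_assoc, ← map_mul, ← map_mul, PowerSeries.inv_mul_cancel s hs, map_one,
    map_one, one_mul, one_mul] at this

theorem scalarSeries_comm (s : PowerSeries ℂ) (P : PowerSeries (Module.End ℂ M)) :
    scalarSeries M s * P = P * scalarSeries M s := by
  refine commute_series fun m n => ?_
  rw [scalarSeries, PowerSeries.coeff_map]
  exact Algebra.commutes _ _

/-! ### Quadratic polynomials with coefficients in a ring -/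

section Quad

variable {E : Type*} [Ring E]

/-- The polynomial `a + b X + c X²`. -/
def quadSeries (a b c : E) : PowerSeries E :=
  PowerSeries.C a + PowerSeries.X * PowerSeries.C b + PowerSeries.X ^ 2 * PowerSeries.C c

theorem coeff_quadSeries (a b c : E) (n : ℕ) : PowerSeries.coeff n (quadSeries a b c) =
    if n = 0 then a else if n = 1 then b else if n = 2 then c else 0 := by
  rcases n with _ | _ | _ | n <;>
    simp [quadSeries, pow_succ, mul_assoc, PowerSeries.coeff_succ_X_mul, PowerSeries.coeff_X]

theorem linear_mul_linear (a b c d : E) :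
    (PowerSeries.C a + PowerSeries.X * PowerSeries.C b) *
      (PowerSeries.C c + PowerSeries.X * PowerSeries.C d) =
      quadSeries (a * c) (a * d + b * c) (b * d) := by
  have h : ∀ y : PowerSeries E, y * PowerSeries.X = PowerSeries.X * y :=
    fun y => PowerSeries.commute_X y
  have h' : ∀ y w : PowerSeries E, y * (PowerSeries.X * w) = PowerSeries.X * (y * w) :=
    fun y w => by rw [← mul_assoc, h, mul_assoc]
  simp only [quadSeries, add_mul, mul_add, mul_assoc, map_mul, map_add, h', pow_two]
  abel

theorem quadSeries_add (a b c a' b' c' : E) :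
    quadSeries a b c + quadSeries a' b' c' = quadSeries (a + a') (b + b') (c + c') := by
  simp only [quadSeries, map_add, mul_add]
  abel

end Quad

theorem intertwinesSeries_quad (φ : M →ₗ[ℂ] N) (a b c : Module.End ℂ M)
    (a' b' c' : Module.End ℂ N) :
    IntertwinesSeries φ (quadSeries a b c) (quadSeries a' b' c') ↔
      (∀ y, φ (a y) = a' (φ y)) ∧ (∀ y, φ (b y) = b' (φ y)) ∧ ∀ y, φ (c y) = c' (φ y) := by
  simp only [IntertwinesSeries, coeff_quadSeries]
  constructor
  · intro h
    exact ⟨h 0, h 1, h 2⟩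
  · rintro ⟨h0, h1, h2⟩ n y
    rcases n with _ | _ | _ | n
    · simp [h0]
    · simp [h1]
    · simp [h2]
    · simp

/-- The value `a + u b + u² c` of a quadratic pencil of operators. -/
def quadPencil (a b c : Module.End ℂ M) (u : ℂ) : Module.End ℂ M := a + u • b + u ^ 2 • c

/-- The values at `u = 0, 1, -1` determine a quadratic polynomial: the first gives `a`, the sum and
difference of the others give `2c` and `2b`. -/
theorem intertwines_quadPencil (φ : M →ₗ[ℂ] N) (a b c : Module.End ℂ M)
    (a' b' c' : Module.End ℂ N) :
    (∀ u y, φ (quadPencil a b c u y) = quadPencil a' b' c' u (φ y)) ↔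
      (∀ y, φ (a y) = a' (φ y)) ∧ (∀ y, φ (b y) = b' (φ y)) ∧ ∀ y, φ (c y) = c' (φ y) := by
  simp only [quadPencil, LinearMap.add_apply, LinearMap.smul_apply, map_add, map_smul]
  constructor
  · intro h
    have h0 : ∀ y, φ (a y) = a' (φ y) := fun y => by simpa using h 0 y
    have h1 : ∀ y, φ (b y) + φ (c y) = b' (φ y) + c' (φ y) := fun y => by
      simpa [h0, add_assoc] using h 1 y
    have h2 : ∀ y, -φ (b y) + φ (c y) = -b' (φ y) + c' (φ y) := fun y => by
      simpa [h0, add_assoc] using h (-1) y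
    refine ⟨h0, fun y => ?_, fun y => ?_⟩
    · refine smul_right_injective _ (two_ne_zero (α := ℂ)) ?_
      have := congrArg₂ (· - ·) (h1 y) (h2 y)
      simp only [two_smul]
      convert this using 1 <;> abel
    · refine smul_right_injective _ (two_ne_zero (α := ℂ)) ?_
      have := congrArg₂ (· + ·) (h1 y) (h2 y)
      simp only [two_smul]
      convert this using 1 <;> abel
  · rintro ⟨h0, h1, h2⟩ u y
    rw [h0, h1, h2]

end Intertwining

/-! ### The Yangian action on a tensor product of two evaluation modules -/

section Rational

variable {M N : Type*} [AddCommGroup M] [Module ℂ M] [AddCommGroup N] [Module ℂ N]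

/-- The constant term of the polynomial `L`-operator `u - z + h, f; e, u - z - h`. -/
def Sl2Module.lax (A : Sl2Module M) (z : ℂ) : Matrix (Fin 2) (Fin 2) (Module.End ℂ M) :=
  !![A.h - z • 1, A.f; A.e, -A.h - z • 1]

theorem one_sub_mul_geomSeries (z : ℂ) :
    (1 - PowerSeries.C z * PowerSeries.X) * geomSeries z = PowerSeries.X := by
  linear_combination geomSeries_eq z

theorem scalarSeries_X : scalarSeries M PowerSeries.X = PowerSeries.X := PowerSeries.map_X _

theorem scalarSeries_one_sub (z : ℂ) :
    scalarSeries M (1 - PowerSeries.C z * PowerSeries.X) =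
      1 - PowerSeries.X * PowerSeries.C (z • 1 : Module.End ℂ M) := by
  rw [map_sub, map_one, map_mul, scalarSeries_X, ← PowerSeries.commute_X, scalarSeries,
    PowerSeries.map_C, Algebra.algebraMap_eq_smul_one]

/-- Multiplication by `1 - z u⁻¹` turns the expansion of `1 / (u - z)` into `u⁻¹`, so the evaluation
module becomes linear in `u⁻¹`. -/
theorem Sl2Module.eval_mul (A : Sl2Module M) (z : ℂ) (i j : Fin 2) :
    scalarSeries M (1 - PowerSeries.C z * PowerSeries.X) * (A.eval z).T i j =
      PowerSeries.C ((1 : Matrix (Fin 2) (Fin 2) (Module.End ℂ M)) i j) +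
        PowerSeries.X * PowerSeries.C (A.lax z i j) := by
  have h : scalarSeries M (1 - PowerSeries.C z * PowerSeries.X) *
      PowerSeries.map (algebraMap ℂ (Module.End ℂ M)) (geomSeries z) = PowerSeries.X := by
    rw [← scalarSeries, ← map_mul, one_sub_mul_geomSeries, scalarSeries_X]
  have h' := scalarSeries_one_sub (M := M) z
  generalize scalarSeries M (1 - PowerSeries.C z * PowerSeries.X) = c at h h' ⊢
  fin_cases i <;> fin_cases j <;>
    simp [Sl2Module.eval, Sl2Module.lax, mul_add, mul_sub, ← mul_assoc, h] <;>
    rw [h'] <;> abel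

/-- The first `L`-operator, acting on a tensor product. -/
def laxLeft (N : Type*) [AddCommGroup N] [Module ℂ N] (A : Sl2Module M) (z : ℂ) :
    Matrix (Fin 2) (Fin 2) (Module.End ℂ (M ⊗[ℂ] N)) :=
  (A.lax z).map (Module.End.rTensorAlgHom ℂ M N)

/-- The second `L`-operator, acting on a tensor product. -/
def laxRight (M : Type*) [AddCommGroup M] [Module ℂ M] (B : Sl2Module N) (w : ℂ) :
    Matrix (Fin 2) (Fin 2) (Module.End ℂ (M ⊗[ℂ] N)) :=
  (B.lax w).map (Module.End.lTensorAlgHom ℂ N M)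

theorem onLeft_scalarSeries (s : PowerSeries ℂ) :
    onLeft M N (scalarSeries M s) = scalarSeries (M ⊗[ℂ] N) s := by
  ext1 n
  simp only [onLeft, scalarSeries, PowerSeries.coeff_map]
  exact (Module.End.rTensorAlgHom ℂ M N).commutes _

theorem onRight_scalarSeries (s : PowerSeries ℂ) :
    onRight M N (scalarSeries N s) = scalarSeries (M ⊗[ℂ] N) s := by
  ext1 n
  simp only [onRight, scalarSeries, PowerSeries.coeff_map]
  exact (Module.End.lTensorAlgHom ℂ N M).commutes _

theorem onLeft_linear (a c : Module.End ℂ M) :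
    onLeft M N (PowerSeries.C a + PowerSeries.X * PowerSeries.C c) =
      PowerSeries.C (Module.End.rTensorAlgHom ℂ M N a) +
        PowerSeries.X * PowerSeries.C (Module.End.rTensorAlgHom ℂ M N c) := by
  rw [map_add, map_mul, onLeft, PowerSeries.map_C, PowerSeries.map_C, PowerSeries.map_X]
  rfl

theorem onRight_linear (a c : Module.End ℂ N) :
    onRight M N (PowerSeries.C a + PowerSeries.X * PowerSeries.C c) =
      PowerSeries.C (Module.End.lTensorAlgHom ℂ N M a) +
        PowerSeries.X * PowerSeries.C (Module.End.lTensorAlgHom ℂ N M c) := by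
  rw [map_add, map_mul, onRight, PowerSeries.map_C, PowerSeries.map_C, PowerSeries.map_X]
  rfl

/-- The entries of the polynomial monodromy matrix, as series in `u⁻¹`. -/
def yangianSeries (A : Sl2Module M) (B : Sl2Module N) (z w : ℂ) (i j : Fin 2) :
    PowerSeries (Module.End ℂ (M ⊗[ℂ] N)) :=
  quadSeries ((1 : Matrix (Fin 2) (Fin 2) (Module.End ℂ (M ⊗[ℂ] N))) i j)
    ((laxLeft N A z + laxRight M B w) i j) ((laxLeft N A z * laxRight M B w) i j)

/-- The entries of the polynomial monodromy matrix `(u + L₁)(u + L₂)`. -/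
def yangianPencil (A : Sl2Module M) (B : Sl2Module N) (z w : ℂ) (i j : Fin 2) :
    ℂ → Module.End ℂ (M ⊗[ℂ] N) :=
  quadPencil ((laxLeft N A z * laxRight M B w) i j) ((laxLeft N A z + laxRight M B w) i j)
    ((1 : Matrix (Fin 2) (Fin 2) (Module.End ℂ (M ⊗[ℂ] N))) i j)

theorem tensor_eval_mul (A : Sl2Module M) (B : Sl2Module N) (z w : ℂ) (i j : Fin 2) :
    scalarSeries (M ⊗[ℂ] N) ((1 - PowerSeries.C z * PowerSeries.X) *
      (1 - PowerSeries.C w * PowerSeries.X)) * ((A.eval z).tensor (B.eval w)).T i j =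
      yangianSeries A B z w i j := by
  have h : ∀ a, scalarSeries (M ⊗[ℂ] N) ((1 - PowerSeries.C z * PowerSeries.X) *
      (1 - PowerSeries.C w * PowerSeries.X)) *
      (onLeft M N ((A.eval z).T i a) * onRight M N ((B.eval w).T a j)) =
      onLeft M N (scalarSeries M (1 - PowerSeries.C z * PowerSeries.X) * (A.eval z).T i a) *
      onRight M N (scalarSeries N (1 - PowerSeries.C w * PowerSeries.X) * (B.eval w).T a j) := by
    intro a
    rw [map_mul, map_mul, map_mul, onLeft_scalarSeries, onRight_scalarSeries]
    simp only [mul_assoc]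
    rw [← mul_assoc (scalarSeries (M ⊗[ℂ] N) (1 - PowerSeries.C w * PowerSeries.X)),
      scalarSeries_comm _ (onLeft M N _), mul_assoc]
  have hT : ((A.eval z).tensor (B.eval w)).T i j =
      onLeft M N ((A.eval z).T i 0) * onRight M N ((B.eval w).T 0 j) +
        onLeft M N ((A.eval z).T i 1) * onRight M N ((B.eval w).T 1 j) := Fin.sum_univ_two _
  rw [hT, mul_add, h, h]
  simp only [Sl2Module.eval_mul, onLeft_linear, onRight_linear]
  rw [linear_mul_linear, linear_mul_linear, quadSeries_add, yangianSeries]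
  clear h hT
  have h1 : ∀ i j, Module.End.rTensorAlgHom ℂ M N
      ((1 : Matrix (Fin 2) (Fin 2) (Module.End ℂ M)) i j) =
      (1 : Matrix (Fin 2) (Fin 2) (Module.End ℂ (M ⊗[ℂ] N))) i j := by
    intro i j
    rw [Matrix.one_apply, Matrix.one_apply]
    split_ifs <;> simp
  have h2 : ∀ i j, Module.End.lTensorAlgHom ℂ N M
      ((1 : Matrix (Fin 2) (Fin 2) (Module.End ℂ N)) i j) =
      (1 : Matrix (Fin 2) (Fin 2) (Module.End ℂ (M ⊗[ℂ] N))) i j := by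
    intro i j
    rw [Matrix.one_apply, Matrix.one_apply]
    split_ifs <;> simp
  simp only [h1, h2]
  congr 1
  · rw [← Fin.sum_univ_two fun a => (1 : Matrix (Fin 2) (Fin 2) (Module.End ℂ (M ⊗[ℂ] N))) i a *
      (1 : Matrix (Fin 2) (Fin 2) (Module.End ℂ (M ⊗[ℂ] N))) a j, ← Matrix.mul_apply, one_mul]
  · conv_rhs => rw [← mul_one (laxLeft N A z), ← one_mul (laxRight M B w)]
    rw [Matrix.add_apply, Matrix.mul_apply, Matrix.mul_apply, Fin.sum_univ_two, Fin.sum_univ_two]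
    simp only [laxLeft, laxRight, Matrix.map_apply]
    abel
  · rw [Matrix.mul_apply, Fin.sum_univ_two]
    rfl

/-- The expansion of `∏_a (1 - (z_a + lam_a) u⁻¹)⁻¹`. -/
def poleSeries (z lam : Fin 2 → ℂ) : PowerSeries ℂ :=
  ∏ a, PowerSeries.mk fun n => (z a + lam a) ^ n

theorem constantCoeff_poleSeries (z lam : Fin 2 → ℂ) :
    PowerSeries.constantCoeff (poleSeries z lam) ≠ 0 := by
  have h : ∀ c : ℂ, PowerSeries.constantCoeff (PowerSeries.mk fun n => c ^ n) = 1 := fun c => by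
    rw [← PowerSeries.coeff_zero_eq_constantCoeff_apply, PowerSeries.coeff_mk, pow_zero]
  simp [poleSeries, h]

/-- The numerators of the normalizing series are exactly the denominators of the two evaluation
modules. What remains is a polynomial monodromy matrix times the pole factor, which depends only on
the numbers `z_a + lam_a`. -/
theorem twist_tensor_eval (A : Sl2Module M) (B : Sl2Module N) (z lam : Fin 2 → ℂ) (i j : Fin 2) :
    (((A.eval (z 0)).tensor (B.eval (z 1))).twist (normSeries z lam) (normSeries_zero z
      lam)).T i j =
      scalarSeries (M ⊗[ℂ] N) (poleSeries z lam) * yangianSeries A B (z 0) (z 1) i j := by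
  rw [← tensor_eval_mul, ← mul_assoc, ← map_mul]
  have : poleSeries z lam * ((1 - PowerSeries.C (z 0) * PowerSeries.X) *
      (1 - PowerSeries.C (z 1) * PowerSeries.X)) = normSeries z lam := by
    simp only [poleSeries, normSeries, Fin.prod_univ_two]
    ring
  rw [this]
  rfl

/-- The series in `u⁻¹` and the pencil in `u` have the same three coefficients in opposite order,
differing by the factor `u²`. -/
theorem intertwines_yangianSeries {M' N' : Type*} [AddCommGroup M'] [Module ℂ M'] [AddCommGroup N']
    [Module ℂ N'] (φ : M ⊗[ℂ] N →ₗ[ℂ] M' ⊗[ℂ] N') (A : Sl2Module M) (B : Sl2Module N) (z w : ℂ)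
    (A' : Sl2Module M') (B' : Sl2Module N') (z' w' : ℂ) (i j : Fin 2) :
    IntertwinesSeries φ (yangianSeries A B z w i j) (yangianSeries A' B' z' w' i j) ↔
      ∀ u y, φ (yangianPencil A B z w i j u y) = yangianPencil A' B' z' w' i j u (φ y) := by
  rw [yangianSeries, yangianSeries, intertwinesSeries_quad, yangianPencil, yangianPencil,
    intertwines_quadPencil]
  tauto

end Rational

/-! ### Monodromy matrix entries on products of Verma modules -/

section RationalVerma

variable {M N : Type*} [AddCommGroup M] [Module ℂ M] [AddCommGroup N] [Module ℂ N]

/-- `A` is the Verma module of highest weight `lam`, with the standard basis `b`. -/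
structure Sl2Module.IsVerma (A : Sl2Module M) (b : Module.Basis ℕ ℂ M) (lam : ℂ) : Prop where
  e_act : ∀ l, A.e (b l) = ((l : ℂ) * (2 * lam - l + 1)) • b (l - 1)
  f_act : ∀ l, A.f (b l) = b (l + 1)
  h_act : ∀ l, A.h (b l) = (lam - l) • b l

variable {A : Sl2Module M} {B : Sl2Module N} {b : Module.Basis ℕ ℂ M} {b' : Module.Basis ℕ ℂ N}
  {x y : ℂ}

theorem yangianPencil_apply (A : Sl2Module M) (B : Sl2Module N) (z w : ℂ) (i j : Fin 2) (u : ℂ)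
    (s : M) (t : N) : yangianPencil A B z w i j u (s ⊗ₜ t) =
      (A.lax z i 0 s ⊗ₜ[ℂ] B.lax w 0 j t + A.lax z i 1 s ⊗ₜ[ℂ] B.lax w 1 j t) +
        u • (A.lax z i j s ⊗ₜ[ℂ] t + s ⊗ₜ[ℂ] B.lax w i j t) +
        u ^ 2 • (1 : Matrix (Fin 2) (Fin 2) (Module.End ℂ (M ⊗[ℂ] N))) i j (s ⊗ₜ t) := by
  simp only [yangianPencil, quadPencil, LinearMap.add_apply, LinearMap.smul_apply,
    Matrix.mul_apply, Fin.sum_univ_two, Module.End.mul_apply, Matrix.add_apply, laxLeft, laxRight,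
    Matrix.map_apply]
  rfl

/-- The two terms are `f ⊗ (u - w - h)` and `(u - z + h) ⊗ f`. The diagonal factor of each involves
only the index that is not raised, whence roots depending on a single index. -/
theorem yangianPencil_12 (hA : A.IsVerma b x) (hB : B.IsVerma b' y) (z w u : ℂ) (m n : ℕ) :
    yangianPencil A B z w 0 1 u (b.tensorProduct b' (m, n)) =
      (1 * (u - (w + y - n))) • b.tensorProduct b' (m + 1, n) +
        (1 * (u - (z - x + m))) • b.tensorProduct b' (m, n + 1) := by
  rw [Module.Basis.tensorProduct_apply, yangianPencil_apply]
  simp [Sl2Module.lax, hA.f_act, hA.h_act, hB.f_act, hB.h_act, TensorProduct.sub_tmul,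
    TensorProduct.tmul_sub, ← TensorProduct.smul_tmul', TensorProduct.tmul_smul,
    TensorProduct.tmul_neg]
  module

theorem yangianPencil_11 (hA : A.IsVerma b x) (hB : B.IsVerma b' y) (z w u : ℂ) (m n : ℕ) :
    yangianPencil A B z w 0 0 u (b.tensorProduct b' (m, n)) =
      ((u - (z - x + m)) * (u - (w - y + n))) • b.tensorProduct b' (m, n) +
        (n * (2 * y - n + 1)) • b.tensorProduct b' (m + 1, n - 1) := by
  rw [Module.Basis.tensorProduct_apply, yangianPencil_apply]
  simp [Sl2Module.lax, hA.f_act, hA.h_act, hB.e_act, hB.h_act, TensorProduct.sub_tmul,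
    TensorProduct.tmul_sub, ← TensorProduct.smul_tmul', TensorProduct.tmul_smul]
  module

theorem yangianPencil_22 (hA : A.IsVerma b x) (hB : B.IsVerma b' y) (z w u : ℂ) (m n : ℕ) :
    yangianPencil A B z w 1 1 u (b.tensorProduct b' (m, n)) =
      ((u - (z + x - m)) * (u - (w + y - n))) • b.tensorProduct b' (m, n) +
        (m * (2 * x - m + 1)) • b.tensorProduct b' (m - 1, n + 1) := by
  rw [Module.Basis.tensorProduct_apply, yangianPencil_apply]
  simp [Sl2Module.lax, hA.e_act, hA.h_act, hB.f_act, hB.h_act, TensorProduct.sub_tmul,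
    TensorProduct.tmul_sub, ← TensorProduct.smul_tmul', TensorProduct.tmul_smul,
    TensorProduct.tmul_neg,
    TensorProduct.neg_tmul]
  module

theorem yangianPencil_21 (hA : A.IsVerma b x) (hB : B.IsVerma b' y) (z w u : ℂ) (m n : ℕ) :
    yangianPencil A B z w 1 0 u (b.tensorProduct b' (m, n)) =
      (m * (2 * x - m + 1) * (u - (w - y + n))) • b.tensorProduct b' (m - 1, n) +
        (n * (2 * y - n + 1) * (u - (z + x - m))) • b.tensorProduct b' (m, n - 1) := by
  rw [Module.Basis.tensorProduct_apply, yangianPencil_apply]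
  simp [Sl2Module.lax, hA.e_act, hA.h_act, hB.e_act, hB.h_act, TensorProduct.sub_tmul,
    TensorProduct.tmul_sub, ← TensorProduct.smul_tmul', TensorProduct.tmul_smul,
    TensorProduct.neg_tmul]
  module

theorem yangian_isRaising (hA : A.IsVerma b x) (hB : B.IsVerma b' y) (z w : ℂ)
    (hne : ∀ k : ℕ, w + y - (z - x) ≠ k) :
    IsRaising (b.tensorProduct b') (yangianPencil A B z w 0 1) (fun _ => 1) (fun n => w + y - n)
      (fun _ => 1) fun m => z - x + m where
  act := yangianPencil_12 hA hB z w
  r_ne _ := one_ne_zero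
  s_ne _ := one_ne_zero
  ne m n h := hne (m + n) (by push_cast; linear_combination -h)
  compat m n := by push_cast; ring

/-- These are components of the defining relation of the Yangian, verified here directly on the
basis. The coefficients contain no parameters of the modules, and the eigenvalues are symmetric in
the two tensor factors. -/
theorem yangian_isBethe (hA : A.IsVerma b x) (hB : B.IsVerma b' y) (z w : ℂ) :
    IsBethe (b.tensorProduct b') (fun u v => u - v - 1) (fun _ _ => 1) (fun u v => u - v + 1)
      (fun _ _ => -1) (-1) (fun u => (u - (z - x)) * (u - (w - y)))
      (fun u => (u - (z + x)) * (u - (w + y)))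
      (yangianPencil A B z w 0 0) (yangianPencil A B z w 1 1) (yangianPencil A B z w 1 0)
      (yangianPencil A B z w 0 1) where
  a_F u v := by
    refine (b.tensorProduct b').ext fun ⟨m, n⟩ => ?_
    -- Index `0` is separated because the entry `11` contains the truncated difference `n - 1`.
    rcases n with _ | n <;>
      simp only [LinearMap.smul_apply, LinearMap.add_apply, Module.End.mul_apply, map_add, map_smul,
        yangianPencil_12 hA hB, yangianPencil_11 hA hB, Nat.add_sub_cancel] <;>
      match_scalars <;> push_cast <;> ring
  d_F u v := by
    refine (b.tensorProduct b').ext fun ⟨m, n⟩ => ?_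
    rcases m with _ | m <;>
      simp only [LinearMap.smul_apply, LinearMap.add_apply, Module.End.mul_apply, map_add, map_smul,
        yangianPencil_12 hA hB, yangianPencil_22 hA hB, Nat.add_sub_cancel] <;>
      match_scalars <;> push_cast <;> ring
  e_F u v := by
    refine (b.tensorProduct b').ext fun ⟨m, n⟩ => ?_
    rcases m with _ | m <;> rcases n with _ | n <;>
      simp only [LinearMap.smul_apply, LinearMap.add_apply, LinearMap.sub_apply,
        Module.End.mul_apply, map_add, map_smul, yangianPencil_12 hA hB, yangianPencil_22 hA hB,
        yangianPencil_11 hA hB, yangianPencil_21 hA hB, Nat.add_sub_cancel] <;>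
      match_scalars <;> push_cast <;> ring
  a_vac u := by rw [yangianPencil_11 hA hB]; push_cast; module
  d_vac u := by rw [yangianPencil_22 hA hB]; push_cast; module
  e_vac u := by rw [yangianPencil_21 hA hB]; push_cast; module

end RationalVerma

/-! ### Permuted parameters -/

/-- The numbers `z'_a ± lam'_a` are the numbers `z_a ± lam_a`, permuted. -/
structure IsPermuted (σ τ : Equiv.Perm (Fin 2)) (z lam z' lam' : Fin 2 → ℂ) : Prop where
  add : ∀ a, z' a + lam' a = z (σ a) + lam (σ a)
  sub : ∀ a, z' a - lam' a = z (τ a) - lam (τ a)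

namespace IsPermuted

variable {σ τ : Equiv.Perm (Fin 2)} {z lam z' lam' : Fin 2 → ℂ}

/-- The monoid is arbitrary so that the statement covers both numerical eigenvalues and pole
factors, which are power series. -/
theorem prod_add (h : IsPermuted σ τ z lam z' lam') {R : Type*} [CommMonoid R] (f : ℂ → R) :
    f (z' 0 + lam' 0) * f (z' 1 + lam' 1) = f (z 0 + lam 0) * f (z 1 + lam 1) := by
  have := Equiv.prod_comp σ fun a => f (z a + lam a)
  simpa only [← h.add, Fin.prod_univ_two] using this

theorem prod_sub (h : IsPermuted σ τ z lam z' lam') {R : Type*} [CommMonoid R] (f : ℂ → R) :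
    f (z' 0 - lam' 0) * f (z' 1 - lam' 1) = f (z 0 - lam 0) * f (z 1 - lam 1) := by
  have := Equiv.prod_comp τ fun a => f (z a - lam a)
  simpa only [← h.sub, Fin.prod_univ_two] using this

theorem sum_add (h : IsPermuted σ τ z lam z' lam') :
    (z' 0 + lam' 0) + (z' 1 + lam' 1) = (z 0 + lam 0) + (z 1 + lam 1) := by
  have := Equiv.sum_comp σ fun a => z a + lam a
  simpa only [← h.add, Fin.sum_univ_two] using this

theorem sum_sub (h : IsPermuted σ τ z lam z' lam') :
    (z' 0 - lam' 0) + (z' 1 - lam' 1) = (z 0 - lam 0) + (z 1 - lam 1) := by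
  have := Equiv.sum_comp τ fun a => z a - lam a
  simpa only [← h.sub, Fin.sum_univ_two] using this

theorem sum_z (h : IsPermuted σ τ z lam z' lam') : z' 0 + z' 1 = z 0 + z 1 := by
  linear_combination (h.sum_add + h.sum_sub) / 2

theorem sum_lam (h : IsPermuted σ τ z lam z' lam') : lam' 0 + lam' 1 = lam 0 + lam 1 := by
  linear_combination (h.sum_add - h.sum_sub) / 2

/-- The expression is `(z_a + lam_a) - (z_b - lam_b)`. The non-resonance condition ranges over all
pairs of indices, so it passes to permuted parameters. -/
theorem difference (h : IsPermuted σ τ z lam z' lam') (a b : Fin 2) :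
    z' a - z' b + lam' a + lam' b = z (σ a) - z (τ b) + lam (σ a) + lam (τ b) := by
  linear_combination h.add a - h.sub b

end IsPermuted

theorem MatrixKind.isPermuted (κ : MatrixKind) (z lam : Fin 2 → ℂ) :
    IsPermuted κ.sub κ.sup z lam (κ.targetZ z lam) (κ.targetLam z lam) where
  add a := by
    simp only [targetZ, targetLam, twistZ, twistLam]
    ring
  sub a := by
    simp only [targetZ, targetLam, twistZ, twistLam]
    ring

/-- The kind `D` exchanges the sums `z_a + lam_a`, the kind `N` exchanges the differences, and the
kind `R` exchanges both. -/
theorem MatrixKind.targetZ_N_D (z lam : Fin 2 → ℂ) :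
    N.targetZ (D.targetZ z lam) (D.targetLam z lam) = R.targetZ z lam := by
  funext a
  simp only [targetZ, targetLam, twistZ, twistLam, sup, sub, Equiv.Perm.one_apply]
  ring

theorem MatrixKind.targetLam_N_D (z lam : Fin 2 → ℂ) :
    N.targetLam (D.targetZ z lam) (D.targetLam z lam) = R.targetLam z lam := by
  funext a
  simp only [targetZ, targetLam, twistZ, twistLam, sup, sub, Equiv.Perm.one_apply]
  ring

/-! ### Rational matrices between tensor products of Verma modules -/

section RationalHom

variable {M N : Type*} [AddCommGroup M] [Module ℂ M] [AddCommGroup N] [Module ℂ N]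
  {A A' : Sl2Module M} {B B' : Sl2Module N} {b : Module.Basis ℕ ℂ M} {b' : Module.Basis ℕ ℂ N}
  {z lam z' lam' : Fin 2 → ℂ} {σ τ : Equiv.Perm (Fin 2)}

/-- The tensor product of two evaluation modules, with the normalized action. -/
def Sl2Module.evalTensor (A : Sl2Module M) (B : Sl2Module N) (z lam : Fin 2 → ℂ) :
    YangianModule (M ⊗[ℂ] N) :=
  ((A.eval (z 0)).tensor (B.eval (z 1))).twist (normSeries z lam) (normSeries_zero z lam)

/-- The pole factors of source and target coincide, because the numbers `z_a + lam_a` are merely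
permuted, and they cancel. Only the polynomial monodromy matrices remain. -/
theorem isYangianHom_iff (hp : IsPermuted σ τ z lam z' lam') (φ : M ⊗[ℂ] N →ₗ[ℂ] M ⊗[ℂ] N) :
    IsYangianHom (A.evalTensor B z lam) (A'.evalTensor B' z' lam') φ ↔ ∀ i j u y,
      φ (yangianPencil A B (z 0) (z 1) i j u y) =
        yangianPencil A' B' (z' 0) (z' 1) i j u (φ y) := by
  have hs : poleSeries z' lam' = poleSeries z lam := by
    simp only [poleSeries, Fin.prod_univ_two]
    exact hp.prod_add fun c => PowerSeries.mk fun n => c ^ n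
  have h : ∀ i j, (∀ n, φ ∘ₗ PowerSeries.coeff n ((A.evalTensor B z lam).T i j) =
      PowerSeries.coeff n ((A'.evalTensor B' z' lam').T i j) ∘ₗ φ) ↔
      ∀ u y, φ (yangianPencil A B (z 0) (z 1) i j u y) =
        yangianPencil A' B' (z' 0) (z' 1) i j u (φ y) := by
    intro i j
    rw [← intertwines_yangianSeries,
      ← intertwinesSeries_scalar_mul (constantCoeff_poleSeries z lam), ← twist_tensor_eval]
    rw [← hs, ← twist_tensor_eval]
    exact forall_congr' fun n => LinearMap.ext_iff
  exact forall_congr' fun i => forall_congr' fun j => h i j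

/-- The coefficients of `u` in the entries `21`, `12`, `11` are `e`, `f` and `h - (z₁ + z₂)`, and
`z₁ + z₂` is the same for source and target. -/
theorem isSl2Hom_of_pencil (hp : IsPermuted σ τ z lam z' lam') {φ : M ⊗[ℂ] N →ₗ[ℂ] M ⊗[ℂ] N}
    (h : ∀ i j u y, φ (yangianPencil A B (z 0) (z 1) i j u y) =
      yangianPencil A' B' (z' 0) (z' 1) i j u (φ y)) :
    IsSl2Hom (A.tensor B) (A'.tensor B') φ := by
  have h1 : ∀ i j y, φ ((laxLeft N A (z 0) + laxRight M B (z 1)) i j y) =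
      (laxLeft N A' (z' 0) + laxRight M B' (z' 1)) i j (φ y) :=
    fun i j => ((intertwines_quadPencil φ _ _ _ _ _ _).1 (h i j)).2.1
  have h0 : ∀ (A : Sl2Module M) (B : Sl2Module N) (z w : ℂ),
      (A.tensor B).h = (laxLeft N A z + laxRight M B w) 0 0 + (z + w) • LinearMap.id := by
    intro A B z w
    refine TensorProduct.ext' fun s t => ?_
    change A.h s ⊗ₜ t + s ⊗ₜ B.h t = ((A.h s - z • s) ⊗ₜ[ℂ] t + s ⊗ₜ[ℂ] (B.h t - w • t)) +
      (z + w) • (s ⊗ₜ t)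
    simp only [TensorProduct.sub_tmul, TensorProduct.tmul_sub, ← TensorProduct.smul_tmul',
      TensorProduct.tmul_smul]
    module
  refine ⟨LinearMap.ext fun y => h1 1 0 y, LinearMap.ext fun y => h1 0 1 y,
    LinearMap.ext fun y => ?_⟩
  rw [h0 A B (z 0) (z 1), h0 A' B' (z' 0) (z' 1), hp.sum_z]
  simp only [LinearMap.comp_apply, LinearMap.add_apply, LinearMap.smul_apply, LinearMap.id_apply,
    map_add, map_smul, h1]

theorem shapovalov_eq_prod (l : ℕ) (x : ℂ) :
    shapovalov l x = ∏ i ∈ Finset.range l, ((i + 1 : ℕ) : ℂ) * (2 * x - (i + 1 : ℕ) + 1) := by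
  rw [shapovalov, Finset.prod_mul_distrib, ← Nat.cast_prod, Finset.prod_range_add_one_eq_factorial]
  congr 1
  exact Finset.prod_congr rfl fun i _ => by push_cast; ring

theorem verma_isLowering (hA : A.IsVerma b (lam 0)) (hB : B.IsVerma b' (lam 1))
    (hx : ∀ a (k : ℕ), 2 * lam a ≠ k) :
    IsLowering (b.tensorProduct b') (A.tensor B).e (fun m => m * (2 * lam 0 - m + 1))
      (fun n => n * (2 * lam 1 - n + 1)) (fun _ => 1) fun _ => 1 where
  act m n := by
    simp [Sl2Module.tensor, hA.e_act, hB.e_act, ← TensorProduct.smul_tmul',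
      TensorProduct.tmul_smul]
  left_zero := by simp
  right_zero := by simp
  left_ne m := mul_ne_zero (Nat.cast_ne_zero.2 m.succ_ne_zero) fun h =>
    hx 0 m (by push_cast at h; linear_combination h)
  right_ne n := mul_ne_zero (Nat.cast_ne_zero.2 n.succ_ne_zero) fun h =>
    hx 1 n (by push_cast at h; linear_combination h)
  k_ne _ := one_ne_zero

/-- The pencil of raising operators of a non-resonant tensor product of Verma modules. -/
theorem evalTensor_isRaising (hA : A.IsVerma b (lam 0)) (hB : B.IsVerma b' (lam 1))
    (hz : ∀ a b (k : ℕ), z a - z b + lam a + lam b ≠ k) :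
    IsRaising (b.tensorProduct b') (yangianPencil A B (z 0) (z 1) 0 1) (fun _ => 1)
      (fun n => z 1 + lam 1 - n) (fun _ => 1) fun m => z 0 - lam 0 + m :=
  yangian_isRaising hA hB _ _ fun k h => hz 1 0 k (by linear_combination h)

variable (hA : A.IsVerma b (lam 0)) (hB : B.IsVerma b' (lam 1)) (hA' : A'.IsVerma b (lam' 0))
  (hB' : B'.IsVerma b' (lam' 1)) (hz : ∀ a b (k : ℕ), z a - z b + lam a + lam b ≠ k)
  (hz' : ∀ a b (k : ℕ), z' a - z' b + lam' a + lam' b ≠ k)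

/-- The isomorphism between two tensor products of Verma modules. -/
def rationalEquiv : (M ⊗[ℂ] N) ≃ₗ[ℂ] (M ⊗[ℂ] N) :=
  (evalTensor_isRaising hA hB hz).equiv (evalTensor_isRaising hA' hB' hz')

theorem rationalEquiv_pencil (hp : IsPermuted σ τ z lam z' lam') (i j : Fin 2) (u : ℂ)
    (y : M ⊗[ℂ] N) : rationalEquiv hA hB hA' hB' hz hz' (yangianPencil A B (z 0) (z 1) i j u y) =
      yangianPencil A' B' (z' 0) (z' 1) i j u (rationalEquiv hA hB hA' hB' hz hz' y) := by
  have h := yangian_isBethe hA hB (z 0) (z 1)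
  have h' := yangian_isBethe hA' hB' (z' 0) (z' 1)
  -- The eigenvalues on the target's highest vector are rewritten as those of the source; this is
  -- the only place in the construction where the permutation of parameters matters.
  rw [funext fun u => hp.prod_add fun x => u - x, funext fun u => hp.prod_sub fun x => u - x] at h'
  have hF := evalTensor_isRaising hA hB hz
  have hF' := evalTensor_isRaising hA' hB' hz'
  fin_cases i <;> fin_cases j
  · exact hF.equiv_diagonal hF' h.a_F h'.a_F h.a_vac h'.a_vac u y
  · exact hF.equiv_raise hF' u y
  · exact hF.equiv_lower hF' h h' u y
  · exact hF.equiv_diagonal hF' h.d_F h'.d_F h.d_vac h'.d_vac u y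

theorem rationalEquiv_vac : rationalEquiv hA hB hA' hB' hz hz' (b 0 ⊗ₜ b' 0) = b 0 ⊗ₜ b' 0 := by
  have := (evalTensor_isRaising hA hB hz).equiv_vac (evalTensor_isRaising hA' hB' hz')
  rwa [Module.Basis.tensorProduct_apply] at this

theorem rationalEquiv_isYangianHom (hp : IsPermuted σ τ z lam z' lam') :
    IsYangianHom (A.evalTensor B z lam) (A'.evalTensor B' z' lam')
      (rationalEquiv hA hB hA' hB' hz hz' : M ⊗[ℂ] N →ₗ[ℂ] M ⊗[ℂ] N) :=
  (isYangianHom_iff hp _).2 (rationalEquiv_pencil hA hB hA' hB' hz hz' hp)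

/-- Commuting with the raising entry and fixing the highest vector already determine the map. -/
theorem eq_rationalEquiv (hp : IsPermuted σ τ z lam z' lam') {φ : (M ⊗[ℂ] N) ≃ₗ[ℂ] (M ⊗[ℂ] N)}
    (h : IsYangianHom (A.evalTensor B z lam) (A'.evalTensor B' z' lam')
      (φ : M ⊗[ℂ] N →ₗ[ℂ] M ⊗[ℂ] N)) (h0 : φ (b 0 ⊗ₜ b' 0) = b 0 ⊗ₜ b' 0) :
    φ = rationalEquiv hA hB hA' hB' hz hz' := by
  rw [isYangianHom_iff hp] at h
  refine LinearEquiv.toLinearMap_injective ((evalTensor_isRaising hA hB hz).hom_ext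
    (yangianPencil A' B' (z' 0) (z' 1) 0 1) ?_ (h 0 1)
    (rationalEquiv_pencil hA hB hA' hB' hz hz' hp 0 1))
  rw [Module.Basis.tensorProduct_apply]
  exact h0.trans (rationalEquiv_vac hA hB hA' hB' hz hz').symm

theorem rationalEquiv_lower (hp : IsPermuted σ τ z lam z' lam') (y : M ⊗[ℂ] N) :
    rationalEquiv hA hB hA' hB' hz hz' ((A.tensor B).e y) =
      (A'.tensor B').e (rationalEquiv hA hB hA' hB' hz hz' y) :=
  LinearMap.congr_fun (isSl2Hom_of_pencil hp (rationalEquiv_pencil hA hB hA' hB' hz hz' hp)).1 y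

theorem two_mul_ne (hz : ∀ a b (k : ℕ), z a - z b + lam a + lam b ≠ k) (a : Fin 2) (k : ℕ) :
    2 * lam a ≠ k := fun h => hz a a k (by linear_combination h)

/-- The hypothesis `h1` says that the root `ρ 0` is unchanged, so the coefficients at `b (l, 0)` can
be compared; all leading coefficients are `1`, whence `t = 1`. -/
theorem rationalEquiv_singular_left (hp : IsPermuted σ τ z lam z' lam')
    (h1 : z' 1 + lam' 1 = z 1 + lam 1) {l : ℕ} {w w' : M ⊗[ℂ] N}
    (hw : IsSingular (b.tensorProduct b') (A.tensor B).e (shapovalov l (lam 0))⁻¹ l w)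
    (hw' : IsSingular (b.tensorProduct b') (A'.tensor B').e (shapovalov l (lam' 0))⁻¹ l w') :
    rationalEquiv hA hB hA' hB' hz hz' w =
      (shapovalov l (lam' 0) / shapovalov l (lam 0)) • w' := by
  simp only [shapovalov_eq_prod] at hw hw' ⊢
  have := (evalTensor_isRaising hA hB hz).equiv_isSingular_left (evalTensor_isRaising hA' hB' hz')
    (verma_isLowering hA hB (two_mul_ne hz)) (verma_isLowering hA' hB' (two_mul_ne hz'))
    (rationalEquiv_lower hA hB hA' hB' hz hz' hp) 1 (by simp) (by simp [h1]) hw hw'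
  rwa [one_pow, one_mul] at this

/-- The hypothesis `h1` says that the root `σ 0` is unchanged. The comultiplication of `sl(2)` has
no twisting factors, so `θ = 1`, and again `t = 1`. -/
theorem rationalEquiv_singular_right (hp : IsPermuted σ τ z lam z' lam')
    (h1 : z' 0 - lam' 0 = z 0 - lam 0) {l : ℕ} {w w' : M ⊗[ℂ] N}
    (hw : IsSingular (b.tensorProduct b') (A.tensor B).e (shapovalov l (lam 0))⁻¹ l w)
    (hw' : IsSingular (b.tensorProduct b') (A'.tensor B').e (shapovalov l (lam' 0))⁻¹ l w') :
    rationalEquiv hA hB hA' hB' hz hz' w =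
      (shapovalov l (lam' 1) / shapovalov l (lam 1)) • w' := by
  simp only [shapovalov_eq_prod] at hw hw' ⊢
  have := (evalTensor_isRaising hA hB hz).equiv_isSingular_right (evalTensor_isRaising hA' hB' hz')
    (verma_isLowering hA hB (two_mul_ne hz)) (verma_isLowering hA' hB' (two_mul_ne hz'))
    (rationalEquiv_lower hA hB hA' hB' hz hz' hp) 1 (by simp) (by simp [h1])
    (one_ne_zero (α := ℂ)) (by simp) (by simp) hw hw'
  rwa [one_pow, one_mul] at this

end RationalHom

/-! ### The rational theorem -/

/-- The standard basis of a Verma module. -/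
def vermaBasis : Module.Basis ℕ ℂ VermaSpace := Finsupp.basisSingleOne

theorem vermaBasis_apply (l : ℕ) : vermaBasis l = fv l := by
  simp [vermaBasis, fv]

theorem verma_isVerma (lam : ℂ) : (verma lam).IsVerma vermaBasis lam where
  e_act l := by rw [vermaBasis_apply, vermaBasis_apply]; exact byBasis_fv _ l
  f_act l := by rw [vermaBasis_apply, vermaBasis_apply]; exact byBasis_fv _ l
  h_act l := by rw [vermaBasis_apply]; exact byBasis_fv _ l

theorem isSingularVector_iff (lam : Fin 2 → ℂ) (l : ℕ) (w : VermaSpace₂) :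
    IsSingularVector lam l w ↔ IsSingular (vermaBasis.tensorProduct vermaBasis)
      ((verma (lam 0)).tensor (verma (lam 1))).e (shapovalov l (lam 0))⁻¹ l w := by
  simp only [IsSingular, Module.Basis.tensorProduct_apply, vermaBasis_apply]
  rfl

/-- No resonances between the parameters of two Verma modules. -/
def IsGeneric (z lam : Fin 2 → ℂ) : Prop :=
  ∀ a b (k : ℕ), z a - z b + lam a + lam b ≠ k

theorem IsGeneric.target {z lam : Fin 2 → ℂ} (hz : IsGeneric z lam) (κ : MatrixKind) :
    IsGeneric (κ.targetZ z lam) (κ.targetLam z lam) := fun a b k => by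
  rw [(κ.isPermuted z lam).difference]
  exact hz _ _ k

/-- The rational matrix of the given kind. -/
def rationalMatrix (κ : MatrixKind) {z lam : Fin 2 → ℂ} (hz : IsGeneric z lam) :
    VermaSpace₂ ≃ₗ[ℂ] VermaSpace₂ :=
  rationalEquiv (verma_isVerma (lam 0)) (verma_isVerma (lam 1)) (verma_isVerma _) (verma_isVerma _)
    hz (hz.target κ)

theorem isRationalMatrix_iff (κ : MatrixKind) {z lam : Fin 2 → ℂ} (hz : IsGeneric z lam)
    (A : VermaSpace₂ ≃ₗ[ℂ] VermaSpace₂) :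
    IsRationalMatrix κ z lam A ↔ A = rationalMatrix κ hz := by
  have hA := fun a => verma_isVerma (lam a)
  have hA' := fun a => verma_isVerma (κ.targetLam z lam a)
  constructor
  · rintro ⟨h, h0⟩
    refine eq_rationalEquiv (hA 0) (hA 1) (hA' 0) (hA' 1) hz (hz.target κ) (κ.isPermuted z lam) h ?_
    simp only [vermaBasis_apply]
    exact h0
  · rintro rfl
    refine ⟨rationalEquiv_isYangianHom (hA 0) (hA 1) (hA' 0) (hA' 1) hz (hz.target κ)
      (κ.isPermuted z lam), ?_⟩
    have := rationalEquiv_vac (hA 0) (hA 1) (hA' 0) (hA' 1) hz (hz.target κ)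
    simp only [vermaBasis_apply] at this
    exact this

theorem existsUnique_isSingularVector {z lam : Fin 2 → ℂ} (hz : IsGeneric z lam) (l : ℕ) :
    ∃! w, IsSingularVector lam l w := by
  simp only [isSingularVector_iff]
  exact (verma_isLowering (verma_isVerma (lam 0)) (verma_isVerma (lam 1))
    (two_mul_ne hz)).existsUnique_isSingular _ l

theorem rationalMatrix_D {z lam : Fin 2 → ℂ} (hz : IsGeneric z lam) {l : ℕ} {w w' : VermaSpace₂}
    (hw : IsSingularVector lam l w)
    (hw' : IsSingularVector (MatrixKind.D.targetLam z lam) l w') :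
    rationalMatrix .D hz w = (shapovalov l (MatrixKind.D.targetLam z lam 1) /
      shapovalov l (lam 1)) • w' :=
  rationalEquiv_singular_right (verma_isVerma (lam 0)) (verma_isVerma (lam 1)) (verma_isVerma _)
    (verma_isVerma _) hz (hz.target .D) (MatrixKind.D.isPermuted z lam)
    ((MatrixKind.D.isPermuted z lam).sub 0)
    ((isSingularVector_iff _ _ _).1 hw) ((isSingularVector_iff _ _ _).1 hw')

theorem rationalMatrix_N {z lam : Fin 2 → ℂ} (hz : IsGeneric z lam) {l : ℕ} {w w' : VermaSpace₂}
    (hw : IsSingularVector lam l w)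
    (hw' : IsSingularVector (MatrixKind.N.targetLam z lam) l w') :
    rationalMatrix .N hz w = (shapovalov l (MatrixKind.N.targetLam z lam 0) /
      shapovalov l (lam 0)) • w' :=
  rationalEquiv_singular_left (verma_isVerma (lam 0)) (verma_isVerma (lam 1)) (verma_isVerma _)
    (verma_isVerma _) hz (hz.target .N) (MatrixKind.N.isPermuted z lam)
    ((MatrixKind.N.isPermuted z lam).add 1)
    ((isSingularVector_iff _ _ _).1 hw) ((isSingularVector_iff _ _ _).1 hw')

theorem isYangianHom_comp {z lam z' lam' z'' lam'' : Fin 2 → ℂ}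
    {φ ψ : VermaSpace₂ ≃ₗ[ℂ] VermaSpace₂}
    (h : IsYangianHom (evalVerma₂ z lam) (evalVerma₂ z' lam') (φ : VermaSpace₂ →ₗ[ℂ] VermaSpace₂))
    (h' : IsYangianHom (evalVerma₂ z' lam') (evalVerma₂ z'' lam'')
      (ψ : VermaSpace₂ →ₗ[ℂ] VermaSpace₂)) :
    IsYangianHom (evalVerma₂ z lam) (evalVerma₂ z'' lam'')
      (φ.trans ψ : VermaSpace₂ →ₗ[ℂ] VermaSpace₂) := fun i j n => LinearMap.ext fun y => by
  have e := LinearMap.congr_fun (h i j n) y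
  have e' := LinearMap.congr_fun (h' i j n) (φ y)
  exact (congrArg ψ e).trans e'

/-- The composite is a Yangian isomorphism that fixes the highest vector and has the parameters of
the kind `R` as target, so uniqueness applies. -/
theorem rationalMatrix_R {z lam : Fin 2 → ℂ} (hz : IsGeneric z lam) (y : VermaSpace₂) :
    rationalMatrix .R hz y = rationalMatrix .N (hz.target .D) (rationalMatrix .D hz y) := by
  have h := (isRationalMatrix_iff .D hz _).2 rfl
  have h' := (isRationalMatrix_iff .N (hz.target .D) _).2 rfl
  have h'' : IsRationalMatrix .R z lam
      ((rationalMatrix .D hz).trans (rationalMatrix .N (hz.target .D))) := by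
    refine ⟨?_, (congrArg _ h.2).trans h'.2⟩
    rw [← MatrixKind.targetZ_N_D, ← MatrixKind.targetLam_N_D]
    exact isYangianHom_comp h.1 h'.1
  exact LinearEquiv.congr_fun ((isRationalMatrix_iff .R hz _).1 h'').symm y

theorem shapovalov_ne_zero {z lam : Fin 2 → ℂ} (hz : IsGeneric z lam) (l : ℕ) (a : Fin 2) :
    shapovalov l (lam a) ≠ 0 :=
  mul_ne_zero (Nat.cast_ne_zero.2 l.factorial_ne_zero)
    (Finset.prod_ne_zero_iff.2 fun k _ => sub_ne_zero.2 (two_mul_ne hz a k))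

theorem lamN_eq (z lam : Fin 2 → ℂ) : lamN z lam = (z 0 - z 1 + lam 0 + lam 1) / 2 := by
  simp [lamN, twistLam]
  ring

/-- For `D` and `N` the functional argument gives a quotient of Shapovalov values at the second,
respectively the first, highest weight; the target weight is `lamN` of the source, the source weight
is `lamN` of the target. For `R` the two quotients are multiplied. -/
theorem rationalMatrix_singular (κ : MatrixKind) {z lam : Fin 2 → ℂ} (hz : IsGeneric z lam) {l : ℕ}
    {w w' : VermaSpace₂} (hw : IsSingularVector lam l w)
    (hw' : IsSingularVector (κ.targetLam z lam) l w') :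
    rationalMatrix κ hz w = (shapovalov l (lamN z lam) /
      shapovalov l (lamN (κ.targetZ z lam) (κ.targetLam z lam))) • w' := by
  have hD1 : MatrixKind.D.targetLam z lam 1 = lamN z lam := by
    rw [lamN_eq]
    simp [MatrixKind.targetLam, twistLam, MatrixKind.sup, MatrixKind.sub]
    ring
  cases κ with
  | D =>
    have h1 : lamN (MatrixKind.D.targetZ z lam) (MatrixKind.D.targetLam z lam) = lam 1 := by
      rw [lamN_eq]
      simp [MatrixKind.targetZ, MatrixKind.targetLam, twistZ, twistLam, MatrixKind.sup,
        MatrixKind.sub]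
      ring
    rw [rationalMatrix_D hz hw hw', hD1, h1]
  | N =>
    have h1 : lamN (MatrixKind.N.targetZ z lam) (MatrixKind.N.targetLam z lam) = lam 0 := by
      rw [lamN_eq]
      simp [MatrixKind.targetZ, MatrixKind.targetLam, twistZ, twistLam, MatrixKind.sup,
        MatrixKind.sub]
      ring
    have h2 : MatrixKind.N.targetLam z lam 0 = lamN z lam := by
      rw [lamN_eq]
      simp [MatrixKind.targetLam, twistLam, MatrixKind.sup, MatrixKind.sub]
      ring
    rw [rationalMatrix_N hz hw hw', h1, h2]
  | R =>
    obtain ⟨v, hv, -⟩ := existsUnique_isSingularVector (hz.target .D) l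
    rw [← MatrixKind.targetLam_N_D] at hw'
    have h1 : lamN (MatrixKind.R.targetZ z lam) (MatrixKind.R.targetLam z lam) =
        MatrixKind.D.targetLam z lam 0 := by
      rw [lamN_eq]
      simp [MatrixKind.targetZ, MatrixKind.targetLam, twistZ, twistLam, MatrixKind.sup,
        MatrixKind.sub]
      ring
    have h2 : MatrixKind.N.targetLam (MatrixKind.D.targetZ z lam) (MatrixKind.D.targetLam z lam) 0 =
        lam 1 := by
      rw [MatrixKind.targetLam_N_D]
      simp [MatrixKind.targetLam, twistLam, MatrixKind.sup, MatrixKind.sub]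
    -- The value at `lam 1` is the denominator for `D` and the numerator for the subsequent `N`, and
    -- is cancelled below.
    have h3 := shapovalov_ne_zero hz l 1
    rw [rationalMatrix_R, rationalMatrix_D hz hw hv, map_smul,
      rationalMatrix_N (hz.target .D) hv hw', h1, h2, hD1, smul_smul]
    congr 1
    field_simp

theorem rational_theorem (z lam : Fin 2 → ℂ) (κ : MatrixKind)
    (hz : ∀ (a b : Fin 2) (k : ℕ), z a - z b + lam a + lam b ≠ (k : ℂ)) :
    (∃! A, IsRationalMatrix κ z lam A) ∧
      (∀ l, ∃! w, IsSingularVector lam l w) ∧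
      (∀ l, ∃! w, IsSingularVector (κ.targetLam z lam) l w) ∧
      ∀ A, IsRationalMatrix κ z lam A →
        IsSl2Hom (verma₂ lam) (verma₂ (κ.targetLam z lam)) (A : VermaSpace₂ →ₗ[ℂ] VermaSpace₂) ∧
        ∀ (l : ℕ) (w w' : VermaSpace₂), IsSingularVector lam l w →
          IsSingularVector (κ.targetLam z lam) l w' →
          A w = (shapovalov l (lamN z lam) /
            shapovalov l (lamN (κ.targetZ z lam) (κ.targetLam z lam))) • w' := by
  change IsGeneric z lam at hz
  simp only [isRationalMatrix_iff κ hz]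
  refine ⟨existsUnique_eq, existsUnique_isSingularVector hz,
    existsUnique_isSingularVector (hz.target κ), ?_⟩
  rintro _ rfl
  exact ⟨isSl2Hom_of_pencil (κ.isPermuted z lam) (rationalEquiv_pencil (verma_isVerma (lam 0))
    (verma_isVerma (lam 1)) (verma_isVerma _) (verma_isVerma _) hz (hz.target κ)
    (κ.isPermuted z lam)), fun l w w' => rationalMatrix_singular κ hz⟩

/-! ### Powers of `q` -/

section QPow

variable {p : ℂ}

theorem qpow_ne_zero (p x : ℂ) : qpow p x ≠ 0 := Complex.exp_ne_zero _

theorem qpow_neg (p x : ℂ) : qpow p (-x) = (qpow p x)⁻¹ :=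
  eq_inv_of_mul_eq_one_right (qpow_mul_neg p x)

theorem qpow_sub (p x y : ℂ) : qpow p (x - y) = qpow p x * (qpow p y)⁻¹ := by
  rw [sub_eq_add_neg, qpow_add, qpow_neg]

theorem qpow_two_mul (p x : ℂ) : qpow p (2 * x) = qpow p x ^ 2 := by
  rw [two_mul, qpow_add, pow_two]

theorem qpow_nat_mul (p x : ℂ) (l : ℕ) : qpow p (l * x) = qpow p x ^ l := by
  induction l with
  | zero => simp [qpow_zero]
  | succ l ih => rw [pow_succ, ← ih, ← qpow_add]; push_cast; ring_nf

/-- The period `2πi` of the exponential becomes the period `2p` of `x ↦ q^x`; for `q^{2x}` this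
explains the multiples of `p` in the non-resonance condition. -/
theorem qpow_eq_iff (hp : p ≠ 0) (x y : ℂ) :
    qpow p x = qpow p y ↔ ∃ n : ℤ, x = y + 2 * (n * p) := by
  have hpi : (Real.pi : ℂ) * Complex.I ≠ 0 :=
    mul_ne_zero (Complex.ofReal_ne_zero.2 Real.pi_ne_zero) Complex.I_ne_zero
  rw [qpow, qpow, Complex.exp_eq_exp_iff_exists_int]
  refine exists_congr fun n => ⟨fun h => ?_, fun h => ?_⟩
  · field_simp at h
    refine mul_left_cancel₀ hpi ?_
    linear_combination Complex.I * Real.pi * h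
  · rw [h]
    field_simp

theorem qpow_sub_ne_zero (hp : p ≠ 0) {x : ℂ} (h : ∀ n : ℤ, x ≠ n * p) :
    qpow p x - qpow p (-x) ≠ 0 := by
  rw [sub_ne_zero, Ne, qpow_eq_iff hp]
  rintro ⟨n, hn⟩
  exact h n (by linear_combination hn / 2)

/-- A relation `k + 1 = n p` would force `n ≠ 0` and make `p` rational. This keeps the
`q`-factorials nonzero. -/
theorem natCast_succ_ne (hp : ∀ r : ℚ, p ≠ r) (k : ℕ) (n : ℤ) : ((k + 1 : ℕ) : ℂ) ≠ n * p := by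
  intro h
  have hn : (n : ℂ) ≠ 0 := by
    rintro hn
    rw [hn, zero_mul] at h
    exact Nat.cast_ne_zero.2 k.succ_ne_zero h
  refine hp ((k + 1 : ℕ) / n) ?_
  push_cast at h ⊢
  rw [h]
  field_simp

theorem ne_zero_of_irrational (hp : ∀ r : ℚ, p ≠ r) : p ≠ 0 := by
  simpa using hp 0

theorem delta_ne_zero (hp : ∀ r : ℚ, p ≠ r) : qpow p 1 - qpow p (-1) ≠ 0 :=
  qpow_sub_ne_zero (ne_zero_of_irrational hp) fun n => by simpa using natCast_succ_ne hp 0 n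

theorem qnum_ne_zero (hp : ∀ r : ℚ, p ≠ r) {x : ℂ} (h : ∀ n : ℤ, x ≠ n * p) : qnum p x ≠ 0 :=
  div_ne_zero (qpow_sub_ne_zero (ne_zero_of_irrational hp) h) (delta_ne_zero hp)

theorem qnum_zero (p : ℂ) : qnum p 0 = 0 := by simp [qnum]

end QPow

/-! ### The quantum affine action on a tensor product of two evaluation modules -/

section Affine

variable {p : ℂ} {M N : Type*} [AddCommGroup M] [Module ℂ M] [AddCommGroup N] [Module ℂ N]

/-- The coefficient of `ξ⁰` in the matrix `L⁺` of an evaluation module. -/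
def UqModule.lax₀ (A : UqModule p M) : Matrix (Fin 2) (Fin 2) (Module.End ℂ M) :=
  !![A.Kinv, 0; -((qpow p 1 - qpow p (-1)) • A.e), A.K]

/-- The coefficient of `ξ¹` in the matrix `L⁺` of an evaluation module. -/
def UqModule.lax₁ (A : UqModule p M) (z : ℂ) : Matrix (Fin 2) (Fin 2) (Module.End ℂ M) :=
  -qpow p (-(2 * z)) • !![A.K, (qpow p 1 - qpow p (-1)) • A.f; 0, A.Kinv]

theorem UqModule.eval_Lp (A : UqModule p M) (z : ℂ) (i j : Fin 2) :
    (A.eval z).Lp i j =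
      PowerSeries.C (A.lax₀ i j) + PowerSeries.X * PowerSeries.C (A.lax₁ z i j) := by
  fin_cases i <;> fin_cases j <;>
    simp [UqModule.eval, evalMatLp, lax₀, lax₁, smul_smul, mul_comm, sub_eq_add_neg]

/-- In an evaluation module `L⁻(ξ) = -q^{2z} ξ⁻¹ L⁺(ξ)`, so `L⁻` carries no further information. -/
theorem UqModule.eval_Lm (A : UqModule p M) (z : ℂ) (i j : Fin 2) :
    (A.eval z).Lm i j = PowerSeries.C (-qpow p (2 * z) • A.lax₁ z i j) +
      PowerSeries.X * PowerSeries.C (-qpow p (2 * z) • A.lax₀ i j) := by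
  fin_cases i <;> fin_cases j <;>
    simp [UqModule.eval, evalMatLm, lax₀, lax₁, smul_smul, mul_comm, sub_eq_add_neg,
      qpow_neg, qpow_ne_zero]
  rw [← map_neg, ← neg_smul, neg_add, neg_neg, add_comm]

/-- The coefficient of `ξ⁰` in the monodromy matrix. -/
def affineCoeff₀ (A : UqModule p M) (B : UqModule p N) (i j : Fin 2) :
    Module.End ℂ (M ⊗[ℂ] N) :=
  ∑ a, Module.End.rTensorAlgHom ℂ M N (A.lax₀ a j) * Module.End.lTensorAlgHom ℂ N M (B.lax₀ i a)

/-- The coefficient of `ξ¹` in the monodromy matrix. -/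
def affineCoeff₁ (A : UqModule p M) (B : UqModule p N) (z w : ℂ) (i j : Fin 2) :
    Module.End ℂ (M ⊗[ℂ] N) :=
  ∑ a, (Module.End.rTensorAlgHom ℂ M N (A.lax₀ a j) *
    Module.End.lTensorAlgHom ℂ N M (B.lax₁ w i a) + Module.End.rTensorAlgHom ℂ M N (A.lax₁ z a j) *
    Module.End.lTensorAlgHom ℂ N M (B.lax₀ i a))

/-- The coefficient of `ξ²` in the monodromy matrix. -/
def affineCoeff₂ (A : UqModule p M) (B : UqModule p N) (z w : ℂ) (i j : Fin 2) :
    Module.End ℂ (M ⊗[ℂ] N) :=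
  ∑ a, Module.End.rTensorAlgHom ℂ M N (A.lax₁ z a j) *
    Module.End.lTensorAlgHom ℂ N M (B.lax₁ w i a)

theorem tensor_eval_Lp (A : UqModule p M) (B : UqModule p N) (z w : ℂ) (i j : Fin 2) :
    ((A.eval z).tensor (B.eval w)).Lp i j =
      quadSeries (affineCoeff₀ A B i j) (affineCoeff₁ A B z w i j) (affineCoeff₂ A B z w i j) := by
  have h : ((A.eval z).tensor (B.eval w)).Lp i j =
      onLeft M N ((A.eval z).Lp 0 j) * onRight M N ((B.eval w).Lp i 0) +
        onLeft M N ((A.eval z).Lp 1 j) * onRight M N ((B.eval w).Lp i 1) := Fin.sum_univ_two _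
  rw [h]
  simp only [UqModule.eval_Lp, onLeft_linear, onRight_linear]
  rw [linear_mul_linear, linear_mul_linear, quadSeries_add, affineCoeff₀, affineCoeff₁,
    affineCoeff₂, Fin.sum_univ_two, Fin.sum_univ_two, Fin.sum_univ_two]

theorem tensor_eval_Lm (A : UqModule p M) (B : UqModule p N) (z w : ℂ) (i j : Fin 2) :
    ((A.eval z).tensor (B.eval w)).Lm i j =
      quadSeries (qpow p (2 * (z + w)) • affineCoeff₂ A B z w i j)
        (qpow p (2 * (z + w)) • affineCoeff₁ A B z w i j)
        (qpow p (2 * (z + w)) • affineCoeff₀ A B i j) := by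
  have h : ((A.eval z).tensor (B.eval w)).Lm i j =
      onLeft M N ((A.eval z).Lm 0 j) * onRight M N ((B.eval w).Lm i 0) +
        onLeft M N ((A.eval z).Lm 1 j) * onRight M N ((B.eval w).Lm i 1) := Fin.sum_univ_two _
  rw [h]
  simp only [UqModule.eval_Lm, onLeft_linear, onRight_linear]
  rw [linear_mul_linear, linear_mul_linear, quadSeries_add, affineCoeff₀, affineCoeff₁,
    affineCoeff₂, Fin.sum_univ_two, Fin.sum_univ_two, Fin.sum_univ_two]
  simp only [map_smul, smul_mul_assoc, mul_smul_comm, smul_smul, mul_add, qpow_add]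
  congr 1 <;> module

/-- The entries of the monodromy matrix `L⁺(ξ)`. -/
def affinePencil (A : UqModule p M) (B : UqModule p N) (z w : ℂ) (i j : Fin 2) :
    ℂ → Module.End ℂ (M ⊗[ℂ] N) :=
  quadPencil (affineCoeff₀ A B i j) (affineCoeff₁ A B z w i j) (affineCoeff₂ A B z w i j)

/-- The coefficients of `L⁻` are those of `L⁺` in opposite order, times `q^{2(z + w)}`. This scalar
agrees on both sides by `hz`, so intertwining `L⁺` is enough. -/
theorem isAffineHom_iff (A A' : UqModule p M) (B B' : UqModule p N) {z w z' w' : ℂ}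
    (hz : z' + w' = z + w) (φ : M ⊗[ℂ] N →ₗ[ℂ] M ⊗[ℂ] N) :
    IsAffineHom ((A.eval z).tensor (B.eval w)) ((A'.eval z').tensor (B'.eval w')) φ ↔
      ∀ i j u y, φ (affinePencil A B z w i j u y) = affinePencil A' B' z' w' i j u (φ y) := by
  refine forall_congr' fun i => forall_congr' fun j => ?_
  rw [affinePencil, affinePencil, intertwines_quadPencil, ← intertwinesSeries_quad,
    ← tensor_eval_Lp, ← tensor_eval_Lp]
  refine ⟨fun h s => LinearMap.congr_fun (h s).1, fun h s => ⟨LinearMap.ext (h s), ?_⟩⟩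
  rw [tensor_eval_Lp, tensor_eval_Lp, intertwinesSeries_quad] at h
  have : IntertwinesSeries φ (((A.eval z).tensor (B.eval w)).Lm i j)
      (((A'.eval z').tensor (B'.eval w')).Lm i j) := by
    rw [tensor_eval_Lm, tensor_eval_Lm, intertwinesSeries_quad, hz]
    obtain ⟨h0, h1, h2⟩ := h
    simp only [LinearMap.smul_apply, map_smul, h0, h1, h2, implies_true, and_self]
  exact LinearMap.ext (this s)

theorem affinePencil_apply (A : UqModule p M) (B : UqModule p N) (z w : ℂ) (i j : Fin 2) (u : ℂ)
    (s : M) (t : N) : affinePencil A B z w i j u (s ⊗ₜ t) =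
      (A.lax₀ 0 j + u • A.lax₁ z 0 j) s ⊗ₜ[ℂ] (B.lax₀ i 0 + u • B.lax₁ w i 0) t +
        (A.lax₀ 1 j + u • A.lax₁ z 1 j) s ⊗ₜ[ℂ] (B.lax₀ i 1 + u • B.lax₁ w i 1) t := by
  have h : affinePencil A B z w i j u (s ⊗ₜ t) =
      (A.lax₀ 0 j s ⊗ₜ[ℂ] B.lax₀ i 0 t + A.lax₀ 1 j s ⊗ₜ[ℂ] B.lax₀ i 1 t) +
      u • ((A.lax₀ 0 j s ⊗ₜ[ℂ] B.lax₁ w i 0 t + A.lax₁ z 0 j s ⊗ₜ[ℂ] B.lax₀ i 0 t) +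
        (A.lax₀ 1 j s ⊗ₜ[ℂ] B.lax₁ w i 1 t + A.lax₁ z 1 j s ⊗ₜ[ℂ] B.lax₀ i 1 t)) +
      u ^ 2 • (A.lax₁ z 0 j s ⊗ₜ[ℂ] B.lax₁ w i 0 t + A.lax₁ z 1 j s ⊗ₜ[ℂ] B.lax₁ w i 1 t) := by
    rw [affinePencil, quadPencil, affineCoeff₀, affineCoeff₁, affineCoeff₂, Fin.sum_univ_two,
      Fin.sum_univ_two, Fin.sum_univ_two]
    rfl
  rw [h]
  simp only [LinearMap.add_apply, LinearMap.smul_apply, TensorProduct.add_tmul,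
    TensorProduct.tmul_add, ← TensorProduct.smul_tmul', TensorProduct.tmul_smul]
  module

/-- The pencil `F(ξ)` with `L⁺₁₂(ξ) = -(q - q⁻¹) ξ F(ξ)`. -/
def raisingPencil (A : UqModule p M) (B : UqModule p N) (z w : ℂ) (u : ℂ) :
    Module.End ℂ (M ⊗[ℂ] N) :=
  qpow p (-(2 * z)) • TensorProduct.map A.f (B.Kinv - (u * qpow p (-(2 * w))) • B.K) +
    qpow p (-(2 * w)) • TensorProduct.map (A.K - (u * qpow p (-(2 * z))) • A.Kinv) B.f

theorem affinePencil_12 (A : UqModule p M) (B : UqModule p N) (z w u : ℂ) :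
    affinePencil A B z w 0 1 u =
      (-((qpow p 1 - qpow p (-1)) * u)) • raisingPencil A B z w u := by
  refine TensorProduct.ext' fun s t => ?_
  rw [affinePencil_apply, raisingPencil]
  simp [UqModule.lax₀, UqModule.lax₁, TensorProduct.sub_tmul, TensorProduct.tmul_sub,
    ← TensorProduct.smul_tmul', TensorProduct.tmul_smul, TensorProduct.add_tmul,
    TensorProduct.tmul_add, TensorProduct.neg_tmul, TensorProduct.tmul_neg]
  module

/-- `A` is the Verma module of highest weight `lam`, with the standard basis `b`. -/
structure UqModule.IsVerma (A : UqModule p M) (b : Module.Basis ℕ ℂ M) (lam : ℂ) : Prop where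
  e_act : ∀ l, A.e (b l) = (qnum p l * qnum p (2 * lam - l + 1)) • b (l - 1)
  f_act : ∀ l, A.f (b l) = b (l + 1)
  K_act : ∀ l, A.K (b l) = qpow p (lam - l) • b l
  Kinv_act : ∀ l, A.Kinv (b l) = qpow p (l - lam) • b l

variable {A : UqModule p M} {B : UqModule p N} {b : Module.Basis ℕ ℂ M} {b' : Module.Basis ℕ ℂ N}
  {x y : ℂ}

/-- As in the rational case each root depends on one index, but now the first factor contributes `z
+ x` and the second `w - y`. Sums and differences exchange roles, and with them the treatment of the
kinds `D` and `N`. -/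
theorem raisingPencil_basis (hA : A.IsVerma b x) (hB : B.IsVerma b' y) (z w u : ℂ) (m n : ℕ) :
    raisingPencil A B z w u (b.tensorProduct b' (m, n)) =
      (-qpow p (y - n - 2 * (z + w)) * (u - qpow p (2 * (w - y + n)))) •
        b.tensorProduct b' (m + 1, n) +
      (-qpow p (m - x - 2 * (z + w)) * (u - qpow p (2 * (z + x - m)))) •
        b.tensorProduct b' (m, n + 1) := by
  simp only [raisingPencil, Module.Basis.tensorProduct_apply, LinearMap.add_apply,
    LinearMap.smul_apply, TensorProduct.map_tmul, LinearMap.sub_apply, hA.f_act, hA.K_act,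
    hA.Kinv_act, hB.f_act, hB.K_act, hB.Kinv_act, TensorProduct.sub_tmul, TensorProduct.tmul_sub,
    ← TensorProduct.smul_tmul', TensorProduct.tmul_smul]
  match_scalars <;> simp only [mul_add, mul_sub, qpow_add, qpow_sub, qpow_neg, qpow_two_mul] <;>
    field_simp [qpow_ne_zero] <;> ring

theorem affinePencil_11 (hA : A.IsVerma b x) (hB : B.IsVerma b' y) (z w u : ℂ) (m n : ℕ) :
    affinePencil A B z w 0 0 u (b.tensorProduct b' (m, n)) =
      ((qpow p (m - x) - u * qpow p (-(2 * z)) * qpow p (x - m)) *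
        (qpow p (n - y) - u * qpow p (-(2 * w)) * qpow p (y - n))) • b.tensorProduct b' (m, n) +
      ((qpow p 1 - qpow p (-1)) ^ 2 * u * qpow p (-(2 * w)) *
        (qnum p m * qnum p (2 * x - m + 1))) • b.tensorProduct b' (m - 1, n + 1) := by
  rw [Module.Basis.tensorProduct_apply, affinePencil_apply]
  simp [UqModule.lax₀, UqModule.lax₁, hA.e_act, hA.K_act, hA.Kinv_act, hB.f_act, hB.K_act,
    hB.Kinv_act,
    ← TensorProduct.smul_tmul', TensorProduct.tmul_smul, TensorProduct.add_tmul,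
    TensorProduct.tmul_add, TensorProduct.neg_tmul, TensorProduct.tmul_neg]
  module

theorem affinePencil_22 (hA : A.IsVerma b x) (hB : B.IsVerma b' y) (z w u : ℂ) (m n : ℕ) :
    affinePencil A B z w 1 1 u (b.tensorProduct b' (m, n)) =
      ((qpow p (x - m) - u * qpow p (-(2 * z)) * qpow p (m - x)) *
        (qpow p (y - n) - u * qpow p (-(2 * w)) * qpow p (n - y))) • b.tensorProduct b' (m, n) +
      ((qpow p 1 - qpow p (-1)) ^ 2 * u * qpow p (-(2 * z)) *
        (qnum p n * qnum p (2 * y - n + 1))) • b.tensorProduct b' (m + 1, n - 1) := by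
  rw [Module.Basis.tensorProduct_apply, affinePencil_apply]
  simp [UqModule.lax₀, UqModule.lax₁, hA.f_act, hA.K_act, hA.Kinv_act, hB.e_act, hB.K_act,
    hB.Kinv_act,
    ← TensorProduct.smul_tmul', TensorProduct.tmul_smul, TensorProduct.add_tmul,
    TensorProduct.tmul_add, TensorProduct.neg_tmul, TensorProduct.tmul_neg]
  module

theorem affinePencil_21 (hA : A.IsVerma b x) (hB : B.IsVerma b' y) (z w u : ℂ) (m n : ℕ) :
    affinePencil A B z w 1 0 u (b.tensorProduct b' (m, n)) =
      (-(qpow p 1 - qpow p (-1)) * (qnum p m * qnum p (2 * x - m + 1)) *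
        (qpow p (y - n) - u * qpow p (-(2 * w)) * qpow p (n - y))) •
          b.tensorProduct b' (m - 1, n) +
      (-(qpow p 1 - qpow p (-1)) * (qnum p n * qnum p (2 * y - n + 1)) *
        (qpow p (m - x) - u * qpow p (-(2 * z)) * qpow p (x - m))) •
          b.tensorProduct b' (m, n - 1) := by
  rw [Module.Basis.tensorProduct_apply, affinePencil_apply]
  simp [UqModule.lax₀, UqModule.lax₁, hA.e_act, hA.K_act, hA.Kinv_act, hB.e_act, hB.K_act,
    hB.Kinv_act,
    ← TensorProduct.smul_tmul', TensorProduct.tmul_smul, TensorProduct.add_tmul,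
    TensorProduct.tmul_add, TensorProduct.neg_tmul, TensorProduct.tmul_neg]
  module

end Affine

/-! ### Raising pencil and exchange relations in the trigonometric case -/

section TrigVerma

variable {p : ℂ} {M N : Type*} [AddCommGroup M] [Module ℂ M] [AddCommGroup N] [Module ℂ N]
  {A : UqModule p M} {B : UqModule p N} {b : Module.Basis ℕ ℂ M} {b' : Module.Basis ℕ ℂ N}
  {x y : ℂ}

theorem affine_isRaising (hp : p ≠ 0) (hA : A.IsVerma b x) (hB : B.IsVerma b' y) (z w : ℂ)
    (hne : ∀ (k : ℕ) (s : ℤ), z + x - (w - y) ≠ k + s * p) :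
    IsRaising (b.tensorProduct b') (raisingPencil A B z w)
      (fun n => -qpow p (y - n - 2 * (z + w))) (fun n => qpow p (2 * (w - y + n)))
      (fun m => -qpow p (m - x - 2 * (z + w))) fun m => qpow p (2 * (z + x - m)) where
  act := raisingPencil_basis hA hB z w
  r_ne _ := neg_ne_zero.2 (qpow_ne_zero _ _)
  s_ne _ := neg_ne_zero.2 (qpow_ne_zero _ _)
  ne m n := by
    rw [sub_ne_zero, Ne, qpow_eq_iff hp]
    rintro ⟨k, hk⟩
    exact hne (m + n) k (by push_cast; linear_combination hk / 2)
  compat m n := by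
    push_cast
    simp only [mul_add, mul_sub, qpow_add, qpow_sub, qpow_two_mul]
    field_simp [qpow_ne_zero]

/-- The form in which `q - q⁻¹ ≠ 0` is needed to clear the denominators of `q`-numbers once `q^{-1}`
is written as an inverse. -/
theorem sq_sub_one_ne_zero (hδ : qpow p 1 - qpow p (-1) ≠ 0) : qpow p 1 ^ 2 - 1 ≠ 0 := by
  intro h
  refine hδ ?_
  rw [qpow_neg]
  field_simp [qpow_ne_zero]
  rw [h, mul_zero]

theorem affine_a_F (hδ : qpow p 1 - qpow p (-1) ≠ 0) (hA : A.IsVerma b x) (hB : B.IsVerma b' y)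
    (z w u v : ℂ) :
    (u - v) • (affinePencil A B z w 0 0 u * raisingPencil A B z w v) =
      (qpow p (-1) * u - qpow p 1 * v) • (raisingPencil A B z w v * affinePencil A B z w 0 0 u) +
      ((qpow p 1 - qpow p (-1)) * u) •
        (raisingPencil A B z w u * affinePencil A B z w 0 0 v) := by
  have hδ' := sq_sub_one_ne_zero hδ
  refine (b.tensorProduct b').ext fun ⟨m, n⟩ => ?_
  rcases m with _ | m <;>
    simp only [LinearMap.smul_apply, LinearMap.add_apply, Module.End.mul_apply, map_add, map_smul,
      raisingPencil_basis hA hB, affinePencil_11 hA hB, Nat.add_sub_cancel] <;>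
    match_scalars <;> push_cast <;>
    simp only [qnum, mul_add, mul_sub, neg_add, neg_sub, qpow_add, qpow_sub, qpow_neg,
      qpow_two_mul, qpow_zero] <;>
    field_simp [qpow_ne_zero] <;> ring

theorem affine_d_F (hδ : qpow p 1 - qpow p (-1) ≠ 0) (hA : A.IsVerma b x) (hB : B.IsVerma b' y)
    (z w u v : ℂ) :
    (u - v) • (affinePencil A B z w 1 1 u * raisingPencil A B z w v) =
      (qpow p 1 * u - qpow p (-1) * v) • (raisingPencil A B z w v * affinePencil A B z w 1 1 u) +
      (-((qpow p 1 - qpow p (-1)) * u)) •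
        (raisingPencil A B z w u * affinePencil A B z w 1 1 v) := by
  have hδ' := sq_sub_one_ne_zero hδ
  refine (b.tensorProduct b').ext fun ⟨m, n⟩ => ?_
  rcases n with _ | n <;>
    simp only [LinearMap.smul_apply, LinearMap.add_apply, Module.End.mul_apply, map_add, map_smul,
      raisingPencil_basis hA hB, affinePencil_22 hA hB, Nat.add_sub_cancel] <;>
    match_scalars <;> push_cast <;>
    simp only [qnum, mul_add, mul_sub, neg_add, neg_sub, qpow_add, qpow_sub, qpow_neg,
      qpow_two_mul, qpow_zero] <;>
    field_simp [qpow_ne_zero] <;> ring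

/-- A component of the defining relations, divided by the factor `-(q - q⁻¹) v` that separates
`L⁺₁₂(v)` from the raising pencil; this leaves the constant `1`. -/
theorem affine_e_F (hδ : qpow p 1 - qpow p (-1) ≠ 0) (hA : A.IsVerma b x) (hB : B.IsVerma b' y)
    (z w u v : ℂ) :
    (u - v) • (affinePencil A B z w 1 0 u * raisingPencil A B z w v) =
      (u - v) • (raisingPencil A B z w v * affinePencil A B z w 1 0 u) +
      (1 : ℂ) • (affinePencil A B z w 0 0 u * affinePencil A B z w 1 1 v -
        affinePencil A B z w 0 0 v * affinePencil A B z w 1 1 u) := by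
  have hδ' := sq_sub_one_ne_zero hδ
  refine (b.tensorProduct b').ext fun ⟨m, n⟩ => ?_
  rcases m with _ | m <;> rcases n with _ | n <;>
    simp only [LinearMap.smul_apply, LinearMap.add_apply, LinearMap.sub_apply, one_smul,
      Module.End.mul_apply, map_add, map_smul, raisingPencil_basis hA hB, affinePencil_11 hA hB,
      affinePencil_22 hA hB, affinePencil_21 hA hB, Nat.add_sub_cancel] <;>
    match_scalars <;> push_cast <;>
    simp only [qnum, mul_add, mul_sub, neg_add, neg_sub, qpow_add, qpow_sub, qpow_neg,
      qpow_two_mul, qpow_zero] <;>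
    field_simp [qpow_ne_zero] <;> ring

/-- In the eigenvalues the parameters enter only through `x + y` and symmetrically through `z - x, w
- y` or `z + x, w + y`, so they survive the permutation. -/
theorem affine_isBethe (hδ : qpow p 1 - qpow p (-1) ≠ 0) (hA : A.IsVerma b x)
    (hB : B.IsVerma b' y) (z w : ℂ) :
    IsBethe (b.tensorProduct b') (fun u v => qpow p (-1) * u - qpow p 1 * v)
      (fun u _ => (qpow p 1 - qpow p (-1)) * u) (fun u v => qpow p 1 * u - qpow p (-1) * v)
      (fun u _ => -((qpow p 1 - qpow p (-1)) * u)) 1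
      (fun u => qpow p (-(x + y)) *
        ((1 - u * qpow p (-(2 * (z - x)))) * (1 - u * qpow p (-(2 * (w - y))))))
      (fun u => qpow p (x + y) *
        ((1 - u * qpow p (-(2 * (z + x)))) * (1 - u * qpow p (-(2 * (w + y))))))
      (affinePencil A B z w 0 0) (affinePencil A B z w 1 1) (affinePencil A B z w 1 0)
      (raisingPencil A B z w) where
  a_F := affine_a_F hδ hA hB z w
  d_F := affine_d_F hδ hA hB z w
  e_F := affine_e_F hδ hA hB z w
  a_vac u := by
    rw [affinePencil_11 hA hB, Nat.cast_zero, qnum_zero, zero_mul, mul_zero, zero_smul, add_zero]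
    congr 1
    simp only [mul_sub, neg_add, neg_sub, qpow_add, qpow_sub, qpow_neg, qpow_two_mul,
      qpow_zero]
    field_simp [qpow_ne_zero]
  d_vac u := by
    rw [affinePencil_22 hA hB, Nat.cast_zero, qnum_zero, zero_mul, mul_zero, zero_smul, add_zero]
    congr 1
    simp only [mul_add, mul_sub, neg_add, qpow_add, qpow_sub, qpow_neg, qpow_two_mul,
      qpow_zero]
    field_simp [qpow_ne_zero]
  e_vac u := by
    rw [affinePencil_21 hA hB, Nat.cast_zero, qnum_zero]
    simp

end TrigVerma

/-! ### Trigonometric matrices between tensor products of Verma modules -/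

section TrigHom

variable {p : ℂ} {M N : Type*} [AddCommGroup M] [Module ℂ M] [AddCommGroup N] [Module ℂ N]
  {A A' : UqModule p M} {B B' : UqModule p N} {b : Module.Basis ℕ ℂ M} {b' : Module.Basis ℕ ℂ N}
  {z lam z' lam' : Fin 2 → ℂ} {σ τ : Equiv.Perm (Fin 2)}

theorem affineCoeff₀_apply (A : UqModule p M) (B : UqModule p N) (i j : Fin 2) (s : M) (t : N) :
    affineCoeff₀ A B i j (s ⊗ₜ t) =
      A.lax₀ 0 j s ⊗ₜ[ℂ] B.lax₀ i 0 t + A.lax₀ 1 j s ⊗ₜ[ℂ] B.lax₀ i 1 t := by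
  rw [affineCoeff₀, Fin.sum_univ_two]
  rfl

theorem affineCoeff₂_apply (A : UqModule p M) (B : UqModule p N) (z w : ℂ) (i j : Fin 2) (s : M)
    (t : N) : affineCoeff₂ A B z w i j (s ⊗ₜ t) =
      A.lax₁ z 0 j s ⊗ₜ[ℂ] B.lax₁ w i 0 t + A.lax₁ z 1 j s ⊗ₜ[ℂ] B.lax₁ w i 1 t := by
  rw [affineCoeff₂, Fin.sum_univ_two]
  rfl

theorem affineCoeff₀_11 (A : UqModule p M) (B : UqModule p N) :
    affineCoeff₀ A B 0 0 = (A.tensor B).Kinv := by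
  refine TensorProduct.ext' fun s t => ?_
  rw [affineCoeff₀_apply]
  simp [UqModule.lax₀, UqModule.tensor]

theorem affineCoeff₀_22 (A : UqModule p M) (B : UqModule p N) :
    affineCoeff₀ A B 1 1 = (A.tensor B).K := by
  refine TensorProduct.ext' fun s t => ?_
  rw [affineCoeff₀_apply]
  simp [UqModule.lax₀, UqModule.tensor]

theorem affineCoeff₀_21 (A : UqModule p M) (B : UqModule p N) :
    affineCoeff₀ A B 1 0 = (-(qpow p 1 - qpow p (-1))) • (A.tensor B).e := by
  refine TensorProduct.ext' fun s t => ?_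
  rw [affineCoeff₀_apply]
  simp [UqModule.lax₀, UqModule.tensor, TensorProduct.neg_tmul, TensorProduct.tmul_neg,
    TensorProduct.tmul_smul, ← TensorProduct.smul_tmul']
  module

theorem affineCoeff₂_12 (A : UqModule p M) (B : UqModule p N) (z w : ℂ) :
    affineCoeff₂ A B z w 0 1 =
      (qpow p (-(2 * (z + w))) * (qpow p 1 - qpow p (-1))) • (A.tensor B).f := by
  have h : qpow p (-(2 * (z + w))) = qpow p (-(2 * z)) * qpow p (-(2 * w)) := by
    rw [← qpow_add]; ring_nf
  refine TensorProduct.ext' fun s t => ?_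
  rw [affineCoeff₂_apply, LinearMap.smul_apply, h]
  simp [UqModule.lax₁, UqModule.tensor, TensorProduct.neg_tmul, TensorProduct.tmul_neg,
    TensorProduct.tmul_smul, ← TensorProduct.smul_tmul']
  module

/-- The coefficient of `ξ⁰` in `L⁺` contains `q^{-h}`, `q^h` and `e` for the whole tensor product,
and the coefficient of `ξ²` in `L⁺₁₂` contains `f`, with a nonzero scalar depending only on `z₁ +
z₂`. -/
theorem isUqHom_of_pencil (hδ : qpow p 1 - qpow p (-1) ≠ 0) (hz : z' 0 + z' 1 = z 0 + z 1)
    {φ : M ⊗[ℂ] N →ₗ[ℂ] M ⊗[ℂ] N}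
    (h : ∀ i j u y, φ (affinePencil A B (z 0) (z 1) i j u y) =
      affinePencil A' B' (z' 0) (z' 1) i j u (φ y)) :
    IsUqHom (A.tensor B) (A'.tensor B') φ := by
  have h0 := fun i j => ((intertwines_quadPencil φ _ _ _ _ _ _).1 (h i j)).1
  have h2 := ((intertwines_quadPencil φ _ _ _ _ _ _).1 (h 0 1)).2.2
  have he := h0 1 0
  have hK := h0 1 1
  have hKinv := h0 0 0
  rw [affineCoeff₀_21, affineCoeff₀_21] at he
  rw [affineCoeff₀_22, affineCoeff₀_22] at hK
  rw [affineCoeff₀_11, affineCoeff₀_11] at hKinv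
  rw [affineCoeff₂_12, affineCoeff₂_12, hz] at h2
  simp only [LinearMap.smul_apply, map_smul] at he h2
  exact ⟨LinearMap.ext fun y => smul_right_injective _ (neg_ne_zero.2 hδ) (he y),
    LinearMap.ext fun y => smul_right_injective _ (mul_ne_zero (qpow_ne_zero _ _) hδ) (h2 y),
    LinearMap.ext hK, LinearMap.ext hKinv⟩

theorem qShapovalov_eq_prod (p : ℂ) (l : ℕ) (x : ℂ) :
    qShapovalov p l x =
      ∏ i ∈ Finset.range l, qnum p ((i + 1 : ℕ) : ℂ) * qnum p (2 * x - (i + 1 : ℕ) + 1) := by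
  rw [qShapovalov, Finset.prod_mul_distrib]
  congr 1 <;> refine Finset.prod_congr rfl fun i _ => ?_
  · push_cast; rfl
  · congr 1; push_cast; ring

theorem qVerma_isLowering (hp : ∀ r : ℚ, p ≠ r) (hA : A.IsVerma b (lam 0))
    (hB : B.IsVerma b' (lam 1)) (hx : ∀ a (k : ℕ) (s : ℤ), 2 * lam a ≠ k + s * p) :
    IsLowering (b.tensorProduct b') (A.tensor B).e
      (fun m => qnum p m * qnum p (2 * lam 0 - m + 1))
      (fun n => qnum p n * qnum p (2 * lam 1 - n + 1)) (fun n => qpow p (lam 1 - n))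
      fun m => qpow p (m - lam 0) where
  act m n := by
    simp [UqModule.tensor, hA.e_act, hA.Kinv_act, hB.e_act, hB.K_act, ← TensorProduct.smul_tmul',
      TensorProduct.tmul_smul, smul_smul]
    module
  left_zero := by simp [qnum_zero]
  right_zero := by simp [qnum_zero]
  left_ne m := mul_ne_zero (qnum_ne_zero hp (natCast_succ_ne hp m)) <| qnum_ne_zero hp
    fun s h => hx 0 m s (by push_cast at h; linear_combination h)
  right_ne n := mul_ne_zero (qnum_ne_zero hp (natCast_succ_ne hp n)) <| qnum_ne_zero hp
    fun s h => hx 1 n s (by push_cast at h; linear_combination h)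
  k_ne _ := qpow_ne_zero _ _

/-- The pencil of raising operators of a non-resonant tensor product of Verma modules. -/
theorem qEvalTensor_isRaising (hp : ∀ r : ℚ, p ≠ r) (hA : A.IsVerma b (lam 0))
    (hB : B.IsVerma b' (lam 1))
    (hz : ∀ a b (k : ℕ) (s : ℤ), z a - z b + lam a + lam b ≠ k + s * p) :
    IsRaising (b.tensorProduct b') (raisingPencil A B (z 0) (z 1))
      (fun n => -qpow p (lam 1 - n - 2 * (z 0 + z 1))) (fun n => qpow p (2 * (z 1 - lam 1 + n)))
      (fun m => -qpow p (m - lam 0 - 2 * (z 0 + z 1))) fun m => qpow p (2 * (z 0 + lam 0 - m)) :=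
  affine_isRaising (ne_zero_of_irrational hp) hA hB _ _ fun k s h =>
    hz 0 1 k s (by linear_combination h)

variable (hp : ∀ r : ℚ, p ≠ r) (hA : A.IsVerma b (lam 0)) (hB : B.IsVerma b' (lam 1))
  (hA' : A'.IsVerma b (lam' 0)) (hB' : B'.IsVerma b' (lam' 1))
  (hz : ∀ a b (k : ℕ) (s : ℤ), z a - z b + lam a + lam b ≠ k + s * p)
  (hz' : ∀ a b (k : ℕ) (s : ℤ), z' a - z' b + lam' a + lam' b ≠ k + s * p)

/-- The isomorphism between two tensor products of quantum Verma modules. -/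
def trigEquiv : (M ⊗[ℂ] N) ≃ₗ[ℂ] (M ⊗[ℂ] N) :=
  (qEvalTensor_isRaising hp hA hB hz).equiv (qEvalTensor_isRaising hp hA' hB' hz')

theorem trigEquiv_pencil (h : IsPermuted σ τ z lam z' lam') (i j : Fin 2) (u : ℂ)
    (y : M ⊗[ℂ] N) : trigEquiv hp hA hB hA' hB' hz hz' (affinePencil A B (z 0) (z 1) i j u y) =
      affinePencil A' B' (z' 0) (z' 1) i j u (trigEquiv hp hA hB hA' hB' hz hz' y) := by
  have hb := affine_isBethe (delta_ne_zero hp) hA hB (z 0) (z 1)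
  have hb' := affine_isBethe (delta_ne_zero hp) hA' hB' (z' 0) (z' 1)
  rw [h.sum_lam, funext fun u => congrArg (qpow p (-(lam 0 + lam 1)) * ·)
      (h.prod_sub fun x => 1 - u * qpow p (-(2 * x))),
    funext fun u => congrArg (qpow p (lam 0 + lam 1) * ·)
      (h.prod_add fun x => 1 - u * qpow p (-(2 * x)))] at hb'
  have hF := qEvalTensor_isRaising hp hA hB hz
  have hF' := qEvalTensor_isRaising hp hA' hB' hz'
  fin_cases i <;> fin_cases j
  · exact hF.equiv_diagonal hF' hb.a_F hb'.a_F hb.a_vac hb'.a_vac u y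
  · change trigEquiv hp hA hB hA' hB' hz hz' (affinePencil A B (z 0) (z 1) 0 1 u y) =
      affinePencil A' B' (z' 0) (z' 1) 0 1 u (trigEquiv hp hA hB hA' hB' hz hz' y)
    rw [affinePencil_12, affinePencil_12, LinearMap.smul_apply, LinearMap.smul_apply, map_smul]
    exact congrArg _ (hF.equiv_raise hF' u y)
  · exact hF.equiv_lower hF' hb hb' u y
  · exact hF.equiv_diagonal hF' hb.d_F hb'.d_F hb.d_vac hb'.d_vac u y

theorem trigEquiv_vac : trigEquiv hp hA hB hA' hB' hz hz' (b 0 ⊗ₜ b' 0) = b 0 ⊗ₜ b' 0 := by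
  have := (qEvalTensor_isRaising hp hA hB hz).equiv_vac (qEvalTensor_isRaising hp hA' hB' hz')
  rwa [Module.Basis.tensorProduct_apply] at this

theorem trigEquiv_isAffineHom (h : IsPermuted σ τ z lam z' lam') :
    IsAffineHom ((A.eval (z 0)).tensor (B.eval (z 1))) ((A'.eval (z' 0)).tensor (B'.eval (z' 1)))
      (trigEquiv hp hA hB hA' hB' hz hz' : M ⊗[ℂ] N →ₗ[ℂ] M ⊗[ℂ] N) :=
  (isAffineHom_iff _ _ _ _ h.sum_z _).2 (trigEquiv_pencil hp hA hB hA' hB' hz hz' h)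

theorem raisingPencil_interpolate (A : UqModule p M) (B : UqModule p N) (z w : ℂ) (y : M ⊗[ℂ] N) :
    raisingPencil A B z w 0 y =
      (2 : ℂ) • raisingPencil A B z w 1 y - raisingPencil A B z w 2 y := by
  refine LinearMap.congr_fun (f := raisingPencil A B z w 0)
    (g := (2 : ℂ) • raisingPencil A B z w 1 - raisingPencil A B z w 2)
    (TensorProduct.ext' fun s t => ?_) y
  simp only [raisingPencil, LinearMap.add_apply, LinearMap.sub_apply, LinearMap.smul_apply,
    TensorProduct.map_tmul, TensorProduct.sub_tmul, TensorProduct.tmul_sub,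
    ← TensorProduct.smul_tmul', TensorProduct.tmul_smul]
  module

/-- The factor `ξ` in `L⁺₁₂` can be cancelled only for `ξ ≠ 0`; the value at `0` is recovered from
those at `1` and `2` because the pencil is affine. -/
theorem intertwines_raisingPencil (hδ : qpow p 1 - qpow p (-1) ≠ 0) {z w z' w' : ℂ}
    {φ : M ⊗[ℂ] N →ₗ[ℂ] M ⊗[ℂ] N}
    (h : ∀ u y, φ (affinePencil A B z w 0 1 u y) = affinePencil A' B' z' w' 0 1 u (φ y)) (u : ℂ)
    (y : M ⊗[ℂ] N) : φ (raisingPencil A B z w u y) = raisingPencil A' B' z' w' u (φ y) := by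
  have key : ∀ u, u ≠ 0 → φ (raisingPencil A B z w u y) = raisingPencil A' B' z' w' u (φ y) := by
    intro u hu
    have := h u y
    rw [affinePencil_12, affinePencil_12, LinearMap.smul_apply, LinearMap.smul_apply,
      map_smul] at this
    exact smul_right_injective _ (neg_ne_zero.2 (mul_ne_zero hδ hu)) this
  rcases eq_or_ne u 0 with rfl | hu
  · rw [raisingPencil_interpolate, raisingPencil_interpolate, map_sub, map_smul,
      key 1 one_ne_zero, key 2 two_ne_zero]
  · exact key u hu

theorem eq_trigEquiv (h : IsPermuted σ τ z lam z' lam') {φ : (M ⊗[ℂ] N) ≃ₗ[ℂ] (M ⊗[ℂ] N)}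
    (hφ : IsAffineHom ((A.eval (z 0)).tensor (B.eval (z 1)))
      ((A'.eval (z' 0)).tensor (B'.eval (z' 1))) (φ : M ⊗[ℂ] N →ₗ[ℂ] M ⊗[ℂ] N))
    (h0 : φ (b 0 ⊗ₜ b' 0) = b 0 ⊗ₜ b' 0) : φ = trigEquiv hp hA hB hA' hB' hz hz' := by
  rw [isAffineHom_iff _ _ _ _ h.sum_z] at hφ
  refine LinearEquiv.toLinearMap_injective ((qEvalTensor_isRaising hp hA hB hz).hom_ext
    (raisingPencil A' B' (z' 0) (z' 1)) ?_
    (intertwines_raisingPencil (delta_ne_zero hp) (hφ 0 1))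
    ((qEvalTensor_isRaising hp hA hB hz).equiv_raise (qEvalTensor_isRaising hp hA' hB' hz')))
  rw [Module.Basis.tensorProduct_apply]
  exact h0.trans (trigEquiv_vac hp hA hB hA' hB' hz hz').symm

theorem trigEquiv_isUqHom (h : IsPermuted σ τ z lam z' lam') :
    IsUqHom (A.tensor B) (A'.tensor B')
      (trigEquiv hp hA hB hA' hB' hz hz' : M ⊗[ℂ] N →ₗ[ℂ] M ⊗[ℂ] N) :=
  isUqHom_of_pencil (delta_ne_zero hp) h.sum_z (trigEquiv_pencil hp hA hB hA' hB' hz hz' h)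

theorem two_mul_ne_add (hz : ∀ a b (k : ℕ) (s : ℤ), z a - z b + lam a + lam b ≠ k + s * p)
    (a : Fin 2) (k : ℕ) (s : ℤ) : 2 * lam a ≠ k + s * p :=
  fun h => hz a a k s (by linear_combination h)

/-- By `h1` the root `ρ 0` is unchanged, and the power of `q` is `t ^ l`, where `t` is the ratio of
the leading coefficients `r 0`. -/
theorem trigEquiv_singular_left (h : IsPermuted σ τ z lam z' lam')
    (h1 : z' 1 - lam' 1 = z 1 - lam 1) {l : ℕ} {w w' : M ⊗[ℂ] N}
    (hw : IsSingular (b.tensorProduct b') (A.tensor B).e (qShapovalov p l (lam 0))⁻¹ l w)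
    (hw' : IsSingular (b.tensorProduct b') (A'.tensor B').e (qShapovalov p l (lam' 0))⁻¹ l w') :
    trigEquiv hp hA hB hA' hB' hz hz' w = (qpow p (l * (lam 0 - lam' 0)) *
      (qShapovalov p l (lam' 0) / qShapovalov p l (lam 0))) • w' := by
  simp only [qShapovalov_eq_prod] at hw hw' ⊢
  rw [qpow_nat_mul]
  refine (qEvalTensor_isRaising hp hA hB hz).equiv_isSingular_left
    (qEvalTensor_isRaising hp hA' hB' hz')
    (qVerma_isLowering hp hA hB (two_mul_ne_add hz))
    (qVerma_isLowering hp hA' hB' (two_mul_ne_add hz'))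
    (LinearMap.congr_fun (trigEquiv_isUqHom hp hA hB hA' hB' hz hz' h).1) _ ?_ (by rw [h1]) hw hw'
  -- The ratio of the coefficients `r 0` is `q^{lam' 1 - lam 1}`; it equals `q^{lam 0 - lam' 0}`
  -- because the sum of the highest weights is preserved.
  rw [mul_neg, ← qpow_add, h.sum_z]
  congr 2
  linear_combination h.sum_lam

theorem trigEquiv_singular_right (h : IsPermuted σ τ z lam z' lam')
    (h1 : z' 0 + lam' 0 = z 0 + lam 0) {l : ℕ} {w w' : M ⊗[ℂ] N}
    (hw : IsSingular (b.tensorProduct b') (A.tensor B).e (qShapovalov p l (lam 0))⁻¹ l w)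
    (hw' : IsSingular (b.tensorProduct b') (A'.tensor B').e (qShapovalov p l (lam' 0))⁻¹ l w') :
    trigEquiv hp hA hB hA' hB' hz hz' w = (qpow p (l * (lam 0 - lam' 0)) *
      (qShapovalov p l (lam' 1) / qShapovalov p l (lam 1))) • w' := by
  simp only [qShapovalov_eq_prod] at hw hw' ⊢
  rw [qpow_nat_mul]
  refine (qEvalTensor_isRaising hp hA hB hz).equiv_isSingular_right
    (qEvalTensor_isRaising hp hA' hB' hz')
    (qVerma_isLowering hp hA hB (two_mul_ne_add hz))
    (qVerma_isLowering hp hA' hB' (two_mul_ne_add hz'))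
    (LinearMap.congr_fun (trigEquiv_isUqHom hp hA hB hA' hB' hz hz' h).1) _ ?_ (by rw [h1])
    -- The constant `θ`: the quotient of `q^{lam 1 - n}` by `q^{m - lam 0}` depends only on `m + n =
    -- l - 1` and on `lam 0 + lam 1`, hence is the same for source and target.
    (qpow_ne_zero p (lam 0 + lam 1 - l + 1)) ?_ ?_ hw hw'
  · rw [mul_neg, ← qpow_add, h.sum_z]
    congr 2
    ring
  · rintro m n rfl
    rw [← qpow_add]
    congr 1
    push_cast
    ring
  · rintro m n rfl
    rw [← qpow_add, ← h.sum_lam]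
    congr 1
    push_cast
    ring

end TrigHom

/-! ### The trigonometric theorem -/

theorem qVerma_isVerma (p lam : ℂ) : (qVerma p lam).IsVerma vermaBasis lam where
  e_act l := by rw [vermaBasis_apply, vermaBasis_apply]; exact byBasis_fv _ l
  f_act l := by rw [vermaBasis_apply, vermaBasis_apply]; exact byBasis_fv _ l
  K_act l := by rw [vermaBasis_apply]; exact byBasis_fv _ l
  Kinv_act l := by rw [vermaBasis_apply]; exact byBasis_fv _ l

theorem isQSingularVector_iff (p : ℂ) (lam : Fin 2 → ℂ) (l : ℕ) (w : VermaSpace₂) :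
    IsQSingularVector p lam l w ↔ IsSingular (vermaBasis.tensorProduct vermaBasis)
      ((qVerma p (lam 0)).tensor (qVerma p (lam 1))).e (qShapovalov p l (lam 0))⁻¹ l w := by
  simp only [IsSingular, Module.Basis.tensorProduct_apply, vermaBasis_apply]
  rfl

/-- No resonances between the parameters of two quantum Verma modules. -/
def IsQGeneric (p : ℂ) (z lam : Fin 2 → ℂ) : Prop :=
  ∀ a b (k : ℕ) (s : ℤ), z a - z b + lam a + lam b ≠ k + s * p

variable {p : ℂ} (hp : ∀ r : ℚ, p ≠ r) {z lam : Fin 2 → ℂ}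

theorem IsQGeneric.target (hz : IsQGeneric p z lam) (κ : MatrixKind) :
    IsQGeneric p (κ.targetZ z lam) (κ.targetLam z lam) := fun a b k s => by
  rw [(κ.isPermuted z lam).difference]
  exact hz _ _ k s

/-- The trigonometric matrix of the given kind. -/
def trigMatrix (κ : MatrixKind) (hz : IsQGeneric p z lam) : VermaSpace₂ ≃ₗ[ℂ] VermaSpace₂ :=
  trigEquiv hp (qVerma_isVerma p (lam 0)) (qVerma_isVerma p (lam 1)) (qVerma_isVerma p _)
    (qVerma_isVerma p _) hz (hz.target κ)

theorem isTrigMatrix_iff (κ : MatrixKind) (hz : IsQGeneric p z lam)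
    (A : VermaSpace₂ ≃ₗ[ℂ] VermaSpace₂) :
    IsTrigMatrix p κ z lam A ↔ A = trigMatrix hp κ hz := by
  have hA := fun a => qVerma_isVerma p (lam a)
  have hA' := fun a => qVerma_isVerma p (κ.targetLam z lam a)
  constructor
  · rintro ⟨h, h0⟩
    refine eq_trigEquiv hp (hA 0) (hA 1) (hA' 0) (hA' 1) hz (hz.target κ) (κ.isPermuted z lam) h ?_
    simp only [vermaBasis_apply]
    exact h0
  · rintro rfl
    refine ⟨trigEquiv_isAffineHom hp (hA 0) (hA 1) (hA' 0) (hA' 1) hz (hz.target κ)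
      (κ.isPermuted z lam), ?_⟩
    have := trigEquiv_vac hp (hA 0) (hA 1) (hA' 0) (hA' 1) hz (hz.target κ)
    simp only [vermaBasis_apply] at this
    exact this

include hp

theorem existsUnique_isQSingularVector (hz : IsQGeneric p z lam) (l : ℕ) :
    ∃! w, IsQSingularVector p lam l w := by
  simp only [isQSingularVector_iff]
  exact (qVerma_isLowering hp (qVerma_isVerma p (lam 0)) (qVerma_isVerma p (lam 1))
    (two_mul_ne_add hz)).existsUnique_isSingular _ l

theorem trigMatrix_D (hz : IsQGeneric p z lam) {l : ℕ} {w w' : VermaSpace₂}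
    (hw : IsQSingularVector p lam l w)
    (hw' : IsQSingularVector p (MatrixKind.D.targetLam z lam) l w') :
    trigMatrix hp .D hz w = (qpow p (l * (lam 0 - MatrixKind.D.targetLam z lam 0)) *
      (qShapovalov p l (MatrixKind.D.targetLam z lam 0) / qShapovalov p l (lam 0))) • w' :=
  trigEquiv_singular_left hp (qVerma_isVerma p (lam 0)) (qVerma_isVerma p (lam 1))
    (qVerma_isVerma p _) (qVerma_isVerma p _) hz (hz.target .D) (MatrixKind.D.isPermuted z lam)
    ((MatrixKind.D.isPermuted z lam).sub 1)
    ((isQSingularVector_iff _ _ _ _).1 hw) ((isQSingularVector_iff _ _ _ _).1 hw')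

theorem trigMatrix_N (hz : IsQGeneric p z lam) {l : ℕ} {w w' : VermaSpace₂}
    (hw : IsQSingularVector p lam l w)
    (hw' : IsQSingularVector p (MatrixKind.N.targetLam z lam) l w') :
    trigMatrix hp .N hz w = (qpow p (l * (lam 0 - MatrixKind.N.targetLam z lam 0)) *
      (qShapovalov p l (MatrixKind.N.targetLam z lam 1) / qShapovalov p l (lam 1))) • w' :=
  trigEquiv_singular_right hp (qVerma_isVerma p (lam 0)) (qVerma_isVerma p (lam 1))
    (qVerma_isVerma p _) (qVerma_isVerma p _) hz (hz.target .N) (MatrixKind.N.isPermuted z lam)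
    ((MatrixKind.N.isPermuted z lam).add 0)
    ((isQSingularVector_iff _ _ _ _).1 hw) ((isQSingularVector_iff _ _ _ _).1 hw')

omit hp in
theorem isAffineHom_comp {z' lam' z'' lam'' : Fin 2 → ℂ} {φ ψ : VermaSpace₂ ≃ₗ[ℂ] VermaSpace₂}
    (h : IsAffineHom (qEvalVerma₂ p z lam) (qEvalVerma₂ p z' lam')
      (φ : VermaSpace₂ →ₗ[ℂ] VermaSpace₂))
    (h' : IsAffineHom (qEvalVerma₂ p z' lam') (qEvalVerma₂ p z'' lam'')
      (ψ : VermaSpace₂ →ₗ[ℂ] VermaSpace₂)) :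
    IsAffineHom (qEvalVerma₂ p z lam) (qEvalVerma₂ p z'' lam'')
      (φ.trans ψ : VermaSpace₂ →ₗ[ℂ] VermaSpace₂) := fun i j n => by
  refine ⟨LinearMap.ext fun y => ?_, LinearMap.ext fun y => ?_⟩
  · have e := LinearMap.congr_fun (h i j n).1 y
    have e' := LinearMap.congr_fun (h' i j n).1 (φ y)
    exact (congrArg ψ e).trans e'
  · have e := LinearMap.congr_fun (h i j n).2 y
    have e' := LinearMap.congr_fun (h' i j n).2 (φ y)
    exact (congrArg ψ e).trans e'

theorem trigMatrix_R (hz : IsQGeneric p z lam) (y : VermaSpace₂) :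
    trigMatrix hp .R hz y = trigMatrix hp .N (hz.target .D) (trigMatrix hp .D hz y) := by
  have h := (isTrigMatrix_iff hp .D hz _).2 rfl
  have h' := (isTrigMatrix_iff hp .N (hz.target .D) _).2 rfl
  have h'' : IsTrigMatrix p .R z lam
      ((trigMatrix hp .D hz).trans (trigMatrix hp .N (hz.target .D))) := by
    refine ⟨?_, (congrArg _ h.2).trans h'.2⟩
    rw [← MatrixKind.targetZ_N_D, ← MatrixKind.targetLam_N_D]
    exact isAffineHom_comp h.1 h'.1
  exact LinearEquiv.congr_fun ((isTrigMatrix_iff hp .R hz _).1 h'').symm y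

theorem qShapovalov_ne_zero (hz : IsQGeneric p z lam) (l : ℕ) (a : Fin 2) :
    qShapovalov p l (lam a) ≠ 0 := by
  refine mul_ne_zero (Finset.prod_ne_zero_iff.2 fun k _ => ?_)
    (Finset.prod_ne_zero_iff.2 fun k _ => qnum_ne_zero hp fun s h =>
      two_mul_ne_add hz a k s (by linear_combination h))
  have := qnum_ne_zero hp (natCast_succ_ne hp k)
  rwa [Nat.cast_succ] at this

omit hp in
theorem lamD_eq (z lam : Fin 2 → ℂ) : lamD z lam = (-z 0 + z 1 + lam 0 + lam 1) / 2 := by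
  simp [lamD, twistLam]
  ring

/-- The kinds `D` and `N` give quotients of values at the first, respectively the second, highest
weight, with `lamD` in place of `lamN`. For `R` the quotients are multiplied, the value at `lam 0`
cancels, and the exponents of `q` add up. -/
theorem trigMatrix_singular (κ : MatrixKind) (hz : IsQGeneric p z lam) {l : ℕ}
    {w w' : VermaSpace₂} (hw : IsQSingularVector p lam l w)
    (hw' : IsQSingularVector p (κ.targetLam z lam) l w') :
    trigMatrix hp κ hz w = (qpow p (l * (lam 0 - κ.targetLam z lam 0)) *
      (qShapovalov p l (lamD z lam) /
        qShapovalov p l (lamD (κ.targetZ z lam) (κ.targetLam z lam)))) • w' := by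
  have hD0 : MatrixKind.D.targetLam z lam 0 = lamD z lam := rfl
  cases κ with
  | D =>
    have h1 : lamD (MatrixKind.D.targetZ z lam) (MatrixKind.D.targetLam z lam) = lam 0 := by
      rw [lamD_eq]
      simp [MatrixKind.targetZ, MatrixKind.targetLam, twistZ, twistLam, MatrixKind.sup,
        MatrixKind.sub]
      ring
    rw [trigMatrix_D hp hz hw hw', h1, hD0]
  | N =>
    have h1 : lamD (MatrixKind.N.targetZ z lam) (MatrixKind.N.targetLam z lam) = lam 1 := by
      rw [lamD_eq]
      simp [MatrixKind.targetZ, MatrixKind.targetLam, twistZ, twistLam, MatrixKind.sup,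
        MatrixKind.sub]
      ring
    have h2 : MatrixKind.N.targetLam z lam 1 = lamD z lam := by
      rw [lamD_eq]
      simp [MatrixKind.targetLam, twistLam, MatrixKind.sup, MatrixKind.sub]
      ring
    rw [trigMatrix_N hp hz hw hw', h1, h2]
  | R =>
    obtain ⟨v, hv, -⟩ := existsUnique_isQSingularVector hp (hz.target .D) l
    rw [← MatrixKind.targetLam_N_D] at hw'
    have h1 : lamD (MatrixKind.R.targetZ z lam) (MatrixKind.R.targetLam z lam) =
        MatrixKind.D.targetLam z lam 1 := by
      rw [lamD_eq]
      simp [MatrixKind.targetZ, MatrixKind.targetLam, twistZ, twistLam, MatrixKind.sup,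
        MatrixKind.sub]
      ring
    have h2 : MatrixKind.N.targetLam (MatrixKind.D.targetZ z lam) (MatrixKind.D.targetLam z lam) 1 =
        lam 0 := by
      rw [MatrixKind.targetLam_N_D]
      simp [MatrixKind.targetLam, twistLam, MatrixKind.sup, MatrixKind.sub]
    have h3 := qShapovalov_ne_zero hp hz l 0
    have h4 : qpow p (l * (lam 0 - MatrixKind.R.targetLam z lam 0)) =
        qpow p (l * (lam 0 - MatrixKind.D.targetLam z lam 0)) *
          qpow p (l * (MatrixKind.D.targetLam z lam 0 - MatrixKind.R.targetLam z lam 0)) := by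
      rw [← qpow_add]
      ring_nf
    rw [trigMatrix_R, trigMatrix_D hp hz hw hv, map_smul,
      trigMatrix_N hp (hz.target .D) hv hw', h1, h2, h4, MatrixKind.targetLam_N_D, hD0, smul_smul]
    congr 1
    field_simp

omit hp in
theorem trig_theorem (p : ℂ) (z lam : Fin 2 → ℂ) (κ : MatrixKind) (hp : ∀ r : ℚ, p ≠ (r : ℂ))
    (hz : ∀ (a b : Fin 2) (k : ℕ) (s : ℤ), z a - z b + lam a + lam b ≠ (k : ℂ) + s * p) :
    (∃! A, IsTrigMatrix p κ z lam A) ∧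
      (∀ l, ∃! w, IsQSingularVector p lam l w) ∧
      (∀ l, ∃! w, IsQSingularVector p (κ.targetLam z lam) l w) ∧
      ∀ A, IsTrigMatrix p κ z lam A →
        IsUqHom (qVerma₂ p lam) (qVerma₂ p (κ.targetLam z lam))
          (A : VermaSpace₂ →ₗ[ℂ] VermaSpace₂) ∧
        ∀ (l : ℕ) (w w' : VermaSpace₂), IsQSingularVector p lam l w →
          IsQSingularVector p (κ.targetLam z lam) l w' →
          A w = (qpow p (l * (lam 0 - κ.targetLam z lam 0)) *
            (qShapovalov p l (lamD z lam) /
              qShapovalov p l (lamD (κ.targetZ z lam) (κ.targetLam z lam)))) • w' := by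
  change IsQGeneric p z lam at hz
  simp only [isTrigMatrix_iff hp κ hz]
  refine ⟨existsUnique_eq, existsUnique_isQSingularVector hp hz,
    existsUnique_isQSingularVector hp (hz.target κ), ?_⟩
  rintro _ rfl
  exact ⟨trigEquiv_isUqHom hp (qVerma_isVerma p (lam 0)) (qVerma_isVerma p (lam 1))
    (qVerma_isVerma p _) (qVerma_isVerma p _) hz (hz.target κ) (κ.isPermuted z lam),
    fun l w w' => trigMatrix_singular hp κ hz⟩

end SpectralDecomposition

end

open scoped TensorProduct in
theorem mainTheorem10 :
    (∀ (z lam : Fin 2 → ℂ) (κ : SpectralDecomposition.MatrixKind),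
      (∀ (a b : Fin 2) (k : ℕ), z a - z b + lam a + lam b ≠ (k : ℂ)) →
      (∃! A, SpectralDecomposition.IsRationalMatrix κ z lam A) ∧
      (∀ l, ∃! w, SpectralDecomposition.IsSingularVector lam l w) ∧
      (∀ l, ∃! w, SpectralDecomposition.IsSingularVector (κ.targetLam z lam) l w) ∧
      ∀ A, SpectralDecomposition.IsRationalMatrix κ z lam A →
        SpectralDecomposition.IsSl2Hom (SpectralDecomposition.verma₂ lam)
          (SpectralDecomposition.verma₂ (κ.targetLam z lam)) A ∧
        ∀ (l : ℕ) (w w' : SpectralDecomposition.VermaSpace₂),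
          SpectralDecomposition.IsSingularVector lam l w →
          SpectralDecomposition.IsSingularVector (κ.targetLam z lam) l w' →
          A w = (SpectralDecomposition.shapovalov l (SpectralDecomposition.lamN z lam) /
            SpectralDecomposition.shapovalov l
              (SpectralDecomposition.lamN (κ.targetZ z lam) (κ.targetLam z lam))) • w') ∧
    (∀ (p : ℂ) (z lam : Fin 2 → ℂ) (κ : SpectralDecomposition.MatrixKind),
      (∀ r : ℚ, p ≠ (r : ℂ)) →
      (∀ (a b : Fin 2) (k : ℕ) (s : ℤ), z a - z b + lam a + lam b ≠ (k : ℂ) + s * p) →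
      (∃! A, SpectralDecomposition.IsTrigMatrix p κ z lam A) ∧
      (∀ l, ∃! w, SpectralDecomposition.IsQSingularVector p lam l w) ∧
      (∀ l, ∃! w, SpectralDecomposition.IsQSingularVector p (κ.targetLam z lam) l w) ∧
      ∀ A, SpectralDecomposition.IsTrigMatrix p κ z lam A →
        SpectralDecomposition.IsUqHom (SpectralDecomposition.qVerma₂ p lam)
          (SpectralDecomposition.qVerma₂ p (κ.targetLam z lam)) A ∧
        ∀ (l : ℕ) (w w' : SpectralDecomposition.VermaSpace₂),
          SpectralDecomposition.IsQSingularVector p lam l w →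
          SpectralDecomposition.IsQSingularVector p (κ.targetLam z lam) l w' →
          A w = (SpectralDecomposition.qpow p (l * (lam 0 - κ.targetLam z lam 0)) *
            (SpectralDecomposition.qShapovalov p l (SpectralDecomposition.lamD z lam) /
              SpectralDecomposition.qShapovalov p l
                (SpectralDecomposition.lamD (κ.targetZ z lam) (κ.targetLam z lam)))) • w') := by
  exact ⟨SpectralDecomposition.rational_theorem, SpectralDecomposition.trig_theorem⟩
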